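/- Let $d\in\mathbf N$, let $s,\sigma>0$ satisfy $s+\sigma\ge 1$, and let $A$ be a real $d\times d$ matrix. Points of $\mathbf R^{2d}$ are written $(x,\xi)$ with $x,\xi\in\mathbf R^d$, and $f\lesssim g$ means $f\le Cg$ for some constant $C$. Weights. A weight is a function $\omega>0$ on $\mathbf R^{2d}$ with $\omega,1/\omega\in L^\infty_{\mathrm{loc}}$. The class $\mathscr P_{s,\sigma}(\mathbf R^{2d})$ consists of all weights $\omega$ that are submultiplicative, i.e. $\omega(-X)=\omega(X)$ and $\omega(X+Y)\lesssim\omega(X)\omega(Y)$ for $X,Y\in\mathbf R^{2d}$, and that satisfy, for some $r>0$, $$e^{-r(|x|^{1/s}+|\xi|^{1/\sigma})}\lesssim\omega(x,\xi)\lesssim e^{r(|x|^{1/s}+|\xi|^{1/\sigma})}.$$ Symbols. $\Gamma^{\sigma,s;0}_{(\omega)}(\mathbf R^{2d})$ is the set of all $f\in C^\infty(\mathbf R^{2d})$ such that for every $h>0$ $$\sup_{\alpha,\beta\in\mathbf N^d}\ \sup_{x,\xi\in\mathbf R^d}\frac{|\partial_x^\alpha\partial_\xi^\beta f(x,\xi)|}{h^{|\alpha+\beta|}\,\alpha!^{\sigma}\,\beta!^{s}\,\omega(x,\xi)}<\infty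 .$$ Test functions and distributions. For $h>0$ and $\varphi\in C^\infty(\mathbf R^{2d})$ let $$\|\varphi\|_h=\sup\frac{|x^{\alpha_1}\xi^{\alpha_2}\partial_x^{\beta_1}\partial_\xi^{\beta_2}\varphi(x,\xi)|}{h^{|\alpha_1+\alpha_2+\beta_1+\beta_2|}\,\alpha_1!^{s}\,\alpha_2!^{\sigma}\,\beta_1!^{\sigma}\,\beta_2!^{s}},$$ the supremum being over $\alpha_1,\alpha_2,\beta_1,\beta_2\in\mathbf N^d$ and $x,\xi\in\mathbf R^d$. The Gelfand–Shilov space $\Sigma^{\sigma,s}_{s,\sigma}(\mathbf R^{2d})$ (resp. $\mathcal S^{\sigma,s}_{s,\sigma}(\mathbf R^{2d})$) is the set of $\varphi$ with $\|\varphi\|_h<\infty$ for every $h>0$ (resp. for some $h>0$), with the projective (resp. inductive) limit topology; $(\Sigma^{\sigma,s}_{s,\sigma})'$ and $(\mathcal S^{\sigma,s}_{s,\sigma})'$ are the dual spaces. A distribution $a$ in one of these duals belongs to $\Gamma^{\sigma,s;0}_{(\omega)}$ if there is $f\in\Gamma^{\sigma,s;0}_{(\omega)}(\mathbf R^{2d})$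 such that $f\varphi$ is integrable and $a(\varphi)=\int f\varphi$ for all test functions $\varphi$. The operator. With $D=-i\partial$, $e^{i\langle AD_\xi,D_x\rangle}$ is the Fourier multiplier with symbol $e^{i\langle Az,\zeta\rangle}$, where $(\zeta,z)$ are the dual variables of $(x,\xi)$. It maps each of the two test function spaces into itself, and on the duals it is defined by transposition, $(e^{i\langle AD_\xi,D_x\rangle}a)(\varphi)=a(e^{i\langle AD_\xi,D_x\rangle}\varphi)$. Theorem. Let $\omega\in\mathscr P_{s,\sigma}(\mathbf R^{2d})$, and let $a\in(\Sigma^{\sigma,s}_{s,\sigma})'(\mathbf R^{2d})$ or, when $s+\sigma=1$, $a\in(\mathcal S^{\sigma,s}_{s,\sigma})'(\mathbf R^{2d})$. Then $e^{i\langle AD_\xi,D_x\rangle}a$ is a well-defined element of the same dual space, and $$a\in\Gamma^{\sigma,s;0}_{(\omega)}(\mathbf R^{2d})\quad\Longleftrightarrow\quad e^{i\langle AD_\xi,D_x\rangle}a\in\Gamma^{\sigma,s;0}_{(\omega)}(\mathbf R^{2d}).$$ -/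

import Mathlib

open scoped ENNReal NNReal FourierTransform Matrix
open MeasureTheory

namespace GelfandShilov

noncomputable section

/-- Phase space `ℝ^{2d}` with its Euclidean structure. The coordinates `Sum.inl j` of a point `X`
are those of `x ∈ ℝ^d`, the coordinates `Sum.inr j` are those of `ξ ∈ ℝ^d`. -/
abbrev Phase (d : ℕ) : Type := EuclideanSpace ℝ (Fin d ⊕ Fin d)

variable {d : ℕ}

/-- The component `x` of `X = (x, ξ)`. -/
def xPart (X : Phase d) : EuclideanSpace ℝ (Fin d) := WithLp.toLp 2 fun j => X (Sum.inl j)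

/-- The component `ξ` of `X = (x, ξ)`. -/
def xiPart (X : Phase d) : EuclideanSpace ℝ (Fin d) := WithLp.toLp 2 fun j => X (Sum.inr j)

/-! ### Multi-indices and derivatives -/

/-- The length `|α|` of a multi-index. -/
def mlen (α : Fin d → ℕ) : ℕ := ∑ j, α j

/-- The factorial `α!` of a multi-index, as a real number. -/
def mfact (α : Fin d → ℕ) : ℝ := ∏ j, (Nat.factorial (α j) : ℝ)

/-- The monomial `x ^ α`. -/
def mpow (x : EuclideanSpace ℝ (Fin d)) (α : Fin d → ℕ) : ℝ := ∏ j, x j ^ α j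

/-- The partial derivative of `f` in the coordinate `i`. -/
def pderiv (i : Fin d ⊕ Fin d) (f : Phase d → ℂ) : Phase d → ℂ :=
  fun X => fderiv ℝ f X (EuclideanSpace.single i 1)

/-- The iterated partial derivative of multi-order `α` in the coordinates `ι 0, …, ι (d-1)`. -/
def iterPderiv (ι : Fin d → Fin d ⊕ Fin d) (α : Fin d → ℕ) (f : Phase d → ℂ) : Phase d → ℂ :=
  (List.finRange d).foldr (fun j g => (pderiv (ι j))^[α j] g) f

/-- The derivative `∂_x^α ∂_ξ^β f`. -/
def mderiv (α β : Fin d → ℕ) (f : Phase d → ℂ) : Phase d → ℂ :=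
  iterPderiv Sum.inl α (iterPderiv Sum.inr β f)

/-! ### Weights and symbol classes -/

/-- A weight: a positive function `ω` with `ω, 1/ω ∈ L^∞_loc`. -/
structure IsWeight (ω : Phase d → ℝ) : Prop where
  pos : ∀ X, 0 < ω X
  memLp : ∀ K : Set (Phase d), IsCompact K → MemLp ω ∞ (volume.restrict K)
  memLp_inv : ∀ K : Set (Phase d), IsCompact K → MemLp (fun X => (ω X)⁻¹) ∞ (volume.restrict K)

/-- `ω` is submultiplicative: it is even, and `ω (X + Y) ≤ C ω(X) ω(Y)` for some constant `C`. -/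
structure IsSubmultiplicative (ω : Phase d → ℝ) : Prop where
  even : ∀ X, ω (-X) = ω X
  submul : ∃ C : ℝ, ∀ X Y, ω (X + Y) ≤ C * ω X * ω Y

/-- The function `|x|^{1/s} + |ξ|^{1/σ}`. -/
def gauge (s σ : ℝ) (X : Phase d) : ℝ := ‖xPart X‖ ^ (1 / s) + ‖xiPart X‖ ^ (1 / σ)

/-- The class `𝒫_{s,σ}(ℝ^{2d})` of submultiplicative weights `ω` such that
`e^{-r(|x|^{1/s} + |ξ|^{1/σ})} ≲ ω(x,ξ) ≲ e^{r(|x|^{1/s} + |ξ|^{1/σ})}` for some `r > 0`. -/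
structure IsWeightP (s σ : ℝ) (ω : Phase d → ℝ) : Prop where
  weight : IsWeight ω
  submultiplicative : IsSubmultiplicative ω
  bounds : ∃ r : ℝ, 0 < r ∧ ∃ C : ℝ, ∀ X,
    Real.exp (-r * gauge s σ X) ≤ C * ω X ∧ ω X ≤ C * Real.exp (r * gauge s σ X)

/-- The norm of `Γ^{σ,s;h}_{(ω)}(ℝ^{2d})`. -/
def gammaNorm (s σ h : ℝ) (ω : Phase d → ℝ) (f : Phase d → ℂ) : ℝ≥0∞ :=
  ⨆ (α : Fin d → ℕ) (β : Fin d → ℕ) (X : Phase d),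
    ENNReal.ofReal (‖mderiv α β f X‖ /
      (h ^ (mlen α + mlen β) * mfact α ^ σ * mfact β ^ s * ω X))

/-- The symbol class `Γ^{σ,s;0}_{(ω)}(ℝ^{2d})`: smooth functions whose norm in
`Γ^{σ,s;h}_{(ω)}(ℝ^{2d})` is finite for every `h > 0`. -/
def IsGammaZero (s σ : ℝ) (ω : Phase d → ℝ) (f : Phase d → ℂ) : Prop :=
  ContDiff ℝ (⊤ : ℕ∞) f ∧ ∀ h : ℝ, 0 < h → gammaNorm s σ h ω f < ∞

/-! ### Gelfand–Shilov spaces and their duals -/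

/-- The norm given by the supremum of
`|x^{α₁} ξ^{α₂} ∂_x^{β₁} ∂_ξ^{β₂} f(x,ξ)| /
  (h^{|α₁+α₂+β₁+β₂|} α₁!^{s₁} α₂!^{s₂} β₁!^{σ₁} β₂!^{σ₂})`. -/
def gsNorm (s₁ s₂ σ₁ σ₂ h : ℝ) (f : Phase d → ℂ) : ℝ≥0∞ :=
  ⨆ (α₁ : Fin d → ℕ) (α₂ : Fin d → ℕ) (β₁ : Fin d → ℕ) (β₂ : Fin d → ℕ) (X : Phase d),
    ENNReal.ofReal (|mpow (xPart X) α₁ * mpow (xiPart X) α₂| * ‖mderiv β₁ β₂ f X‖ /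
      (h ^ (mlen α₁ + mlen α₂ + mlen β₁ + mlen β₂) *
        mfact α₁ ^ s₁ * mfact α₂ ^ s₂ * mfact β₁ ^ σ₁ * mfact β₂ ^ σ₂))

theorem contDiff_pderiv {f : Phase d → ℂ} (hf : ContDiff ℝ (⊤ : ℕ∞) f) (i : Fin d ⊕ Fin d) :
    ContDiff ℝ (⊤ : ℕ∞) (pderiv i f) := by
  unfold pderiv
  exact (hf.fderiv_right (m := ((⊤ : ℕ∞) : WithTop ℕ∞)) (by simp)).clm_apply contDiff_const

theorem contDiff_pderiv_iterate {f : Phase d → ℂ} (hf : ContDiff ℝ (⊤ : ℕ∞) f)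
    (i : Fin d ⊕ Fin d) (n : ℕ) : ContDiff ℝ (⊤ : ℕ∞) ((pderiv i)^[n] f) := by
  induction n with
  | zero => simpa using hf
  | succ n ih => rw [Function.iterate_succ_apply']; exact contDiff_pderiv ih i

theorem pderiv_iterate_lin {f g : Phase d → ℂ} (hf : ContDiff ℝ (⊤ : ℕ∞) f)
    (hg : ContDiff ℝ (⊤ : ℕ∞) g) (c : ℂ) (i : Fin d ⊕ Fin d) (n : ℕ) :
    (pderiv i)^[n] (f + c • g) = (pderiv i)^[n] f + c • (pderiv i)^[n] g := by
  induction n with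
  | zero => rfl
  | succ n ih =>
    simp only [Function.iterate_succ_apply', ih]
    have h1 := (contDiff_pderiv_iterate hf i n).differentiable (by simp)
    have h2 := (contDiff_pderiv_iterate hg i n).differentiable (by simp)
    funext X
    simp only [pderiv, Pi.add_apply, Pi.smul_apply]
    rw [fderiv_add (h1 X) ((h2 X).const_smul c), fderiv_const_smul (h2 X)]
    rfl

theorem contDiff_iterPderiv {f : Phase d → ℂ} (hf : ContDiff ℝ (⊤ : ℕ∞) f)
    (ι : Fin d → Fin d ⊕ Fin d) (α : Fin d → ℕ) : ContDiff ℝ (⊤ : ℕ∞) (iterPderiv ι α f) := by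
  unfold iterPderiv
  induction List.finRange d with
  | nil => simpa using hf
  | cons j l ih => exact contDiff_pderiv_iterate ih _ _

theorem iterPderiv_lin {f g : Phase d → ℂ} (hf : ContDiff ℝ (⊤ : ℕ∞) f)
    (hg : ContDiff ℝ (⊤ : ℕ∞) g) (c : ℂ) (ι : Fin d → Fin d ⊕ Fin d) (α : Fin d → ℕ) :
    iterPderiv ι α (f + c • g) = iterPderiv ι α f + c • iterPderiv ι α g := by
  have key : ∀ l : List (Fin d), ∀ u : Phase d → ℂ, ContDiff ℝ (⊤ : ℕ∞) u →
      ContDiff ℝ (⊤ : ℕ∞) (l.foldr (fun j g => (pderiv (ι j))^[α j] g) u) := by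
    intro l u hu
    induction l with
    | nil => simpa using hu
    | cons j l ih => exact contDiff_pderiv_iterate ih _ _
  unfold iterPderiv
  induction List.finRange d with
  | nil => rfl
  | cons j l ih =>
    simp only [List.foldr_cons]
    rw [ih]
    exact pderiv_iterate_lin (key l f hf) (key l g hg) c _ _

theorem mderiv_lin {f g : Phase d → ℂ} (hf : ContDiff ℝ (⊤ : ℕ∞) f)
    (hg : ContDiff ℝ (⊤ : ℕ∞) g) (c : ℂ) (α β : Fin d → ℕ) :
    mderiv α β (f + c • g) = mderiv α β f + c • mderiv α β g := by
  unfold mderiv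
  rw [iterPderiv_lin hf hg, iterPderiv_lin (contDiff_iterPderiv hf _ _)
    (contDiff_iterPderiv hg _ _)]

theorem mfact_pos (α : Fin d → ℕ) : 0 < mfact α :=
  Finset.prod_pos fun j _ => by exact_mod_cast Nat.factorial_pos (α j)

theorem gsNorm_lin_lt_top {s₁ s₂ σ₁ σ₂ h : ℝ} (hh : 0 < h) {f g : Phase d → ℂ}
    (hf : ContDiff ℝ (⊤ : ℕ∞) f) (hg : ContDiff ℝ (⊤ : ℕ∞) g) (c : ℂ)
    (hfn : gsNorm s₁ s₂ σ₁ σ₂ h f < ∞) (hgn : gsNorm s₁ s₂ σ₁ σ₂ h g < ∞) :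
    gsNorm s₁ s₂ σ₁ σ₂ h (f + c • g) < ∞ := by
  have hbd : gsNorm s₁ s₂ σ₁ σ₂ h (f + c • g) ≤
      gsNorm s₁ s₂ σ₁ σ₂ h f + ENNReal.ofReal ‖c‖ * gsNorm s₁ s₂ σ₁ σ₂ h g := by
    refine iSup_le fun α₁ => iSup_le fun α₂ => iSup_le fun β₁ => iSup_le fun β₂ =>
      iSup_le fun X => ?_
    have hf' : _ ≤ gsNorm s₁ s₂ σ₁ σ₂ h f := le_iSup_of_le α₁ <| le_iSup_of_le α₂ <|
      le_iSup_of_le β₁ <| le_iSup_of_le β₂ <| le_iSup_of_le X le_rfl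
    have hg' : _ ≤ gsNorm s₁ s₂ σ₁ σ₂ h g := le_iSup_of_le α₁ <| le_iSup_of_le α₂ <|
      le_iSup_of_le β₁ <| le_iSup_of_le β₂ <| le_iSup_of_le X le_rfl
    refine le_trans ?_ (add_le_add hf' (mul_le_mul_right hg' _))
    have hden : 0 < h ^ (mlen α₁ + mlen α₂ + mlen β₁ + mlen β₂) *
        mfact α₁ ^ s₁ * mfact α₂ ^ s₂ * mfact β₁ ^ σ₁ * mfact β₂ ^ σ₂ := by
      have h1 := mfact_pos α₁
      have h2 := mfact_pos α₂
      have h3 := mfact_pos β₁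
      have h4 := mfact_pos β₂
      positivity
    rw [← ENNReal.ofReal_mul (norm_nonneg c), ← ENNReal.ofReal_add (by positivity)
      (by positivity)]
    apply ENNReal.ofReal_le_ofReal
    rw [mderiv_lin hf hg, mul_div_assoc', ← add_div]
    gcongr
    rw [Pi.add_apply, Pi.smul_apply, smul_eq_mul]
    calc _ ≤ |mpow (xPart X) α₁ * mpow (xiPart X) α₂| *
          (‖mderiv β₁ β₂ f X‖ + ‖c‖ * ‖mderiv β₁ β₂ g X‖) := by
            gcongr
            exact (norm_add_le _ _).trans (by rw [norm_mul])
      _ = _ := by ring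
  refine hbd.trans_lt (ENNReal.add_lt_top.2 ⟨hfn, ENNReal.mul_lt_top ENNReal.ofReal_lt_top hgn⟩)

theorem gsNorm_anti {s₁ s₂ σ₁ σ₂ h h' : ℝ} (hh : 0 < h) (hle : h ≤ h') (f : Phase d → ℂ) :
    gsNorm s₁ s₂ σ₁ σ₂ h' f ≤ gsNorm s₁ s₂ σ₁ σ₂ h f := by
  refine iSup_mono fun α₁ => iSup_mono fun α₂ => iSup_mono fun β₁ => iSup_mono fun β₂ =>
    iSup_mono fun X => ENNReal.ofReal_le_ofReal ?_
  have h1 := mfact_pos α₁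
  have h2 := mfact_pos α₂
  have h3 := mfact_pos β₁
  have h4 := mfact_pos β₂
  gcongr

theorem gsNorm_zero (s₁ s₂ σ₁ σ₂ h : ℝ) : gsNorm (d := d) s₁ s₂ σ₁ σ₂ h 0 = 0 := by
  have hz : ∀ α β : Fin d → ℕ, mderiv α β (0 : Phase d → ℂ) = 0 := by
    intro α β
    have h0 : ContDiff ℝ (⊤ : ℕ∞) (0 : Phase d → ℂ) := contDiff_const
    have := mderiv_lin h0 h0 (-1) α β
    simpa using this
  simp [gsNorm, hz]

/-- The Gelfand–Shilov space `Σ_{s₁,s₂}^{σ₁,σ₂}(ℝ^{d+d})` (Beurling type): the smooth functions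
with finite norm for every `h > 0`. -/
def SigmaSpace (d : ℕ) (s₁ s₂ σ₁ σ₂ : ℝ) : Submodule ℂ (Phase d → ℂ) where
  carrier := {f | ContDiff ℝ (⊤ : ℕ∞) f ∧ ∀ h : ℝ, 0 < h → gsNorm s₁ s₂ σ₁ σ₂ h f < ∞}
  zero_mem' := ⟨contDiff_const, fun h _ => by rw [gsNorm_zero]; simp⟩
  add_mem' := fun {f g} hf hg => ⟨hf.1.add hg.1, fun h hh => by
    simpa using gsNorm_lin_lt_top hh hf.1 hg.1 1 (hf.2 h hh) (hg.2 h hh)⟩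
  smul_mem' := fun c f hf => ⟨contDiff_const.smul hf.1, fun h hh => by
    have h0 : gsNorm s₁ s₂ σ₁ σ₂ h (0 : Phase d → ℂ) < ∞ := by rw [gsNorm_zero]; simp
    have hz : ContDiff ℝ (⊤ : ℕ∞) (0 : Phase d → ℂ) := contDiff_const
    simpa using gsNorm_lin_lt_top hh hz hf.1 c h0 (hf.2 h hh)⟩

/-- The Gelfand–Shilov space `𝒮_{s₁,s₂}^{σ₁,σ₂}(ℝ^{d+d})` (Roumieu type): the smooth functions
with finite norm for some `h > 0`. -/
def SSpace (d : ℕ) (s₁ s₂ σ₁ σ₂ : ℝ) : Submodule ℂ (Phase d → ℂ) where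
  carrier := {f | ContDiff ℝ (⊤ : ℕ∞) f ∧ ∃ h : ℝ, 0 < h ∧ gsNorm s₁ s₂ σ₁ σ₂ h f < ∞}
  zero_mem' := ⟨contDiff_const, 1, one_pos, by rw [gsNorm_zero]; simp⟩
  add_mem' := fun {f g} hf hg => by
    obtain ⟨hf, h, hh, hfn⟩ := hf
    obtain ⟨hg, k, hk, hgn⟩ := hg
    refine ⟨hf.add hg, max h k, lt_max_of_lt_left hh, ?_⟩
    simpa using gsNorm_lin_lt_top (lt_max_of_lt_left hh) hf hg 1
      ((gsNorm_anti hh (le_max_left h k) f).trans_lt hfn)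
      ((gsNorm_anti hk (le_max_right h k) g).trans_lt hgn)
  smul_mem' := fun c f hf => by
    obtain ⟨hf, h, hh, hfn⟩ := hf
    refine ⟨contDiff_const.smul hf, h, hh, ?_⟩
    have h0 : gsNorm s₁ s₂ σ₁ σ₂ h (0 : Phase d → ℂ) < ∞ := by rw [gsNorm_zero]; simp
    have hz : ContDiff ℝ (⊤ : ℕ∞) (0 : Phase d → ℂ) := contDiff_const
    simpa using gsNorm_lin_lt_top hh hz hf c h0 hfn

/-- The distribution space `(Σ_{s₁,s₂}^{σ₁,σ₂})'(ℝ^{d+d})`: linear forms that are continuous for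
the projective limit topology, i.e. bounded for the norm with some parameter `h > 0`. -/
abbrev SigmaDual (d : ℕ) (s₁ s₂ σ₁ σ₂ : ℝ) : Type :=
  {a : SigmaSpace d s₁ s₂ σ₁ σ₂ →ₗ[ℂ] ℂ //
    ∃ h : ℝ, 0 < h ∧ ∃ C : ℝ≥0, ∀ φ : SigmaSpace d s₁ s₂ σ₁ σ₂,
      ‖a φ‖ₑ ≤ C * gsNorm s₁ s₂ σ₁ σ₂ h (φ : Phase d → ℂ)}

/-- The distribution space `(𝒮_{s₁,s₂}^{σ₁,σ₂})'(ℝ^{d+d})`: linear forms that are continuous for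
the inductive limit topology, i.e. for every `h > 0` bounded on the subspace where the norm with
parameter `h` is finite. -/
abbrev SDual (d : ℕ) (s₁ s₂ σ₁ σ₂ : ℝ) : Type :=
  {a : SSpace d s₁ s₂ σ₁ σ₂ →ₗ[ℂ] ℂ //
    ∀ h : ℝ, 0 < h → ∃ C : ℝ≥0, ∀ φ : SSpace d s₁ s₂ σ₁ σ₂,
      gsNorm s₁ s₂ σ₁ σ₂ h (φ : Phase d → ℂ) < ∞ →
      ‖a φ‖ₑ ≤ C * gsNorm s₁ s₂ σ₁ σ₂ h (φ : Phase d → ℂ)}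

/-! ### The operator `e^{i⟨A D_ξ, D_x⟩}` -/

/-- `e^{i⟨A D_ξ, D_x⟩} φ`, with `D = -i ∂`, for a rapidly decreasing smooth function `φ`: the
Fourier multiplier with symbol `e^{i⟨A z, ζ⟩}`, where `(ζ, z)` are the dual variables of `(x, ξ)`.
The Fourier transform `𝓕` has the kernel `e^{-2πi⟨X, Ξ⟩}`, so that `(ζ, z) = 2π Ξ`. -/
def expADD (A : Matrix (Fin d) (Fin d) ℝ) (φ : Phase d → ℂ) : Phase d → ℂ :=
  𝓕⁻ fun Ξ : Phase d =>
    Complex.exp (Complex.I *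
      (((2 * Real.pi) ^ 2 *
        ((A *ᵥ fun k => Ξ (Sum.inr k)) ⬝ᵥ fun j => Ξ (Sum.inl j)) : ℝ) : ℂ)) * 𝓕 φ Ξ

/-- `b = e^{i⟨A D_ξ, D_x⟩} a` for linear forms `a`, `b` on a space `V` of test functions:
`e^{i⟨A D_ξ, D_x⟩}` maps `V` into `V` and `b φ = a (e^{i⟨A D_ξ, D_x⟩} φ)` for all `φ ∈ V`. (The
symbol is an even function, so the operator is its own transpose for `(f, g) ↦ ∫ f g`.) -/
def IsExpADD {V : Submodule ℂ (Phase d → ℂ)} (A : Matrix (Fin d) (Fin d) ℝ)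
    (a b : V →ₗ[ℂ] ℂ) : Prop :=
  ∀ φ : V, ∃ ψ : V, (ψ : Phase d → ℂ) = expADD A φ ∧ b φ = a ψ

/-- The linear form `a` on the space `V` of test functions belongs to `Γ^{σ,s;0}_{(ω)}(ℝ^{2d})`,
i.e. it is `φ ↦ ∫ f φ` for some function `f` in that class. -/
def MemGammaZero {V : Submodule ℂ (Phase d → ℂ)} (s σ : ℝ) (ω : Phase d → ℝ)
    (a : V →ₗ[ℂ] ℂ) : Prop :=
  ∃ f : Phase d → ℂ, IsGammaZero s σ ω f ∧ ∀ φ : V,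
    Integrable (fun X => f X * (φ : Phase d → ℂ) X) ∧ a φ = ∫ X, f X * (φ : Phase d → ℂ) X

end

end GelfandShilov

open scoped ENNReal NNReal FourierTransform Matrix SchwartzMap LineDeriv
open MeasureTheory

namespace GelfandShilov

noncomputable section

variable {d : ℕ}

/-! Write T_A for the operator on Schwartz functions (`TS`). It is a Fourier multiplier with an even
symbol of modulus one. Hence T_{A+B} = T_A T_B, T_A is its own transpose for the bilinear pairing,
and it commutes with derivatives and translations. Two facts therefore suffice: T_A is continuous on
the test functions, and its transpose maps functionals given by symbols to functionals given by
symbols. The converse implication is the direct one for -A (`IsInvariant.exists_unique_and_iff`).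

Continuity (`exists_GS_TS`). A coordinate passes through T_A at the price of a first-order term: x_j
T_A u = T_A (x_j u + i Σ_k A_jk ∂_{ξ_k} u), and similarly for ξ_k. The norms fit this, since x_j and
∂_{ξ_k} both cost factorials to the power s, while ξ_k and ∂_{x_j} both cost factorials to the power
σ. The Leibniz terms, in which a coordinate destroys a derivative, produce an integer factor that
two further orders of factorials absorb when s + σ ≥ 1 (`prop_step`). The constants stay bounded if
s + σ > 1, or if the norm parameter is at least 1 (`exists_comP_le`). What remains is a sup norm,
controlled by finitely many Schwartz seminorms.

Beurling dual, s + σ > 1 (`MemGammaZero.sigma_op`). A symbol f is cut into pieces f φ(· - Y) with a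
window φ of integral 1. Each piece, moved to the origin, is a test function with bounds proportional
to ω(Y), and so is its image under T_A. Translating the images back and integrating over Y gives a
function in the same class (`window_integral`), and Fubini shows that it represents the transposed
functional. For s + σ = 1 the Beurling space is trivial if d ≥ 1 (`SigmaSpace_eq_bot`), and A = 0 if
d = 0.

Roumieu dual, s + σ = 1. The new symbol is the exponential series of the generator i⟨A D_ξ, D_x⟩
applied to f. The n-th iterate costs n!^{s+σ} = n!, which the exponential series divides out, and
the freedom to take h small makes the series geometric (`IsGammaZero.expGen`). The series represents
the functional because t ↦ ∫ f T_{tA} u has a convergent Taylor expansion (`integral_expGen_mul`).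
This needs f to grow slower than every exponential e^{ε(|x|^{1/s} + |ξ|^{1/σ})}, as a test function
decays only at some rate. That growth bound follows from the continuity of the functional: an
interpolation between the symbol estimates (small h, fixed growth) and the continuity estimates
(large parameter, arbitrarily small growth) gives both advantages at once (`gam_exp_of_dual`). -/

/-! ### Derivatives along words -/

/-- The iterated partial derivative along a word of coordinates. -/
def dl (l : List (Fin d ⊕ Fin d)) (f : Phase d → ℂ) : Phase d → ℂ := l.foldr pderiv f

/-- The monomial given by a word of coordinates. -/
def xl (m : List (Fin d ⊕ Fin d)) (X : Phase d) : ℝ := (m.map fun i => X i).prod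

/-- The number of letters of a given kind in a word. -/
def cnt (b : Bool) (l : List (Fin d ⊕ Fin d)) : ℕ := l.countP fun i => i.isLeft == b

@[simp] theorem dl_nil (f : Phase d → ℂ) : dl [] f = f := rfl

@[simp] theorem dl_cons (i : Fin d ⊕ Fin d) (l : List (Fin d ⊕ Fin d)) (f : Phase d → ℂ) :
    dl (i :: l) f = pderiv i (dl l f) := rfl

theorem dl_append (l l' : List (Fin d ⊕ Fin d)) (f : Phase d → ℂ) :
    dl (l ++ l') f = dl l (dl l' f) := List.foldr_append

@[simp] theorem xl_nil (X : Phase d) : xl [] X = 1 := rfl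

@[simp] theorem xl_cons (i : Fin d ⊕ Fin d) (m : List (Fin d ⊕ Fin d)) (X : Phase d) :
    xl (i :: m) X = X i * xl m X := by simp [xl]

theorem xl_append (m m' : List (Fin d ⊕ Fin d)) (X : Phase d) :
    xl (m ++ m') X = xl m X * xl m' X := by simp [xl]

theorem xl_perm {m m' : List (Fin d ⊕ Fin d)} (h : m.Perm m') (X : Phase d) :
    xl m X = xl m' X := (h.map _).prod_eq

@[simp] theorem cnt_nil (b : Bool) : cnt b ([] : List (Fin d ⊕ Fin d)) = 0 := rfl

theorem cnt_cons (b : Bool) (i : Fin d ⊕ Fin d) (l : List (Fin d ⊕ Fin d)) :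
    cnt b (i :: l) = cnt b l + if i.isLeft = b then 1 else 0 := by
  simp [cnt, List.countP_cons]

theorem cnt_append (b : Bool) (l l' : List (Fin d ⊕ Fin d)) :
    cnt b (l ++ l') = cnt b l + cnt b l' := by simp [cnt]

theorem cnt_perm (b : Bool) {l l' : List (Fin d ⊕ Fin d)} (h : l.Perm l') :
    cnt b l = cnt b l' := h.countP_eq _

theorem cnt_add_cnt (b : Bool) (l : List (Fin d ⊕ Fin d)) : cnt b l + cnt (!b) l = l.length := by
  induction l with
  | nil => rfl
  | cons i l ih =>
    rw [cnt_cons, cnt_cons, List.length_cons, ← ih]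
    rcases i with i | i <;> cases b <;> simp <;> omega

theorem cnt_true_add_cnt_false (l : List (Fin d ⊕ Fin d)) :
    cnt true l + cnt false l = l.length := cnt_add_cnt true l

theorem contDiff_dl {f : Phase d → ℂ} (hf : ContDiff ℝ (⊤ : ℕ∞) f) (l : List (Fin d ⊕ Fin d)) :
    ContDiff ℝ (⊤ : ℕ∞) (dl l f) := by
  induction l with
  | nil => exact hf
  | cons i l ih => exact contDiff_pderiv ih i

theorem pderiv_add {f g : Phase d → ℂ} (hf : ContDiff ℝ (⊤ : ℕ∞) f)
    (hg : ContDiff ℝ (⊤ : ℕ∞) g) (i : Fin d ⊕ Fin d) :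
    pderiv i (f + g) = pderiv i f + pderiv i g := by
  simpa using pderiv_iterate_lin hf hg 1 i 1

theorem pderiv_smul {f : Phase d → ℂ} (hf : ContDiff ℝ (⊤ : ℕ∞) f) (c : ℂ)
    (i : Fin d ⊕ Fin d) : pderiv i (c • f) = c • pderiv i f := by
  funext X
  have h := hf.differentiable (by simp) X
  simp only [pderiv, Pi.smul_apply]
  rw [fderiv_const_smul h]
  rfl

theorem dl_add {f g : Phase d → ℂ} (hf : ContDiff ℝ (⊤ : ℕ∞) f)
    (hg : ContDiff ℝ (⊤ : ℕ∞) g) (l : List (Fin d ⊕ Fin d)) :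
    dl l (f + g) = dl l f + dl l g := by
  induction l with
  | nil => rfl
  | cons i l ih => rw [dl_cons, ih, pderiv_add (contDiff_dl hf l) (contDiff_dl hg l)]; rfl

theorem dl_smul {f : Phase d → ℂ} (hf : ContDiff ℝ (⊤ : ℕ∞) f) (c : ℂ)
    (l : List (Fin d ⊕ Fin d)) : dl l (c • f) = c • dl l f := by
  induction l with
  | nil => rfl
  | cons i l ih => rw [dl_cons, ih, pderiv_smul (contDiff_dl hf l)]; rfl

theorem dl_zero (l : List (Fin d ⊕ Fin d)) : dl l (0 : Phase d → ℂ) = 0 := by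
  simpa using dl_smul (f := (0 : Phase d → ℂ)) contDiff_const 0 l

theorem dl_sum {κ : Type*} (t : Finset κ) {f : κ → Phase d → ℂ}
    (hf : ∀ k, ContDiff ℝ (⊤ : ℕ∞) (f k)) (l : List (Fin d ⊕ Fin d)) :
    dl l (∑ k ∈ t, f k) = ∑ k ∈ t, dl l (f k) := by
  classical
  induction t using Finset.induction_on with
  | empty => simp [dl_zero]
  | insert k t hk ih =>
    rw [Finset.sum_insert hk, Finset.sum_insert hk, dl_add (hf k), ih]
    have : (∑ k ∈ t, f k) = fun X => ∑ k ∈ t, f k X := by ext; simp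
    rw [this]
    exact ContDiff.sum fun i _ => hf i

theorem pderiv_comm {f : Phase d → ℂ} (hf : ContDiff ℝ (⊤ : ℕ∞) f) (i j : Fin d ⊕ Fin d) :
    pderiv i (pderiv j f) = pderiv j (pderiv i f) := by
  have h1 : Differentiable ℝ (fderiv ℝ f) :=
    (hf.fderiv_right (m := ((⊤ : ℕ∞) : WithTop ℕ∞)) (by simp)).differentiable (by simp)
  have key : ∀ (i j : Fin d ⊕ Fin d) (X : Phase d), pderiv i (pderiv j f) X =
      fderiv ℝ (fderiv ℝ f) X (EuclideanSpace.single i 1) (EuclideanSpace.single j 1) := by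
    intro i j X
    unfold pderiv
    rw [fderiv_clm_apply (h1 X) (differentiableAt_const _)]
    simp
  funext X
  rw [key, key]
  have h2 : ContDiff ℝ 2 f := hf.of_le (WithTop.coe_le_coe.2 le_top)
  exact (h2.contDiffAt.isSymmSndFDerivAt (by simp)).eq _ _

theorem dl_perm {f : Phase d → ℂ} (hf : ContDiff ℝ (⊤ : ℕ∞) f)
    {l l' : List (Fin d ⊕ Fin d)} (h : l.Perm l') : dl l f = dl l' f := by
  induction h with
  | nil => rfl
  | cons i _ ih => rw [dl_cons, dl_cons, ih]
  | swap i j l => simp only [dl_cons]; exact pderiv_comm (contDiff_dl hf l) _ _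
  | trans _ _ h1 h2 => rw [h1, h2]

theorem pderiv_mul {f g : Phase d → ℂ} (hf : ContDiff ℝ (⊤ : ℕ∞) f)
    (hg : ContDiff ℝ (⊤ : ℕ∞) g) (i : Fin d ⊕ Fin d) :
    pderiv i (f * g) = pderiv i f * g + f * pderiv i g := by
  funext X
  have h1 := hf.differentiable (by simp) X
  have h2 := hg.differentiable (by simp) X
  simp only [pderiv, Pi.mul_apply, Pi.add_apply]
  rw [fderiv_mul h1 h2]
  simp
  ring

/-- The word of coordinates belonging to a pair of multi-indices. -/
def canon (α β : Fin d → ℕ) : List (Fin d ⊕ Fin d) :=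
  ((List.finRange d).flatMap fun j => List.replicate (α j) (Sum.inl j)) ++
    (List.finRange d).flatMap fun j => List.replicate (β j) (Sum.inr j)

theorem iterPderiv_eq_dl (ι : Fin d → Fin d ⊕ Fin d) (α : Fin d → ℕ) (f : Phase d → ℂ) :
    iterPderiv ι α f = dl ((List.finRange d).flatMap fun j => List.replicate (α j) (ι j)) f := by
  unfold iterPderiv
  induction List.finRange d with
  | nil => rfl
  | cons j t ih =>
    rw [List.foldr_cons, List.flatMap_cons, dl_append, ih]
    generalize dl _ f = g
    induction α j with
    | zero => rfl
    | succ n ih => rw [Function.iterate_succ_apply', ih, List.replicate_succ, dl_cons]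

theorem mderiv_eq_dl (α β : Fin d → ℕ) (f : Phase d → ℂ) : mderiv α β f = dl (canon α β) f := by
  rw [mderiv, iterPderiv_eq_dl, iterPderiv_eq_dl, canon, dl_append]

/-- Counting letters in words uses the boolean equality of the sum type, and the permutation and
erasure lemmas require it to be lawful. -/
instance : LawfulBEq (Fin d ⊕ Fin d) where
  eq_of_beq {a b} h := by
    rcases a with a | a <;> rcases b with b | b
    · exact congrArg _ (eq_of_beq (α := Fin d) h)
    · exact absurd (show false = true from h) Bool.false_ne_true
    · exact absurd (show false = true from h) Bool.false_ne_true
    · exact congrArg _ (eq_of_beq (α := Fin d) h)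
  rfl {a} := by
    rcases a with a | a
    · exact beq_self_eq_true (α := Fin d) a
    · exact beq_self_eq_true (α := Fin d) a

theorem count_flatMap_replicate (ι : Fin d → Fin d ⊕ Fin d) (α : Fin d → ℕ)
    (p : Fin d ⊕ Fin d) :
    (((List.finRange d).flatMap fun j => List.replicate (α j) (ι j)).count p) =
      ∑ j, if ι j = p then α j else 0 := by
  rw [List.count_flatMap, ← List.ofFn_eq_map, List.sum_ofFn]
  refine Finset.sum_congr rfl fun j _ => ?_
  simp only [Function.comp_apply]
  rw [List.count_replicate]
  by_cases h : ι j = p <;> simp [h]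

/-- Bridge from words to multi-indices: derivatives of smooth functions and monomials depend on a
word only up to permutation. -/
theorem perm_canon (l : List (Fin d ⊕ Fin d)) :
    l.Perm (canon (fun j => l.count (Sum.inl j)) fun j => l.count (Sum.inr j)) := by
  rw [List.perm_iff_count]
  intro p
  rw [canon, List.count_append, count_flatMap_replicate, count_flatMap_replicate]
  rcases p with p | p <;> simp

theorem cnt_canon_true (α β : Fin d → ℕ) : cnt true (canon α β) = mlen α := by
  rw [canon, cnt_append, cnt, cnt, List.countP_flatMap, List.countP_flatMap, ← List.ofFn_eq_map,
    ← List.ofFn_eq_map, List.sum_ofFn, List.sum_ofFn]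
  simp [mlen, List.countP_replicate]

theorem cnt_canon_false (α β : Fin d → ℕ) : cnt false (canon α β) = mlen β := by
  rw [canon, cnt_append, cnt, cnt, List.countP_flatMap, List.countP_flatMap, ← List.ofFn_eq_map,
    ← List.ofFn_eq_map, List.sum_ofFn, List.sum_ofFn]
  simp [mlen, List.countP_replicate]

theorem length_canon (α β : Fin d → ℕ) : (canon α β).length = mlen α + mlen β := by
  rw [← cnt_true_add_cnt_false, cnt_canon_true, cnt_canon_false]

theorem xl_canon (α β : Fin d → ℕ) (X : Phase d) :
    xl (canon α β) X = mpow (xPart X) α * mpow (xiPart X) β := by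
  rw [canon, xl_append]
  have key : ∀ (ι : Fin d → Fin d ⊕ Fin d) (γ : Fin d → ℕ),
      xl ((List.finRange d).flatMap fun j => List.replicate (γ j) (ι j)) X =
        ∏ j, X (ι j) ^ γ j := by
    intro ι γ
    have : ∀ t : List (Fin d), xl (t.flatMap fun j => List.replicate (γ j) (ι j)) X =
        (t.map fun j => X (ι j) ^ γ j).prod := by
      intro t
      induction t with
      | nil => rfl
      | cons j t ih =>
        rw [List.flatMap_cons, xl_append, ih, List.map_cons, List.prod_cons]
        simp [xl]
    rw [this, ← List.ofFn_eq_map, List.prod_ofFn]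
  rw [key, key]
  rfl

theorem mfact_le_factorial (α : Fin d → ℕ) : mfact α ≤ ((mlen α).factorial : ℝ) := by
  unfold mfact mlen
  exact_mod_cast Nat.le_of_dvd (Nat.factorial_pos _) (Nat.prod_factorial_dvd_factorial_sum _ _)

/-- The quotient is a multinomial coefficient, one of the terms of the expansion of (1 + ⋯ + 1)^|α|
= d^|α|. The base d + 1 keeps the factor at least 1 also for d = 0. -/
theorem factorial_le_mfact (α : Fin d → ℕ) :
    ((mlen α).factorial : ℝ) ≤ (d + 1 : ℝ) ^ mlen α * mfact α := by
  have h1 : (mlen α).factorial = (∏ j, (α j).factorial) * Nat.multinomial Finset.univ α :=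
    (Nat.multinomial_spec _ _).symm
  have h2 : Nat.multinomial Finset.univ α ≤ d ^ mlen α := by
    have := Finset.sum_pow_eq_sum_piAntidiag (Finset.univ : Finset (Fin d)) (fun _ => (1 : ℕ))
      (mlen α)
    simp only [Finset.sum_const, Finset.card_univ, Fintype.card_fin, smul_eq_mul, mul_one,
      one_pow, Finset.prod_const_one, Nat.cast_id] at this
    rw [this]
    exact Finset.single_le_sum (f := fun k => Nat.multinomial Finset.univ k)
      (fun _ _ => Nat.zero_le _) (by simp [mlen])
  have h3 : (mlen α).factorial ≤ (∏ j, (α j).factorial) * d ^ mlen α :=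
    h1.le.trans (Nat.mul_le_mul_left _ h2)
  have h4 : ((mlen α).factorial : ℝ) ≤ mfact α * (d : ℝ) ^ mlen α := by
    unfold mfact; exact_mod_cast h3
  refine h4.trans ?_
  rw [mul_comm]
  have := mfact_pos α
  gcongr
  linarith

/-! ### Powers of factorials -/

/-- The power `n! ^ x` of a factorial. -/
def fr (x : ℝ) (n : ℕ) : ℝ := (n.factorial : ℝ) ^ x

theorem fr_pos (x : ℝ) (n : ℕ) : 0 < fr x n :=
  Real.rpow_pos_of_pos (by exact_mod_cast n.factorial_pos) x

theorem fr_nonneg (x : ℝ) (n : ℕ) : 0 ≤ fr x n := (fr_pos x n).le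

@[simp] theorem fr_zero (x : ℝ) : fr x 0 = 1 := by simp [fr]

theorem fr_one (n : ℕ) : fr 1 n = n.factorial := by simp [fr]

theorem fr_succ (x : ℝ) (n : ℕ) : fr x (n + 1) = (n + 1 : ℝ) ^ x * fr x n := by
  unfold fr
  rw [Nat.factorial_succ, Nat.cast_mul, Real.mul_rpow (by positivity) (by positivity)]
  push_cast
  rfl

theorem fr_add_exp (x y : ℝ) (n : ℕ) : fr (x + y) n = fr x n * fr y n := by
  unfold fr
  rw [Real.rpow_add (by exact_mod_cast n.factorial_pos)]

theorem fr_mono {x : ℝ} (hx : 0 ≤ x) {m n : ℕ} (h : m ≤ n) : fr x m ≤ fr x n :=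
  Real.rpow_le_rpow (by positivity) (by exact_mod_cast Nat.factorial_le h) hx

theorem fr_mul_le {x : ℝ} (hx : 0 ≤ x) (m n : ℕ) : fr x m * fr x n ≤ fr x (m + n) := by
  unfold fr
  rw [← Real.mul_rpow (by positivity) (by positivity)]
  refine Real.rpow_le_rpow (by positivity) ?_ hx
  exact_mod_cast Nat.le_of_dvd (Nat.factorial_pos _) (Nat.factorial_mul_factorial_dvd_factorial_add m n)

theorem factorial_add_le (m n : ℕ) :
    ((m + n).factorial : ℝ) ≤ 2 ^ (m + n) * (m.factorial * n.factorial) := by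
  have h : (m + n).factorial = (m + n).choose n * m.factorial * n.factorial :=
    (Nat.add_choose_mul_factorial_mul_factorial m n).symm
  have h2 : (m + n).choose n ≤ 2 ^ (m + n) := Nat.choose_le_two_pow _ _
  rw [h]
  push_cast
  have h3 : ((m + n).choose n : ℝ) ≤ 2 ^ (m + n) := by exact_mod_cast h2
  rw [mul_assoc]
  gcongr

theorem fr_add_le {x : ℝ} (hx : 0 ≤ x) (m n : ℕ) :
    fr x (m + n) ≤ ((2 : ℝ) ^ x) ^ (m + n) * (fr x m * fr x n) := by
  unfold fr
  have h := Real.rpow_le_rpow (by positivity) (factorial_add_le m n) hx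
  rw [Real.mul_rpow (by positivity) (by positivity),
    Real.mul_rpow (by positivity) (by positivity)] at h
  rwa [← Real.rpow_natCast, ← Real.rpow_mul (by norm_num), mul_comm x, Real.rpow_mul (by norm_num),
    Real.rpow_natCast]

theorem mfact_rpow_le {x : ℝ} (hx : 0 ≤ x) (α : Fin d → ℕ) : mfact α ^ x ≤ fr x (mlen α) :=
  Real.rpow_le_rpow (mfact_pos α).le (mfact_le_factorial α) hx

theorem fr_le_mfact_rpow {x : ℝ} (hx : 0 ≤ x) (α : Fin d → ℕ) :
    fr x (mlen α) ≤ ((d + 1 : ℝ) ^ x) ^ mlen α * mfact α ^ x := by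
  unfold fr
  have h := Real.rpow_le_rpow (by positivity) (factorial_le_mfact α) hx
  rw [Real.mul_rpow (by positivity) (mfact_pos α).le] at h
  rwa [← Real.rpow_natCast, ← Real.rpow_mul (by positivity), mul_comm x,
    Real.rpow_mul (by positivity), Real.rpow_natCast]

/-! ### Quantitative versions of the function classes -/

/-- The derivatives of `f` satisfy Gevrey bounds with parameter `h` relative to the weight `w`. -/
def Gam (s σ h C : ℝ) (w : Phase d → ℝ) (f : Phase d → ℂ) : Prop :=
  ∀ (l : List (Fin d ⊕ Fin d)) (X : Phase d),
    ‖dl l f X‖ ≤ C * (h ^ l.length * (fr σ (cnt true l) * fr s (cnt false l))) * w X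

/-- The Gelfand–Shilov bounds with parameter `h`. -/
def GS (s σ h C : ℝ) (f : Phase d → ℂ) : Prop :=
  ∀ (m l : List (Fin d ⊕ Fin d)) (X : Phase d),
    |xl m X| * ‖dl l f X‖ ≤ C * (h ^ (m.length + l.length) *
      (fr s (cnt true m + cnt false l) * fr σ (cnt false m + cnt true l)))

theorem Gam.mono {s σ h h' C C' : ℝ} {w w' : Phase d → ℝ} {f : Phase d → ℂ}
    (H : Gam s σ h C w f) (hh : 0 ≤ h) (hle : h ≤ h')
    (hw0 : ∀ X, 0 ≤ w X) (hw : ∀ X, C * w X ≤ C' * w' X) : Gam s σ h' C' w' f := by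
  intro l X
  have h1 := fr_nonneg σ (cnt true l)
  have h2 := fr_nonneg s (cnt false l)
  have h3 := hw0 X
  have h4 := hw X
  have h5 : 0 ≤ C' * w' X := by
    by_cases hC0 : 0 ≤ C
    · exact le_trans (mul_nonneg hC0 h3) h4
    -- Even for negative `C` the estimate for the empty word forces `C * w X` to be nonnegative.
    · have := (norm_nonneg _).trans (H [] X)
      simp at this
      exact this.trans h4
  calc _ ≤ _ := H l X
    _ = (h ^ l.length * (fr σ (cnt true l) * fr s (cnt false l))) * (C * w X) := by ring
    _ ≤ (h ^ l.length * (fr σ (cnt true l) * fr s (cnt false l))) * (C' * w' X) := by gcongr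
    _ ≤ (h' ^ l.length * (fr σ (cnt true l) * fr s (cnt false l))) * (C' * w' X) := by gcongr
    _ = _ := by ring

/-- The Leibniz rule has 2^|l| terms, which accounts for the doubled parameter. Products of
factorials are bounded by the factorial of the sum, so nothing else is lost. -/
theorem Gam.mul {s σ h C C' : ℝ} {w w' : Phase d → ℝ} {f g : Phase d → ℂ}
    (hs : 0 ≤ s) (hσ : 0 ≤ σ) (hh : 0 ≤ h) (hf : ContDiff ℝ (⊤ : ℕ∞) f)
    (hg : ContDiff ℝ (⊤ : ℕ∞) g) (hw : ∀ X, 0 ≤ C * w X) (hw' : ∀ X, 0 ≤ C' * w' X)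
    (H : Gam s σ h C w f) (H' : Gam s σ h C' w' g) :
    Gam s σ (2 * h) (C * C') (fun X => w X * w' X) (f * g) := by
  -- With arbitrary derivatives already on both factors, the claim is stable under removing the
  -- letter that acts first: it splits the product into two products of the same form.
  have key : ∀ (l u v : List (Fin d ⊕ Fin d)) (X : Phase d),
      ‖dl l (dl u f * dl v g) X‖ ≤
        2 ^ l.length * ((C * w X) * (C' * w' X) * (h ^ (l.length + u.length + v.length) *
        (fr σ (cnt true l + cnt true u + cnt true v) *
          fr s (cnt false l + cnt false u + cnt false v)))) := by
    intro l
    induction l using List.reverseRecOn with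
    | nil =>
      intro u v X
      simp only [dl_nil, Pi.mul_apply, norm_mul, List.length_nil, pow_zero, one_mul, cnt_nil,
        zero_add]
      have a1 := fr_nonneg σ (cnt true u)
      have a2 := fr_nonneg s (cnt false u)
      have a3 := fr_nonneg σ (cnt true v)
      have a4 := fr_nonneg s (cnt false v)
      have b1 := hw X
      have b2 := hw' X
      calc _ ≤ (C * (h ^ u.length * (fr σ (cnt true u) * fr s (cnt false u))) * w X) *
            (C' * (h ^ v.length * (fr σ (cnt true v) * fr s (cnt false v))) * w' X) :=
            mul_le_mul (H u X) (H' v X) (norm_nonneg _) ((norm_nonneg _).trans (H u X))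
        _ = (C * w X) * (C' * w' X) * (h ^ (u.length + v.length) *
            ((fr σ (cnt true u) * fr σ (cnt true v)) *
              (fr s (cnt false u) * fr s (cnt false v)))) := by ring
        _ ≤ _ := by
          have c1 := fr_mul_le hσ (cnt true u) (cnt true v)
          have c2 := fr_mul_le hs (cnt false u) (cnt false v)
          have c3 := fr_nonneg σ (cnt true u + cnt true v)
          gcongr
    | append_singleton l i ih =>
      intro u v X
      have e : dl (l ++ [i]) (dl u f * dl v g) =
          dl l (dl (i :: u) f * dl v g) +
          dl l (dl u f * dl (i :: v) g) := by
        rw [dl_append, dl_cons, dl_nil, pderiv_mul (contDiff_dl hf u) (contDiff_dl hg v),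
          ← dl_cons, ← dl_cons]
        exact dl_add ((contDiff_dl hf _).mul (contDiff_dl hg _))
          ((contDiff_dl hf _).mul (contDiff_dl hg _)) l
      rw [e, Pi.add_apply]
      refine (norm_add_le _ _).trans ((add_le_add (ih _ _ X) (ih _ _ X)).trans (le_of_eq ?_))
      simp only [cnt_append, cnt_cons, cnt_nil, List.length_append, List.length_cons,
        List.length_nil, zero_add]
      have e1 : ∀ a b c k : ℕ, a + (b + k) + c = a + k + b + c := by intros; omega
      have e2 : ∀ a b c k : ℕ, a + b + (c + k) = a + k + b + c := by intros; omega
      simp only [e1, e2]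
      ring
  intro l X
  have := key l [] [] X
  simp only [dl_nil, List.length_nil, cnt_nil, add_zero] at this
  refine this.trans (le_of_eq ?_)
  rw [mul_pow]
  ring

theorem one_le_rpow_succ {x : ℝ} (hx : 0 ≤ x) (d : ℕ) : (1 : ℝ) ≤ (d + 1 : ℝ) ^ x :=
  Real.one_le_rpow (by linarith [(Nat.cast_nonneg d : (0 : ℝ) ≤ d)]) hx

/-! ### Word bounds compared with the multi-index norms. -/

/-- Powers of x and derivatives in ξ carry the same exponent s, powers of ξ and derivatives in x the
same exponent σ. Their factorials may be merged, and in this direction the merging costs nothing. -/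
theorem GS_of_gsNorm {s σ h : ℝ} (hs : 0 ≤ s) (hσ : 0 ≤ σ) (hh : 0 < h) {f : Phase d → ℂ}
    (hf : ContDiff ℝ (⊤ : ℕ∞) f) (hn : gsNorm s σ σ s h f < ∞) :
    GS s σ h (gsNorm s σ σ s h f).toReal f := by
  intro m l X
  rw [dl_perm hf (perm_canon l), xl_perm (perm_canon m), cnt_perm _ (perm_canon l),
    cnt_perm _ (perm_canon m), cnt_perm _ (perm_canon l), cnt_perm _ (perm_canon m),
    (perm_canon l).length_eq, (perm_canon m).length_eq]
  generalize (fun j => m.count (Sum.inl j)) = α₁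
  generalize (fun j => m.count (Sum.inr j)) = α₂
  generalize (fun j => l.count (Sum.inl j)) = β₁
  generalize (fun j => l.count (Sum.inr j)) = β₂
  rw [xl_canon, ← mderiv_eq_dl, length_canon, length_canon, cnt_canon_true, cnt_canon_true,
    cnt_canon_false, cnt_canon_false]
  have h1 := mfact_pos α₁
  have h2 := mfact_pos α₂
  have h3 := mfact_pos β₁
  have h4 := mfact_pos β₂
  have hle : _ ≤ gsNorm s σ σ s h f := le_iSup_of_le α₁ <| le_iSup_of_le α₂ <|
      le_iSup_of_le β₁ <| le_iSup_of_le β₂ <| le_iSup_of_le X le_rfl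
  have hle2 := ENNReal.toReal_mono hn.ne hle
  rw [ENNReal.toReal_ofReal (by positivity), div_le_iff₀ (by positivity)] at hle2
  refine hle2.trans ?_
  have a1 := (mul_le_mul (mfact_rpow_le hs α₁) (mfact_rpow_le hs β₂) (by positivity)
    (fr_nonneg _ _)).trans (fr_mul_le hs _ _)
  have a2 := (mul_le_mul (mfact_rpow_le hσ α₂) (mfact_rpow_le hσ β₁) (by positivity)
    (fr_nonneg _ _)).trans (fr_mul_le hσ _ _)
  calc _ = (gsNorm s σ σ s h f).toReal * (h ^ (mlen α₁ + mlen α₂ + (mlen β₁ + mlen β₂)) *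
        ((mfact α₁ ^ s * mfact β₂ ^ s) * (mfact α₂ ^ σ * mfact β₁ ^ σ))) := by
        rw [add_assoc (mlen α₁ + mlen α₂)]; ring
    _ ≤ _ := by
        gcongr
        exact fr_nonneg _ _

/-- Splitting the factorial of a sum costs powers of 2, splitting |α|! into α! costs powers of d +
1. Both losses are geometric and are moved into the parameter. -/
theorem gsNorm_le_of_GS {s σ h C : ℝ} (hs : 0 ≤ s) (hσ : 0 ≤ σ) (hh : 0 < h) (hC : 0 ≤ C)
    {f : Phase d → ℂ} (H : GS s σ h C f) :
    gsNorm s σ σ s ((2 * (d + 1 : ℝ)) ^ (s + σ) * h) f ≤ ENNReal.ofReal C := by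
  refine iSup_le fun α₁ => iSup_le fun α₂ => iSup_le fun β₁ => iSup_le fun β₂ =>
      iSup_le fun X => ENNReal.ofReal_le_ofReal ?_
  have h1 := mfact_pos α₁
  have h2 := mfact_pos α₂
  have h3 := mfact_pos β₁
  have h4 := mfact_pos β₂
  rw [div_le_iff₀ (by positivity)]
  have H1 := H (canon α₁ α₂) (canon β₁ β₂) X
  rw [xl_canon, ← mderiv_eq_dl, length_canon, length_canon, cnt_canon_true, cnt_canon_true,
    cnt_canon_false, cnt_canon_false] at H1
  refine H1.trans ?_
  have key : ∀ {x : ℝ}, 0 ≤ x → ∀ (α β : Fin d → ℕ), fr x (mlen α + mlen β) ≤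
      ((2 * (d + 1 : ℝ)) ^ x) ^ (mlen α + mlen β) * (mfact α ^ x * mfact β ^ x) := by
    intro x hx α β
    have := mfact_pos α
    have := mfact_pos β
    have := fr_nonneg x (mlen β)
    calc _ ≤ _ := fr_add_le hx _ _
      _ ≤ ((2 : ℝ) ^ x) ^ (mlen α + mlen β) * ((((d + 1 : ℝ) ^ x) ^ mlen α * mfact α ^ x) *
            (((d + 1 : ℝ) ^ x) ^ mlen β * mfact β ^ x)) := by
          gcongr <;> exact fr_le_mfact_rpow hx _
      _ = _ := by rw [Real.mul_rpow (by norm_num) (by positivity)]; ring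
  have b1 := key hs α₁ β₂
  have b2 := key hσ α₂ β₁
  set D : ℝ := 2 * (d + 1 : ℝ) with hD
  have hD1 : 1 ≤ D := by rw [hD]; linarith [(Nat.cast_nonneg d : (0 : ℝ) ≤ d)]
  have c1 : 1 ≤ D ^ s := Real.one_le_rpow hD1 hs
  have c2 : 1 ≤ D ^ σ := Real.one_le_rpow hD1 hσ
  calc _ ≤ C * (h ^ (mlen α₁ + mlen α₂ + (mlen β₁ + mlen β₂)) *
        (((D ^ s) ^ (mlen α₁ + mlen β₂) * (mfact α₁ ^ s * mfact β₂ ^ s)) *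
         ((D ^ σ) ^ (mlen α₂ + mlen β₁) * (mfact α₂ ^ σ * mfact β₁ ^ σ)))) := by
        have := fr_nonneg σ (mlen α₂ + mlen β₁)
        gcongr
    _ ≤ C * (h ^ (mlen α₁ + mlen α₂ + (mlen β₁ + mlen β₂)) *
        (((D ^ s) ^ (mlen α₁ + mlen α₂ + mlen β₁ + mlen β₂) * (mfact α₁ ^ s * mfact β₂ ^ s)) *
         ((D ^ σ) ^ (mlen α₁ + mlen α₂ + mlen β₁ + mlen β₂) *
          (mfact α₂ ^ σ * mfact β₁ ^ σ)))) := by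
        have e1 := pow_le_pow_right₀ c1 (show mlen α₁ + mlen β₂ ≤
          mlen α₁ + mlen α₂ + mlen β₁ + mlen β₂ by omega)
        have e2 := pow_le_pow_right₀ c2 (show mlen α₂ + mlen β₁ ≤
          mlen α₁ + mlen α₂ + mlen β₁ + mlen β₂ by omega)
        gcongr
    _ = _ := by
        rw [Real.rpow_add (by positivity), mul_pow, mul_pow, ← add_assoc (mlen α₁ + mlen α₂)]
        ring

theorem Gam_of_gammaNorm {s σ h : ℝ} (hs : 0 ≤ s) (hσ : 0 ≤ σ) (hh : 0 < h) {ω : Phase d → ℝ}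
    (hω : ∀ X, 0 < ω X) {f : Phase d → ℂ} (hf : ContDiff ℝ (⊤ : ℕ∞) f)
    (hn : gammaNorm s σ h ω f < ∞) : Gam s σ h (gammaNorm s σ h ω f).toReal ω f := by
  intro l X
  rw [dl_perm hf (perm_canon l), cnt_perm _ (perm_canon l), cnt_perm _ (perm_canon l),
    (perm_canon l).length_eq]
  generalize (fun j => l.count (Sum.inl j)) = β₁
  generalize (fun j => l.count (Sum.inr j)) = β₂
  rw [← mderiv_eq_dl, length_canon, cnt_canon_true, cnt_canon_false]
  have h3 := mfact_pos β₁
  have h4 := mfact_pos β₂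
  have h5 := hω X
  have hle : _ ≤ gammaNorm s σ h ω f := 
      le_iSup_of_le β₁ <| le_iSup_of_le β₂ <| le_iSup_of_le X le_rfl
  have hle2 := ENNReal.toReal_mono hn.ne hle
  rw [ENNReal.toReal_ofReal (by positivity), div_le_iff₀ (by positivity)] at hle2
  refine hle2.trans ?_
  have a1 := mul_le_mul (mfact_rpow_le hσ β₁) (mfact_rpow_le hs β₂) (by positivity)
    (fr_nonneg _ _)
  calc _ = (gammaNorm s σ h ω f).toReal * (h ^ (mlen β₁ + mlen β₂) *
        (mfact β₁ ^ σ * mfact β₂ ^ s)) * ω X := by ring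
    _ ≤ _ := by gcongr

theorem gammaNorm_le_of_Gam {s σ h C : ℝ} (hs : 0 ≤ s) (hσ : 0 ≤ σ) (hh : 0 < h) (hC : 0 ≤ C)
    {ω : Phase d → ℝ} (hω : ∀ X, 0 < ω X) {f : Phase d → ℂ} (H : Gam s σ h C ω f) :
    gammaNorm s σ ((d + 1 : ℝ) ^ (s + σ) * h) ω f ≤ ENNReal.ofReal C := by
  refine iSup_le fun β₁ => iSup_le fun β₂ => iSup_le fun X => ENNReal.ofReal_le_ofReal ?_
  have h3 := mfact_pos β₁
  have h4 := mfact_pos β₂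
  have h5 := hω X
  rw [div_le_iff₀ (by positivity)]
  have H1 := H (canon β₁ β₂) X
  rw [← mderiv_eq_dl, length_canon, cnt_canon_true, cnt_canon_false] at H1
  refine H1.trans ?_
  have b1 := fr_le_mfact_rpow hσ β₁
  have b2 := fr_le_mfact_rpow hs β₂
  have c1 := one_le_rpow_succ hs d
  have c2 := one_le_rpow_succ hσ d
  set D : ℝ := (d + 1 : ℝ) with hD
  calc _ ≤ C * (h ^ (mlen β₁ + mlen β₂) *
        (((D ^ σ) ^ (mlen β₁) * mfact β₁ ^ σ) * ((D ^ s) ^ (mlen β₂) * mfact β₂ ^ s))) * ω X := by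
        have := fr_nonneg s (mlen β₂)
        gcongr
    _ ≤ C * (h ^ (mlen β₁ + mlen β₂) *
        (((D ^ σ) ^ (mlen β₁ + mlen β₂) * mfact β₁ ^ σ) *
          ((D ^ s) ^ (mlen β₁ + mlen β₂) * mfact β₂ ^ s))) * ω X := by
        gcongr <;> first | assumption | omega
    _ = _ := by
        rw [Real.rpow_add (by positivity), mul_pow, mul_pow]
        ring

/-- The geometric loss between words and multi-indices is harmless because all parameters `h > 0`
are admitted. -/
theorem isGammaZero_iff {s σ : ℝ} (hs : 0 ≤ s) (hσ : 0 ≤ σ) {ω : Phase d → ℝ}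
    (hω : ∀ X, 0 < ω X) {f : Phase d → ℂ} :
    IsGammaZero s σ ω f ↔ ContDiff ℝ (⊤ : ℕ∞) f ∧
      ∀ h : ℝ, 0 < h → ∃ C : ℝ, 0 ≤ C ∧ Gam s σ h C ω f := by
  refine ⟨fun H => ⟨H.1, fun h hh => ⟨_, ENNReal.toReal_nonneg,
    Gam_of_gammaNorm hs hσ hh hω H.1 (H.2 h hh)⟩⟩, fun H => ⟨H.1, fun h hh => ?_⟩⟩
  have hD : (0 : ℝ) < (d + 1 : ℝ) ^ (s + σ) := by positivity
  obtain ⟨C, hC, HC⟩ := H.2 (h / (d + 1 : ℝ) ^ (s + σ)) (by positivity)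
  have := gammaNorm_le_of_Gam hs hσ (by positivity) hC hω HC
  rw [mul_div_cancel₀ _ hD.ne'] at this
  exact this.trans_lt ENNReal.ofReal_lt_top

/-! ### The gauge -/

theorem gauge_nonneg (s σ : ℝ) (X : Phase d) : 0 ≤ gauge s σ X := by
  unfold gauge; positivity

theorem norm_xPart_sq (X : Phase d) : ‖xPart X‖ ^ 2 = ∑ j, X (Sum.inl j) ^ 2 := by
  rw [EuclideanSpace.norm_sq_eq]; simp [xPart]

theorem norm_xiPart_sq (X : Phase d) : ‖xiPart X‖ ^ 2 = ∑ j, X (Sum.inr j) ^ 2 := by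
  rw [EuclideanSpace.norm_sq_eq]; simp [xiPart]

theorem norm_sq_eq_add (X : Phase d) : ‖X‖ ^ 2 = ‖xPart X‖ ^ 2 + ‖xiPart X‖ ^ 2 := by
  rw [norm_xPart_sq, norm_xiPart_sq, EuclideanSpace.norm_sq_eq]; simp

theorem norm_le_add (X : Phase d) : ‖X‖ ≤ ‖xPart X‖ + ‖xiPart X‖ := by
  refine le_of_sq_le_sq ?_ (by positivity)
  rw [norm_sq_eq_add]
  nlinarith [norm_nonneg (xPart X), norm_nonneg (xiPart X)]

theorem abs_inl_le (X : Phase d) (j : Fin d) : |X (Sum.inl j)| ≤ ‖xPart X‖ := by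
  simpa [xPart] using PiLp.norm_apply_le (xPart X) j

theorem abs_inr_le (X : Phase d) (j : Fin d) : |X (Sum.inr j)| ≤ ‖xiPart X‖ := by
  simpa [xiPart] using PiLp.norm_apply_le (xiPart X) j

theorem xPart_add (X Y : Phase d) : xPart (X + Y) = xPart X + xPart Y := by ext; simp [xPart]

theorem xiPart_add (X Y : Phase d) : xiPart (X + Y) = xiPart X + xiPart Y := by ext; simp [xiPart]

theorem gauge_neg (s σ : ℝ) (X : Phase d) : gauge s σ (-X) = gauge s σ X := by
  have h1 : xPart (-X) = -xPart X := by ext; simp [xPart]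
  have h2 : xiPart (-X) = -xiPart X := by ext; simp [xiPart]
  simp [gauge, h1, h2]

theorem continuous_gauge {s σ : ℝ} (hs : 0 < s) (hσ : 0 < σ) :
    Continuous (gauge s σ : Phase d → ℝ) := by
  have h1 : Continuous (xPart : Phase d → _) := by
    refine (PiLp.continuous_toLp 2 _).comp ?_
    fun_prop
  have h2 : Continuous (xiPart : Phase d → _) := by
    refine (PiLp.continuous_toLp 2 _).comp ?_
    fun_prop
  refine Continuous.add ?_ ?_
  · exact h1.norm.rpow_const fun _ => Or.inr (by positivity)
  · exact h2.norm.rpow_const fun _ => Or.inr (by positivity)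

/-- The constant in the quasi-triangle inequality for the gauge. -/
def quasi (s σ : ℝ) : ℝ := 2 ^ (1 / s) + 2 ^ (1 / σ)

theorem quasi_pos (s σ : ℝ) : 0 < quasi s σ := by unfold quasi; positivity

theorem add_rpow_le {a b p : ℝ} (ha : 0 ≤ a) (hb : 0 ≤ b) (hp : 0 ≤ p) :
    (a + b) ^ p ≤ 2 ^ p * (a ^ p + b ^ p) := by
  have h1 : a + b ≤ 2 * max a b := by linarith [le_max_left a b, le_max_right a b]
  calc (a + b) ^ p ≤ (2 * max a b) ^ p := by gcongr
    _ = 2 ^ p * (max a b) ^ p := Real.mul_rpow (by norm_num) (le_max_of_le_left ha)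
    _ ≤ _ := by
      gcongr
      rcases max_choice a b with h | h <;> rw [h]
      · linarith [Real.rpow_nonneg hb p]
      · linarith [Real.rpow_nonneg ha p]

theorem gauge_add_le {s σ : ℝ} (hs : 0 < s) (hσ : 0 < σ) (X Y : Phase d) :
    gauge s σ (X + Y) ≤ quasi s σ * (gauge s σ X + gauge s σ Y) := by
  unfold gauge quasi
  rw [xPart_add, xiPart_add]
  have h1 : ‖xPart X + xPart Y‖ ^ (1 / s) ≤ 2 ^ (1 / s) * (‖xPart X‖ ^ (1 / s) + ‖xPart Y‖ ^ (1 / s)) :=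
    le_trans (by gcongr; exact norm_add_le _ _)
      (add_rpow_le (norm_nonneg _) (norm_nonneg _) (by positivity))
  have h2 : ‖xiPart X + xiPart Y‖ ^ (1 / σ) ≤
      2 ^ (1 / σ) * (‖xiPart X‖ ^ (1 / σ) + ‖xiPart Y‖ ^ (1 / σ)) :=
    le_trans (by gcongr; exact norm_add_le _ _)
      (add_rpow_le (norm_nonneg _) (norm_nonneg _) (by positivity))
  have a1 : (0 : ℝ) ≤ 2 ^ (1 / s) := by positivity
  have a2 : (0 : ℝ) ≤ 2 ^ (1 / σ) := by positivity
  have b1 : 0 ≤ ‖xPart X‖ ^ (1 / s) := by positivity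
  have b2 : 0 ≤ ‖xPart Y‖ ^ (1 / s) := by positivity
  have b3 : 0 ≤ ‖xiPart X‖ ^ (1 / σ) := by positivity
  have b4 : 0 ≤ ‖xiPart Y‖ ^ (1 / σ) := by positivity
  nlinarith [mul_nonneg a1 b3, mul_nonneg a1 b4, mul_nonneg a2 b1, mul_nonneg a2 b2]

/-! ### Exponentials of the gauge against monomials. -/

/-- One term of the exponential series controls its sum: if all terms were smaller than those of the
geometric series e^y/2 · 2^{-n}, whose sum is e^y, the total would be too small. The inequality for
y = (r/s) t^{1/s} is then raised to the power s. -/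
theorem exists_exp_le {s r t : ℝ} (hs : 0 < s) (hr : 0 < r) (ht : 0 ≤ t) :
    ∃ n : ℕ, Real.exp (r * t ^ (1 / s)) ≤ 2 ^ s * (((2 * r / s) ^ s) ^ n * t ^ n / fr s n) := by
  set y : ℝ := r / s * t ^ (1 / s) with hy
  have hy0 : 0 ≤ y := by positivity
  obtain ⟨n, hn⟩ : ∃ n : ℕ, Real.exp y ≤ 2 * (2 ^ n * y ^ n / n.factorial) := by
    by_contra! hcon
    have hs1 : HasSum (fun n : ℕ => y ^ n / n.factorial) (Real.exp y) := by
      rw [Real.exp_eq_exp_ℝ]; exact NormedSpace.expSeries_div_hasSum_exp y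
    have hs2 : HasSum (fun n : ℕ => Real.exp y / 2 / 2 ^ n) (Real.exp y) := hasSum_geometric_two' _
    have hlt : ∀ n : ℕ, y ^ n / n.factorial < Real.exp y / 2 / 2 ^ n := by
      intro n
      rw [lt_div_iff₀ (by positivity), lt_div_iff₀ (by positivity)]
      refine lt_of_eq_of_lt ?_ (hcon n)
      ring
    exact absurd (hasSum_lt (fun n => (hlt n).le) (hlt 0) hs1 hs2) (lt_irrefl _)
  refine ⟨n, ?_⟩
  have h1 := Real.rpow_le_rpow (by positivity) hn hs.le
  rw [← Real.exp_mul, hy] at h1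
  have e1 : r / s * t ^ (1 / s) * s = r * t ^ (1 / s) := by field_simp
  rw [e1] at h1
  refine h1.trans (le_of_eq ?_)
  have e2 : (2 : ℝ) ^ n * (r / s * t ^ (1 / s)) ^ n = (2 * r / s) ^ n * (t ^ (1 / s)) ^ n := by
    rw [mul_pow, div_pow, div_pow, mul_pow]; ring
  rw [e2, Real.mul_rpow (by norm_num) (by positivity), Real.div_rpow (by positivity) (by positivity),
    Real.mul_rpow (by positivity) (by positivity), fr]
  congr 3
  · rw [← Real.rpow_natCast, ← Real.rpow_natCast, ← Real.rpow_mul (by positivity),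
      ← Real.rpow_mul (by positivity), mul_comm s]
  · rw [← Real.rpow_natCast, ← Real.rpow_natCast, ← Real.rpow_mul (by positivity),
      ← Real.rpow_mul (by positivity)]
    congr 1
    field_simp

/-- The inequality y^n/n! ≤ e^y for y = (r/s) t^{1/s}, raised to the power s. -/
theorem pow_le_exp {s r t : ℝ} (hs : 0 < s) (hr : 0 < r) (ht : 0 ≤ t) (n : ℕ) :
    t ^ n ≤ ((s / r) ^ s) ^ n * fr s n * Real.exp (r * t ^ (1 / s)) := by
  have h0 := Real.pow_div_factorial_le_exp (r / s * t ^ (1 / s)) (by positivity) n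
  have h1 := Real.rpow_le_rpow (by positivity) h0 hs.le
  have e1 : r / s * t ^ (1 / s) * s = r * t ^ (1 / s) := by field_simp
  rw [← Real.exp_mul, e1, Real.div_rpow (by positivity) (by positivity), ← fr,
    div_le_iff₀ (fr_pos _ _), mul_pow, Real.mul_rpow (by positivity) (by positivity)] at h1
  have e2 : ((t ^ (1 / s)) ^ n) ^ s = t ^ n := by
    rw [← Real.rpow_natCast, ← Real.rpow_natCast, ← Real.rpow_mul (by positivity),
      ← Real.rpow_mul (by positivity)]
    congr 1
    field_simp
  have e3 : ((r / s) ^ n) ^ s * ((s / r) ^ s) ^ n = 1 := by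
    rw [← Real.rpow_natCast, ← Real.rpow_natCast, ← Real.rpow_mul (by positivity),
      ← Real.rpow_mul (by positivity), mul_comm s, ← Real.mul_rpow (by positivity) (by positivity)]
    have : r / s * (s / r) = 1 := by field_simp
    rw [this, Real.one_rpow]
  rw [e2] at h1
  calc t ^ n = (((r / s) ^ n) ^ s * t ^ n) * ((s / r) ^ s) ^ n := by
        rw [mul_right_comm, e3, one_mul]
    _ ≤ (Real.exp (r * t ^ (1 / s)) * fr s n) * ((s / r) ^ s) ^ n := by gcongr
    _ = _ := by ring

theorem xl_replicate (n : ℕ) (i : Fin d ⊕ Fin d) (X : Phase d) :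
    xl (List.replicate n i) X = X i ^ n := by simp [xl]

theorem cnt_replicate (b : Bool) (n : ℕ) (i : Fin d ⊕ Fin d) :
    cnt b (List.replicate n i) = if i.isLeft = b then n else 0 := by
  simp [cnt, List.countP_replicate]

theorem exists_norm_le_mul_abs {n : ℕ} (hn : 0 < n) (x : EuclideanSpace ℝ (Fin n)) :
    ∃ j, ‖x‖ ≤ (n + 1 : ℝ) * |x j| := by
  have : Nonempty (Fin n) := ⟨⟨0, hn⟩⟩
  obtain ⟨j, -, hj⟩ := Finset.exists_max_image Finset.univ (fun j => |x j|) Finset.univ_nonempty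
  refine ⟨j, ?_⟩
  refine le_of_sq_le_sq ?_ (by positivity)
  rw [EuclideanSpace.norm_sq_eq]
  calc _ ≤ ∑ _i : Fin n, |x j| ^ 2 := by
        refine Finset.sum_le_sum fun i _ => ?_
        rw [Real.norm_eq_abs]
        have := hj i (Finset.mem_univ _)
        gcongr
    _ = n * |x j| ^ 2 := by simp
    _ ≤ _ := by
        rw [mul_pow]
        gcongr
        nlinarith [(Nat.cast_nonneg n : (0 : ℝ) ≤ n)]

/-- The factor that measures decay of exponential type `r` by monomials. -/
def lam (d : ℕ) (s σ r : ℝ) : ℝ := (d + 1) * ((2 * r / s) ^ s + (2 * r / σ) ^ σ)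

theorem lam_pos (d : ℕ) {s σ r : ℝ} (hs : 0 < s) (hσ : 0 < σ) (hr : 0 < r) : 0 < lam d s σ r := by
  unfold lam; positivity

/-- The factor tends to 0 with the decay rate. Bounds with any parameter, however large, thus give
exponential decay at some rate. -/
theorem exists_lam_le (d : ℕ) {s σ h : ℝ} (hs : 0 < s) (hσ : 0 < σ) (hh : 0 < h) :
    ∃ r : ℝ, 0 < r ∧ lam d s σ r ≤ h := by
  have hc : Filter.Tendsto (lam d s σ) (nhds 0) (nhds 0) := by
    have : ContinuousAt (lam d s σ) 0 := by
      unfold lam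
      refine continuousAt_const.mul (ContinuousAt.add ?_ ?_)
      · exact ContinuousAt.rpow_const (by fun_prop) (Or.inr hs.le)
      · exact ContinuousAt.rpow_const (by fun_prop) (Or.inr hσ.le)
    have h0 : lam d s σ 0 = 0 := by simp [lam, hs.ne', hσ.ne']
    simpa [ContinuousAt, h0] using this
  have h1 := (hc.mono_left (nhdsWithin_le_nhds (s := Set.Ioi 0))).eventually_le_const hh
  obtain ⟨r, hr⟩ := (h1.and self_mem_nhdsWithin).exists
  exact ⟨r, hr.2, hr.1⟩

/-- A single monomial, chosen according to the point, dominates the exponential. It is a power of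
the largest x-coordinate times a power of the largest ξ-coordinate. No summation over monomials is
then needed to pass from monomial bounds to decay. -/
theorem exp_gauge_le {s σ r : ℝ} (hs : 0 < s) (hσ : 0 < σ) (hr : 0 < r) (X : Phase d) :
    ∃ m : List (Fin d ⊕ Fin d), Real.exp (r * gauge s σ X) ≤
      2 ^ (s + σ) * (lam d s σ r ^ m.length * |xl m X| /
        (fr s (cnt true m) * fr σ (cnt false m))) := by
  rcases Nat.eq_zero_or_pos d with rfl | hd
  · refine ⟨[], ?_⟩
    have : X = 0 := Subsingleton.elim _ _
    subst this
    have h1 : xPart (0 : Phase 0) = 0 := Subsingleton.elim _ _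
    have h2 : xiPart (0 : Phase 0) = 0 := Subsingleton.elim _ _
    have h3 : (0 : ℝ) ^ s⁻¹ = 0 := Real.zero_rpow (by positivity)
    have h4 : (0 : ℝ) ^ σ⁻¹ = 0 := Real.zero_rpow (by positivity)
    simp [gauge, h1, h2, h3, h4]
    exact Real.one_le_rpow (by norm_num) (by positivity)
  obtain ⟨n, hn⟩ := exists_exp_le hs hr (norm_nonneg (xPart X))
  obtain ⟨k, hk⟩ := exists_exp_le hσ hr (norm_nonneg (xiPart X))
  obtain ⟨i, hi⟩ := exists_norm_le_mul_abs hd (xPart X)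
  obtain ⟨j, hj⟩ := exists_norm_le_mul_abs hd (xiPart X)
  refine ⟨List.replicate n (Sum.inl i) ++ List.replicate k (Sum.inr j), ?_⟩
  rw [gauge, mul_add, Real.exp_add, xl_append, xl_replicate, xl_replicate, cnt_append, cnt_append,
    List.length_append, List.length_replicate, List.length_replicate]
  simp only [cnt_replicate, Sum.isLeft_inl, Sum.isLeft_inr, if_true, if_false, Bool.false_eq_true,
    Bool.true_eq_false, add_zero, zero_add]
  have e1 : xPart X i = X (Sum.inl i) := rfl
  have e2 : xiPart X j = X (Sum.inr j) := rfl
  rw [e1] at hi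
  rw [e2] at hj
  have p1 : 0 < (2 * r / s) ^ s := by positivity
  have p2 : 0 < (2 * r / σ) ^ σ := by positivity
  have q1 := fr_pos s n
  have q2 := fr_pos σ k
  have l1 : (2 * r / s) ^ s * (d + 1 : ℝ) ≤ lam d s σ r := by
    rw [lam, mul_comm]; gcongr; linarith
  have l2 : (2 * r / σ) ^ σ * (d + 1 : ℝ) ≤ lam d s σ r := by
    rw [lam, mul_comm]; gcongr; linarith
  have hlam := lam_pos d hs hσ hr
  have A : Real.exp (r * ‖xPart X‖ ^ (1 / s)) ≤
      2 ^ s * (lam d s σ r ^ n * |X (Sum.inl i)| ^ n / fr s n) := by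
    refine hn.trans ?_
    rw [← mul_pow, ← mul_pow]
    gcongr ?_ * (?_ ^ _ / _)
    calc _ ≤ (2 * r / s) ^ s * ((d + 1 : ℝ) * |X (Sum.inl i)|) := by gcongr
      _ = ((2 * r / s) ^ s * (d + 1 : ℝ)) * |X (Sum.inl i)| := by ring
      _ ≤ _ := by gcongr
  have B : Real.exp (r * ‖xiPart X‖ ^ (1 / σ)) ≤
      2 ^ σ * (lam d s σ r ^ k * |X (Sum.inr j)| ^ k / fr σ k) := by
    refine hk.trans ?_
    rw [← mul_pow, ← mul_pow]
    gcongr ?_ * (?_ ^ _ / _)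
    calc _ ≤ (2 * r / σ) ^ σ * ((d + 1 : ℝ) * |X (Sum.inr j)|) := by gcongr
      _ = ((2 * r / σ) ^ σ * (d + 1 : ℝ)) * |X (Sum.inr j)| := by ring
      _ ≤ _ := by gcongr
  refine (mul_le_mul A B (Real.exp_pos _).le (by positivity)).trans (le_of_eq ?_)
  rw [Real.rpow_add (by norm_num), abs_mul, abs_pow, abs_pow]
  field_simp
  ring

/-- Multiplication by the dominating monomial from `exp_gauge_le` is controlled by the hypothesis.
As its length is unknown, the factor raised to that length must not exceed 1, which is the condition
`hlam`. -/
theorem GS.gam {s σ h C r : ℝ} (hs : 0 < s) (hσ : 0 < σ) (hh : 0 ≤ h) (hC : 0 ≤ C) (hr : 0 < r)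
    (hlam : lam d s σ r * h * 2 ^ (s + σ) ≤ 1) {f : Phase d → ℂ} (H : GS s σ h C f) :
    Gam s σ (2 ^ (s + σ) * h) (2 ^ (s + σ) * C) (fun X => Real.exp (-r * gauge s σ X)) f := by
  intro l X
  obtain ⟨m, hm⟩ := exp_gauge_le hs hσ hr X
  have h1 := H m l X
  have q1 := fr_pos s (cnt true m)
  have q2 := fr_pos σ (cnt false m)
  have q3 := fr_nonneg s (cnt false l)
  have q4 := fr_nonneg σ (cnt true l)
  have hl := lam_pos d hs hσ hr
  beta_reduce
  rw [neg_mul, Real.exp_neg, ← div_eq_mul_inv, le_div_iff₀ (Real.exp_pos _)]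
  have t1 := fr_add_le hs.le (cnt true m) (cnt false l)
  have t2 := fr_add_le hσ.le (cnt false m) (cnt true l)
  have o1 : (1 : ℝ) ≤ 2 ^ s := Real.one_le_rpow (by norm_num) hs.le
  have o2 : (1 : ℝ) ≤ 2 ^ σ := Real.one_le_rpow (by norm_num) hσ.le
  have c1 := cnt_true_add_cnt_false m
  have c2 := cnt_true_add_cnt_false l
  have t3 := pow_le_pow_right₀ o1 (show cnt true m + cnt false l ≤ m.length + l.length by omega)
  have t4 := pow_le_pow_right₀ o2 (show cnt false m + cnt true l ≤ m.length + l.length by omega)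
  calc _ ≤ ‖dl l f X‖ * (2 ^ (s + σ) * (lam d s σ r ^ m.length * |xl m X| /
        (fr s (cnt true m) * fr σ (cnt false m)))) := by gcongr
    _ = 2 ^ (s + σ) * (lam d s σ r ^ m.length * (|xl m X| * ‖dl l f X‖) /
        (fr s (cnt true m) * fr σ (cnt false m))) := by ring
    _ ≤ 2 ^ (s + σ) * (lam d s σ r ^ m.length * (C * (h ^ (m.length + l.length) *
      (fr s (cnt true m + cnt false l) * fr σ (cnt false m + cnt true l)))) /
        (fr s (cnt true m) * fr σ (cnt false m))) := by gcongr
    _ ≤ 2 ^ (s + σ) * (lam d s σ r ^ m.length * (C * (h ^ (m.length + l.length) *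
      ((((2 : ℝ) ^ s) ^ (m.length + l.length) * (fr s (cnt true m) * fr s (cnt false l))) *
       (((2 : ℝ) ^ σ) ^ (m.length + l.length) * (fr σ (cnt false m) * fr σ (cnt true l)))))) /
        (fr s (cnt true m) * fr σ (cnt false m))) := by
        have u1 := t1.trans (mul_le_mul_of_nonneg_right t3 (by positivity))
        have u2 := t2.trans (mul_le_mul_of_nonneg_right t4 (by positivity))
        have := fr_nonneg σ (cnt false m + cnt true l)
        gcongr
    _ = (lam d s σ r * h * 2 ^ (s + σ)) ^ m.length * (2 ^ (s + σ) * C *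
        ((2 ^ (s + σ) * h) ^ l.length * (fr σ (cnt true l) * fr s (cnt false l)))) := by
        rw [Real.rpow_add (by norm_num)]
        field_simp
        ring
    _ ≤ 1 * (2 ^ (s + σ) * C *
        ((2 ^ (s + σ) * h) ^ l.length * (fr σ (cnt true l) * fr s (cnt false l)))) := by
        gcongr
        exact pow_le_one₀ (by positivity) hlam
    _ = _ := one_mul _

theorem abs_xl_le (m : List (Fin d ⊕ Fin d)) (X : Phase d) :
    |xl m X| ≤ ‖xPart X‖ ^ cnt true m * ‖xiPart X‖ ^ cnt false m := by
  induction m with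
  | nil => simp
  | cons i m ih =>
    rw [xl_cons, abs_mul, cnt_cons, cnt_cons]
    rcases i with i | i
    · calc _ ≤ ‖xPart X‖ * (‖xPart X‖ ^ cnt true m * ‖xiPart X‖ ^ cnt false m) := by
            gcongr; exact abs_inl_le X i
        _ = _ := by simp [pow_succ]; ring
    · calc _ ≤ ‖xiPart X‖ * (‖xPart X‖ ^ cnt true m * ‖xiPart X‖ ^ cnt false m) := by
            gcongr; exact abs_inr_le X i
        _ = _ := by simp [pow_succ]; ring

/-- The factor that bounds monomials by exponentials of type `r`. -/
def monoFac (s σ r : ℝ) : ℝ := (s / r) ^ s + (σ / r) ^ σ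

theorem monoFac_pos {s σ r : ℝ} (hs : 0 < s) (hσ : 0 < σ) (hr : 0 < r) : 0 < monoFac s σ r := by
  unfold monoFac; positivity

/-- Fast exponential decay makes the cost of monomials as small as desired, as the Beurling spaces
require. -/
theorem exists_monoFac_le {s σ h : ℝ} (hs : 0 < s) (hσ : 0 < σ) (hh : 0 < h) :
    ∃ r : ℝ, 0 < r ∧ monoFac s σ r ≤ h := by
  have hc : Filter.Tendsto (monoFac s σ) Filter.atTop (nhds 0) := by
    have h1 : ∀ {x : ℝ}, 0 < x → Filter.Tendsto (fun r : ℝ => (x / r) ^ x) Filter.atTop (nhds 0) := by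
      intro x hx
      have := (Filter.Tendsto.div_atTop (tendsto_const_nhds (x := x))
        (Filter.tendsto_id (α := ℝ))).rpow_const (p := x) (Or.inr hx.le)
      simpa [Real.zero_rpow hx.ne'] using this
    simpa using! (h1 hs).add (h1 hσ)
  obtain ⟨r, hr⟩ := ((hc.eventually_le_const hh).and (Filter.eventually_gt_atTop 0)).exists
  exact ⟨r, hr.2, hr.1⟩

theorem abs_xl_le_exp {s σ r : ℝ} (hs : 0 < s) (hσ : 0 < σ) (hr : 0 < r)
    (m : List (Fin d ⊕ Fin d)) (X : Phase d) :
    |xl m X| ≤ monoFac s σ r ^ m.length * (fr s (cnt true m) * fr σ (cnt false m)) *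
      Real.exp (r * gauge s σ X) := by
  have q1 := fr_nonneg s (cnt true m)
  have q2 := fr_nonneg σ (cnt false m)
  have l1 : (s / r) ^ s ≤ monoFac s σ r := by
    rw [monoFac]; have : 0 ≤ (σ / r) ^ σ := by positivity
    linarith
  have l2 : (σ / r) ^ σ ≤ monoFac s σ r := by
    rw [monoFac]; have : 0 ≤ (s / r) ^ s := by positivity
    linarith
  have hM := monoFac_pos hs hσ hr
  have hx := pow_le_exp hs hr (norm_nonneg (xPart X)) (cnt true m)
  have hxi := pow_le_exp hσ hr (norm_nonneg (xiPart X)) (cnt false m)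
  calc _ ≤ _ := abs_xl_le m X
    _ ≤ ((monoFac s σ r ^ cnt true m) * fr s (cnt true m) * Real.exp (r * ‖xPart X‖ ^ (1 / s))) *
        ((monoFac s σ r ^ cnt false m) * fr σ (cnt false m) * Real.exp (r * ‖xiPart X‖ ^ (1 / σ))) := by
        have v1 := hx.trans (show _ ≤ (monoFac s σ r ^ cnt true m) * fr s (cnt true m) *
          Real.exp (r * ‖xPart X‖ ^ (1 / s)) by gcongr)
        have v2 := hxi.trans (show _ ≤ (monoFac s σ r ^ cnt false m) * fr σ (cnt false m) *
          Real.exp (r * ‖xiPart X‖ ^ (1 / σ)) by gcongr)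
        gcongr
    _ = _ := by
        rw [gauge, mul_add, Real.exp_add, ← cnt_true_add_cnt_false m, pow_add]; ring

theorem Gam.gs {s σ h C r : ℝ} (hs : 0 < s) (hσ : 0 < σ) (hh : 0 ≤ h) (hC : 0 ≤ C) (hr : 0 < r)
    {f : Phase d → ℂ} (H : Gam s σ h C (fun X => Real.exp (-r * gauge s σ X)) f) :
    GS s σ (max h (monoFac s σ r)) C f := by
  intro m l X
  have h1 := abs_xl_le_exp hs hσ hr m X
  have h2 := H l X
  have q1 := fr_nonneg s (cnt true m)
  have q2 := fr_nonneg σ (cnt false m)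
  have q3 := fr_nonneg s (cnt false l)
  have q4 := fr_nonneg σ (cnt true l)
  have q5 := fr_nonneg s (cnt true m + cnt false l)
  have t1 := fr_mul_le hs.le (cnt true m) (cnt false l)
  have t2 := fr_mul_le hσ.le (cnt false m) (cnt true l)
  have hM := monoFac_pos hs hσ hr
  calc _ ≤ (monoFac s σ r ^ m.length * (fr s (cnt true m) * fr σ (cnt false m)) *
        Real.exp (r * gauge s σ X)) * (C * (h ^ l.length * (fr σ (cnt true l) * fr s (cnt false l))) *
          Real.exp (-r * gauge s σ X)) := by gcongr
    _ = C * (monoFac s σ r ^ m.length * h ^ l.length * ((fr s (cnt true m) * fr s (cnt false l)) *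
        (fr σ (cnt false m) * fr σ (cnt true l)))) * (Real.exp (r * gauge s σ X) *
          Real.exp (-r * gauge s σ X)) := by ring
    _ = C * (monoFac s σ r ^ m.length * h ^ l.length * ((fr s (cnt true m) * fr s (cnt false l)) *
        (fr σ (cnt false m) * fr σ (cnt true l)))) := by
        rw [← Real.exp_add]; simp
    _ ≤ C * ((max h (monoFac s σ r)) ^ m.length * (max h (monoFac s σ r)) ^ l.length *
        ((fr s (cnt true m + cnt false l)) * (fr σ (cnt false m + cnt true l)))) := by
        gcongr
        · exact le_max_right _ _
        · exact le_max_left _ _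
    _ = _ := by rw [pow_add]

theorem norm_pow_mul_exp_le {s σ r : ℝ} (hs : 0 < s) (hσ : 0 < σ) (hr : 0 < r) (k : ℕ) :
    ∃ C : ℝ, 0 ≤ C ∧ ∀ X : Phase d, ‖X‖ ^ k * Real.exp (-r * gauge s σ X) ≤ C := by
  refine ⟨2 ^ k * (((s / r) ^ s) ^ k * fr s k + ((σ / r) ^ σ) ^ k * fr σ k), ?_, fun X => ?_⟩
  · have := fr_nonneg s k
    have := fr_nonneg σ k
    positivity
  have hx := pow_le_exp hs hr (norm_nonneg (xPart X)) k
  have hxi := pow_le_exp hσ hr (norm_nonneg (xiPart X)) k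
  have h1 : ‖X‖ ^ k ≤ 2 ^ k * (‖xPart X‖ ^ k + ‖xiPart X‖ ^ k) := by
    refine (pow_le_pow_left₀ (norm_nonneg _) (norm_le_add X) k).trans ?_
    have := add_rpow_le (norm_nonneg (xPart X)) (norm_nonneg (xiPart X)) (Nat.cast_nonneg k)
    simpa using this
  have e1 : Real.exp (r * ‖xPart X‖ ^ (1 / s)) ≤ Real.exp (r * gauge s σ X) := by
    gcongr
    unfold gauge
    have : 0 ≤ ‖xiPart X‖ ^ (1 / σ) := by positivity
    linarith
  have e2 : Real.exp (r * ‖xiPart X‖ ^ (1 / σ)) ≤ Real.exp (r * gauge s σ X) := by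
    gcongr
    unfold gauge
    have : 0 ≤ ‖xPart X‖ ^ (1 / s) := by positivity
    linarith
  have f1 := fr_nonneg s k
  have f2 := fr_nonneg σ k
  rw [neg_mul, Real.exp_neg, ← div_eq_mul_inv, div_le_iff₀ (Real.exp_pos _)]
  calc _ ≤ _ := h1
    _ ≤ 2 ^ k * (((s / r) ^ s) ^ k * fr s k * Real.exp (r * gauge s σ X) +
        ((σ / r) ^ σ) ^ k * fr σ k * Real.exp (r * gauge s σ X)) := by
        gcongr
        · exact hx.trans (by gcongr)
        · exact hxi.trans (by gcongr)
    _ = _ := by ring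

theorem integrable_exp_gauge {s σ r : ℝ} (hs : 0 < s) (hσ : 0 < σ) (hr : 0 < r) :
    Integrable (fun X : Phase d => Real.exp (-r * gauge s σ X)) := by
  obtain ⟨C₁, -, h₁⟩ := norm_pow_mul_exp_le (d := d) hs hσ hr 0
  obtain ⟨C₂, -, h₂⟩ := norm_pow_mul_exp_le (d := d) hs hσ hr
    (0 + (volume : Measure (Phase d)).integrablePower)
  have hc : Continuous fun X : Phase d => Real.exp (-r * gauge s σ X) :=
    Real.continuous_exp.comp (continuous_const.mul (continuous_gauge hs hσ))
  have := integrable_of_le_of_pow_mul_le (μ := (volume : Measure (Phase d)))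
    (f := fun X : Phase d => Real.exp (-r * gauge s σ X)) (C₁ := C₁) (C₂ := C₂) (k := 0)
    (fun X => by simpa using h₁ X) (fun X => by simpa using h₂ X) hc.aestronglyMeasurable
  simpa using this

/-! ### Partial derivatives and Schwartz functions -/

theorem fderiv_eq_sum_pderiv (f : Phase d → ℂ) (X : Phase d) :
    fderiv ℝ f X = ∑ i, (EuclideanSpace.proj (𝕜 := ℝ) i).smulRight (pderiv i f X) := by
  ext v
  have hv : v = ∑ i, v i • EuclideanSpace.single i (1 : ℝ) := by
    ext j
    simp only [WithLp.ofLp_sum, Finset.sum_apply, PiLp.smul_apply,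
      EuclideanSpace.single, PiLp.single_apply, smul_eq_mul, mul_ite, mul_one, mul_zero]
    rw [Finset.sum_ite_eq, if_pos (Finset.mem_univ _)]
  conv_lhs => rw [hv]
  rw [map_sum]
  simp [pderiv]

/-- The derivative is the sum of the partial derivatives times coordinate forms, so each order
reduces to the previous one for the partial derivatives. The constant does not depend on the
function. -/
theorem norm_iteratedFDeriv_le (d n : ℕ) : ∃ K : ℝ, 0 ≤ K ∧
    ∀ f : Phase d → ℂ, ContDiff ℝ (⊤ : ℕ∞) f → ∀ (X : Phase d) (B : ℝ),
      (∀ l : List (Fin d ⊕ Fin d), l.length = n → ‖dl l f X‖ ≤ B) →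
      ‖iteratedFDeriv ℝ n f X‖ ≤ K * B := by
  induction n with
  | zero =>
    refine ⟨1, zero_le_one, fun f hf X B H => ?_⟩
    simpa using H [] rfl
  | succ n ih =>
    obtain ⟨K, hK, H⟩ := ih
    let L : Fin d ⊕ Fin d → ℂ →L[ℝ] (Phase d →L[ℝ] ℂ) := fun i =>
      ContinuousLinearMap.smulRightL ℝ (Phase d) ℂ (EuclideanSpace.proj i)
    refine ⟨∑ i, ‖L i‖ * K, Finset.sum_nonneg fun i _ => by positivity, fun f hf X B hB => ?_⟩
    have e : fderiv ℝ f = fun X => ∑ i, (L i ∘ pderiv i f) X := by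
      funext X
      rw [fderiv_eq_sum_pderiv]
      rfl
    have hp : ∀ i, ContDiff ℝ n (pderiv i f) := fun i =>
      (contDiff_pderiv hf i).of_le (by exact_mod_cast le_top)
    rw [← norm_iteratedFDeriv_fderiv, e]
    rw [iteratedFDeriv_fun_sum_apply fun i _ => ((L i).contDiff.comp (hp i)).contDiffAt]
    refine (norm_sum_le _ _).trans ?_
    rw [Finset.sum_mul]
    refine Finset.sum_le_sum fun i _ => ?_
    refine ((L i).norm_iteratedFDeriv_comp_left (hp i).contDiffAt le_rfl).trans ?_
    rw [mul_assoc]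
    gcongr
    refine H _ (contDiff_pderiv hf i) X B fun l hl => ?_
    have := hB (l ++ [i]) (by simp [hl])
    rwa [dl_append] at this

theorem norm_pow_mul_le (d k : ℕ) : ∃ K : ℝ, 0 ≤ K ∧ ∀ (X : Phase d) (y B : ℝ), 0 ≤ y →
    (∀ m : List (Fin d ⊕ Fin d), m.length ≤ k → |xl m X| * y ≤ B) → ‖X‖ ^ k * y ≤ K * B := by
  refine ⟨2 ^ k * ((d + 1) ^ k + (d + 1) ^ k), by positivity, fun X y B hy H => ?_⟩
  have hB : 0 ≤ B := le_trans (by simpa using hy) (H [] (by simp))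
  rcases Nat.eq_zero_or_pos d with rfl | hd
  · have : X = 0 := Subsingleton.elim _ _
    subst this
    have h0 := H [] (by simp)
    simp only [xl_nil, abs_one, one_mul] at h0
    rw [norm_zero]
    have h1 : (0 : ℝ) ^ k ≤ 1 := pow_le_one₀ le_rfl zero_le_one
    have h2 : (1 : ℝ) ≤ 2 ^ k * ((((0 : ℕ) : ℝ) + 1) ^ k + (((0 : ℕ) : ℝ) + 1) ^ k) := by
      have : (1 : ℝ) ≤ 2 ^ k := one_le_pow₀ (by norm_num)
      simp; linarith
    calc _ ≤ 1 * B := by gcongr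
      _ ≤ _ := by gcongr
  obtain ⟨i, hi⟩ := exists_norm_le_mul_abs hd (xPart X)
  obtain ⟨j, hj⟩ := exists_norm_le_mul_abs hd (xiPart X)
  have e1 : xPart X i = X (Sum.inl i) := rfl
  have e2 : xiPart X j = X (Sum.inr j) := rfl
  rw [e1] at hi
  rw [e2] at hj
  have h1 : ‖X‖ ^ k ≤ 2 ^ k * (‖xPart X‖ ^ k + ‖xiPart X‖ ^ k) := by
    refine (pow_le_pow_left₀ (norm_nonneg _) (norm_le_add X) k).trans ?_
    have := add_rpow_le (norm_nonneg (xPart X)) (norm_nonneg (xiPart X)) (Nat.cast_nonneg k)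
    simpa using this
  have a1 := H (List.replicate k (Sum.inl i)) (by simp)
  have a2 := H (List.replicate k (Sum.inr j)) (by simp)
  rw [xl_replicate, abs_pow] at a1 a2
  calc _ ≤ (2 ^ k * (‖xPart X‖ ^ k + ‖xiPart X‖ ^ k)) * y := by gcongr
    _ ≤ (2 ^ k * (((d + 1 : ℝ) * |X (Sum.inl i)|) ^ k + ((d + 1 : ℝ) * |X (Sum.inr j)|) ^ k)) * y := by
        gcongr
    _ = 2 ^ k * ((d + 1) ^ k * (|X (Sum.inl i)| ^ k * y) + (d + 1) ^ k * (|X (Sum.inr j)| ^ k * y)) := by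
        rw [mul_pow, mul_pow]; ring
    _ ≤ 2 ^ k * ((d + 1) ^ k * B + (d + 1) ^ k * B) := by gcongr
    _ = _ := by ring

theorem norm_pow_mul_iteratedFDeriv_le (d k n : ℕ) : ∃ K : ℝ, 0 ≤ K ∧
    ∀ f : Phase d → ℂ, ContDiff ℝ (⊤ : ℕ∞) f → ∀ (X : Phase d) (B : ℝ),
      (∀ m l : List (Fin d ⊕ Fin d), m.length ≤ k → l.length ≤ n → |xl m X| * ‖dl l f X‖ ≤ B) →
      ‖X‖ ^ k * ‖iteratedFDeriv ℝ n f X‖ ≤ K * B := by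
  obtain ⟨K₁, hK₁, H₁⟩ := norm_iteratedFDeriv_le d n
  obtain ⟨K₂, hK₂, H₂⟩ := norm_pow_mul_le d k
  refine ⟨K₂ * K₁, by positivity, fun f hf X B H => ?_⟩
  rw [mul_assoc]
  refine H₂ X _ _ (norm_nonneg _) fun m hm => ?_
  rcases eq_or_lt_of_le (abs_nonneg (xl m X)) with h0 | h0
  · rw [← h0, zero_mul]
    have : 0 ≤ B := le_trans (by positivity) (H [] [] (by simp) (by simp))
    positivity
  · rw [mul_comm, ← le_div_iff₀ h0, mul_div_assoc]
    refine H₁ f hf X _ fun l hl => ?_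
    rw [le_div_iff₀ h0, mul_comm]
    exact H m l hm hl.le

/-- A function with Gelfand–Shilov bounds, as a Schwartz function. -/
theorem GS.exists_schwartz {s σ h C : ℝ} {f : Phase d → ℂ} (hf : ContDiff ℝ (⊤ : ℕ∞) f)
    (H : GS s σ h C f) : ∃ u : 𝓢(Phase d, ℂ), ⇑u = f := by
  refine ⟨⟨f, hf, fun k n => ?_⟩, rfl⟩
  obtain ⟨K, hK, HK⟩ := norm_pow_mul_iteratedFDeriv_le d k n
  let S : Set (List (Fin d ⊕ Fin d)) := {l | l.length ≤ max k n}
  have hS : S.Finite := List.finite_length_le _ _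
  let F : List (Fin d ⊕ Fin d) × List (Fin d ⊕ Fin d) → ℝ := fun p =>
    C * (h ^ (p.1.length + p.2.length) *
      (fr s (cnt true p.1 + cnt false p.2) * fr σ (cnt false p.1 + cnt true p.2)))
  obtain ⟨B, hB⟩ := ((hS.prod hS).image F).bddAbove
  refine ⟨K * B, fun X => HK f hf X B fun m l hm hl => (H m l X).trans ?_⟩
  exact hB ⟨(m, l), ⟨hm.trans (le_max_left _ _), hl.trans (le_max_right _ _)⟩, rfl⟩

/-- The partial derivative of a Schwartz function. -/
abbrev DS (i : Fin d ⊕ Fin d) (u : 𝓢(Phase d, ℂ)) : 𝓢(Phase d, ℂ) :=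
  ∂_{(EuclideanSpace.single i (1 : ℝ) : Phase d)} u

theorem coe_DS (i : Fin d ⊕ Fin d) (u : 𝓢(Phase d, ℂ)) : ⇑(DS i u) = pderiv i u := rfl

/-- Multiplication of a Schwartz function by a coordinate. -/
def MS (i : Fin d ⊕ Fin d) (u : 𝓢(Phase d, ℂ)) : 𝓢(Phase d, ℂ) :=
  SchwartzMap.smulLeftCLM ℂ
    (fun X : Phase d => inner ℝ X (EuclideanSpace.single i (1 : ℝ) : Phase d)) u

theorem MS_apply (i : Fin d ⊕ Fin d) (u : 𝓢(Phase d, ℂ)) (X : Phase d) :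
    MS i u X = (X i : ℂ) * u X := by
  have h : (fun X : Phase d => inner ℝ X
    (EuclideanSpace.single i (1 : ℝ) : Phase d)).HasTemperateGrowth := by fun_prop
  rw [MS, SchwartzMap.smulLeftCLM_apply_apply h]
  simp [EuclideanSpace.inner_single_right]

/-! ### The Fourier multiplier on Schwartz functions -/

/-- The phase of the symbol of `e^{i⟨A D_ξ, D_x⟩}`. -/
def phase (A : Matrix (Fin d) (Fin d) ℝ) (Ξ : Phase d) : ℝ :=
  (2 * Real.pi) ^ 2 * ((A *ᵥ fun k => Ξ (Sum.inr k)) ⬝ᵥ fun j => Ξ (Sum.inl j))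

/-- The symbol of `e^{i⟨A D_ξ, D_x⟩}`. -/
def symb (A : Matrix (Fin d) (Fin d) ℝ) (Ξ : Phase d) : ℂ :=
  Complex.exp (Complex.I * (phase A Ξ : ℂ))

theorem norm_symb (A : Matrix (Fin d) (Fin d) ℝ) (Ξ : Phase d) : ‖symb A Ξ‖ = 1 := by
  rw [symb, mul_comm]; exact Complex.norm_exp_ofReal_mul_I _

theorem coord_hasTemperateGrowth (i : Fin d ⊕ Fin d) :
    (fun X : Phase d => X i).HasTemperateGrowth :=
  (EuclideanSpace.proj (𝕜 := ℝ) i : Phase d →L[ℝ] ℝ).hasTemperateGrowth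

theorem phase_hasTemperateGrowth (A : Matrix (Fin d) (Fin d) ℝ) :
    (phase A).HasTemperateGrowth := by
  have h := coord_hasTemperateGrowth (d := d)
  have : phase A = fun Ξ : Phase d => (2 * Real.pi) ^ 2 *
      ∑ j, (∑ k, A j k * Ξ (Sum.inr k)) * Ξ (Sum.inl j) := by
    funext Ξ; rfl
  rw [this]
  fun_prop

theorem cexp_I_hasTemperateGrowth :
    (fun t : ℝ => Complex.exp (Complex.I * (t : ℂ))).HasTemperateGrowth := by
  have hd : ∀ n : ℕ, iteratedDeriv n (fun t : ℝ => Complex.exp (Complex.I * (t : ℂ))) =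
      fun t : ℝ => Complex.I ^ n * Complex.exp (Complex.I * (t : ℂ)) := by
    intro n
    induction n with
    | zero => simp
    | succ n ih =>
      rw [iteratedDeriv_succ, ih]
      funext t
      have h1 : HasDerivAt (fun t : ℝ => Complex.exp (Complex.I * (t : ℂ)))
          (Complex.exp (Complex.I * (t : ℂ)) * (Complex.I * 1)) t :=
        ((Complex.ofRealCLM.hasDerivAt (x := t)).const_mul Complex.I).cexp
      rw [(h1.const_mul (Complex.I ^ n)).deriv]
      ring
  refine ⟨?_, fun n => ⟨0, 1, fun t => ?_⟩⟩
  · have : ContDiff ℝ (⊤ : ℕ∞) (fun t : ℝ => (t : ℂ)) := Complex.ofRealCLM.contDiff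
    fun_prop
  · rw [norm_iteratedFDeriv_eq_norm_iteratedDeriv, hd, norm_mul, norm_pow, Complex.norm_I,
      mul_comm Complex.I, Complex.norm_exp_ofReal_mul_I]
    simp

theorem symb_hasTemperateGrowth (A : Matrix (Fin d) (Fin d) ℝ) : (symb A).HasTemperateGrowth :=
  cexp_I_hasTemperateGrowth.comp (phase_hasTemperateGrowth A)

/-- The operator `e^{i⟨A D_ξ, D_x⟩}` on Schwartz functions. -/
def TS (A : Matrix (Fin d) (Fin d) ℝ) : 𝓢(Phase d, ℂ) →L[ℂ] 𝓢(Phase d, ℂ) :=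
  SchwartzMap.fourierMultiplierCLM ℂ (symb A)

theorem TS_apply (A : Matrix (Fin d) (Fin d) ℝ) (u : 𝓢(Phase d, ℂ)) :
    TS A u = 𝓕⁻ (SchwartzMap.smulLeftCLM ℂ (symb A) (𝓕 u)) := rfl

theorem coe_TS (A : Matrix (Fin d) (Fin d) ℝ) (u : 𝓢(Phase d, ℂ)) : ⇑(TS A u) = expADD A u := by
  rw [TS_apply, SchwartzMap.fourierInv_coe, expADD]
  congr 1
  funext Ξ
  rw [SchwartzMap.smulLeftCLM_apply_apply (symb_hasTemperateGrowth A)]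
  rfl

theorem symb_zero : symb (0 : Matrix (Fin d) (Fin d) ℝ) = fun _ => 1 := by
  funext Ξ; simp [symb, phase]

theorem symb_add (A B : Matrix (Fin d) (Fin d) ℝ) : symb (A + B) = symb A * symb B := by
  funext Ξ
  simp [symb, phase, Matrix.add_mulVec, add_dotProduct, ← Complex.exp_add]
  congr 1
  ring

theorem TS_zero (u : 𝓢(Phase d, ℂ)) : TS 0 u = u := by
  rw [TS, symb_zero, SchwartzMap.fourierMultiplierCLM_const]
  simp

theorem TS_add (A B : Matrix (Fin d) (Fin d) ℝ) (u : 𝓢(Phase d, ℂ)) :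
    TS (A + B) u = TS A (TS B u) := by
  rw [TS, TS, TS, symb_add]
  exact (SchwartzMap.fourierMultiplierCLM_fourierMultiplierCLM_apply
    (symb_hasTemperateGrowth A) (symb_hasTemperateGrowth B) u).symm

/-- Fourier inversion is moved to the other factor, and the reflection Ξ ↦ -Ξ leaves the even symbol
unchanged. -/
theorem integral_TS_mul (A : Matrix (Fin d) (Fin d) ℝ) (u v : 𝓢(Phase d, ℂ)) :
    ∫ X, TS A u X * v X = ∫ X, u X * TS A v X := by
  rw [TS_apply, SchwartzMap.integral_fourierInv_mul_eq]
  have h := symb_hasTemperateGrowth A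
  have hneg : ∀ Ξ : Phase d, symb A (-Ξ) = symb A Ξ := by
    intro Ξ
    have e1 : (A *ᵥ fun k => -Ξ (Sum.inr k)) = -(A *ᵥ fun k => Ξ (Sum.inr k)) :=
      Matrix.mulVec_neg _ _
    have e2 : (fun j => -Ξ (Sum.inl j)) = -fun j => Ξ (Sum.inl j) := rfl
    simp only [symb, phase, PiLp.neg_apply]
    rw [e1, e2, neg_dotProduct_neg]
  have e1 : ∀ w : 𝓢(Phase d, ℂ), ∀ Ξ, (𝓕⁻ w) Ξ = (𝓕 w) (-Ξ) := by
    intro w Ξ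
    rw [SchwartzMap.fourierInv_coe, SchwartzMap.fourier_coe]
    exact Real.fourierInv_eq_fourier_neg _ _
  calc ∫ Ξ, SchwartzMap.smulLeftCLM ℂ (symb A) (𝓕 u) Ξ * (𝓕⁻ v) Ξ
      = ∫ Ξ, (𝓕 u) Ξ * (symb A Ξ * (𝓕⁻ v) Ξ) := by
        congr 1
        funext Ξ
        rw [SchwartzMap.smulLeftCLM_apply_apply h, smul_eq_mul]
        ring
    _ = ∫ Ξ, (𝓕 u) (-Ξ) * (symb A (-Ξ) * (𝓕⁻ v) (-Ξ)) :=
        (integral_neg_eq_self (fun Ξ => (𝓕 u) Ξ * (symb A Ξ * (𝓕⁻ v) Ξ)) volume).symm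
    _ = ∫ Ξ, (𝓕⁻ u) Ξ * SchwartzMap.smulLeftCLM ℂ (symb A) (𝓕 v) Ξ := by
        congr 1
        funext Ξ
        rw [SchwartzMap.smulLeftCLM_apply_apply h, smul_eq_mul, hneg, e1, e1, neg_neg]
    _ = _ := SchwartzMap.integral_fourierInv_mul_eq _ _

theorem norm_TS_le (A : Matrix (Fin d) (Fin d) ℝ) (u : 𝓢(Phase d, ℂ)) (X : Phase d) :
    ‖TS A u X‖ ≤ ∫ Ξ, ‖(𝓕 u) Ξ‖ := by
  rw [TS_apply, SchwartzMap.fourierInv_coe, Real.fourierInv_eq]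
  refine (norm_integral_le_integral_norm _).trans (le_of_eq ?_)
  congr 1
  funext Ξ
  rw [Circle.norm_smul, SchwartzMap.smulLeftCLM_apply_apply (symb_hasTemperateGrowth A),
    smul_eq_mul, norm_mul, norm_symb, one_mul]

/-- The symbol has modulus one, so the sup norm of the image is at most the L¹ norm of the Fourier
transform. The latter is a continuous seminorm that does not involve `A`, whence the uniform
constants. -/
theorem exists_norm_TS_le (d : ℕ) : ∃ (N : ℕ) (K : ℝ), 0 ≤ K ∧
    ∀ (A : Matrix (Fin d) (Fin d) ℝ) (u : 𝓢(Phase d, ℂ)) (B : ℝ),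
      (∀ (m l : List (Fin d ⊕ Fin d)) (X : Phase d), m.length ≤ N → l.length ≤ N →
        |xl m X| * ‖dl l u X‖ ≤ B) → ∀ X, ‖TS A u X‖ ≤ K * B := by
  let Φ : 𝓢(Phase d, ℂ) →L[ℂ] Lp ℂ 1 (volume : Measure (Phase d)) :=
    (SchwartzMap.toLpCLM ℂ ℂ 1 volume).comp (FourierTransform.fourierCLM ℂ 𝓢(Phase d, ℂ))
  have hΦ : ∀ u, ‖Φ u‖ = ∫ Ξ, ‖(𝓕 u) Ξ‖ := fun u => SchwartzMap.norm_toLp_one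
  let q : Seminorm ℂ 𝓢(Phase d, ℂ) := (normSeminorm ℂ _).comp Φ.toLinearMap
  have hq : Continuous q := continuous_norm.comp Φ.continuous
  obtain ⟨t, C, -, hC⟩ := Seminorm.bound_of_continuous
    (schwartz_withSeminorms ℂ (Phase d) ℂ) q hq
  choose K hK0 hK using norm_pow_mul_iteratedFDeriv_le d
  let N : ℕ := t.sup fun p => max p.1 p.2
  refine ⟨N, C * ∑ p ∈ t, K p.1 p.2, mul_nonneg C.2 (Finset.sum_nonneg fun p _ => hK0 _ _),
    fun A u B hB X => ?_⟩
  have hB0 : 0 ≤ B := le_trans (by positivity) (hB [] [] 0 (by simp) (by simp))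
  have h1 : ‖TS A u X‖ ≤ q u := (norm_TS_le A u X).trans (hΦ u).symm.le
  refine h1.trans ((hC u).trans ?_)
  rw [_root_.smul_apply, NNReal.smul_def, smul_eq_mul, mul_assoc]
  refine mul_le_mul_of_nonneg_left ?_ C.2
  refine Seminorm.finset_sup_apply_le
    (mul_nonneg (Finset.sum_nonneg fun p _ => hK0 _ _) hB0) fun p hp => ?_
  have hle : K p.1 p.2 * B ≤ (∑ p ∈ t, K p.1 p.2) * B := by
    refine mul_le_mul_of_nonneg_right ?_ hB0
    exact Finset.single_le_sum (f := fun p : ℕ × ℕ => K p.1 p.2) (fun p _ => hK0 _ _) hp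
  refine le_trans ?_ hle
  have hpN : max p.1 p.2 ≤ N := Finset.le_sup (f := fun p : ℕ × ℕ => max p.1 p.2) hp
  refine SchwartzMap.seminorm_le_bound ℂ p.1 p.2 u (mul_nonneg (hK0 _ _) hB0) fun Y => ?_
  refine hK p.1 p.2 u (u.smooth _) Y B fun m l hm hl => hB m l Y ?_ ?_
  · exact hm.trans ((le_max_left _ _).trans hpN)
  · exact hl.trans ((le_max_right _ _).trans hpN)

theorem DS_TS (A : Matrix (Fin d) (Fin d) ℝ) (i : Fin d ⊕ Fin d) (u : 𝓢(Phase d, ℂ)) :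
    DS i (TS A u) = TS A (DS i u) := by
  have h := symb_hasTemperateGrowth A
  have h' : (fun X : Phase d => inner ℝ X
    (EuclideanSpace.single i (1 : ℝ) : Phase d)).HasTemperateGrowth := by fun_prop
  rw [TS_apply, TS_apply, DS, DS, SchwartzMap.lineDerivOp_fourierInv_eq,
    SchwartzMap.fourier_lineDerivOp_eq]
  congr 1
  ext Ξ
  simp [SchwartzMap.smulLeftCLM_apply_apply h, SchwartzMap.smulLeftCLM_apply_apply h']
  ring

theorem dl_TS (A : Matrix (Fin d) (Fin d) ℝ) (l : List (Fin d ⊕ Fin d)) (u : 𝓢(Phase d, ℂ)) :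
    ∃ v : 𝓢(Phase d, ℂ), ⇑v = dl l u ∧ ⇑(TS A v) = dl l (TS A u) := by
  induction l with
  | nil => exact ⟨u, rfl, rfl⟩
  | cons i l ih =>
    obtain ⟨v, hv, hTv⟩ := ih
    refine ⟨DS i v, ?_, ?_⟩
    · rw [coe_DS, hv, dl_cons]
    · rw [← DS_TS, coe_DS, hTv, dl_cons]

/-- The coefficients of the commutators of `e^{i⟨A D_ξ, D_x⟩}` with the coordinates. -/
def cf (A : Matrix (Fin d) (Fin d) ℝ) : Fin d ⊕ Fin d → Fin d ⊕ Fin d → ℝ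
  | Sum.inl j, Sum.inr k => A j k
  | Sum.inr k, Sum.inl j => A j k
  | _, _ => 0

theorem pderiv_symb (A : Matrix (Fin d) (Fin d) ℝ) (i : Fin d ⊕ Fin d) (Ξ : Phase d) :
    pderiv i (symb A) Ξ =
      symb A Ξ * (Complex.I * ((2 * Real.pi) ^ 2 * ∑ k, cf A i k * Ξ k : ℝ)) := by
  have h : ∀ i : Fin d ⊕ Fin d, HasFDerivAt (fun X : Phase d => X i)
      (EuclideanSpace.proj (𝕜 := ℝ) i : Phase d →L[ℝ] ℝ) Ξ := fun i =>
    (EuclideanSpace.proj (𝕜 := ℝ) i : Phase d →L[ℝ] ℝ).hasFDerivAt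
  have h1 : HasFDerivAt (phase A) ((2 * Real.pi) ^ 2 • ∑ j, ((∑ k, A j k * Ξ (Sum.inr k)) •
      (EuclideanSpace.proj (𝕜 := ℝ) (Sum.inl j) : Phase d →L[ℝ] ℝ) +
      Ξ (Sum.inl j) • ∑ k, A j k • (EuclideanSpace.proj (𝕜 := ℝ) (Sum.inr k) : Phase d →L[ℝ] ℝ)))
      Ξ := by
    have : phase A = fun Ξ : Phase d => (2 * Real.pi) ^ 2 *
      ∑ j, (∑ k, A j k * Ξ (Sum.inr k)) * Ξ (Sum.inl j) := by
      funext Ξ; rfl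
    rw [this]
    refine HasFDerivAt.const_mul ?_ _
    refine HasFDerivAt.fun_sum fun j _ => ?_
    refine HasFDerivAt.mul ?_ (h _)
    exact HasFDerivAt.fun_sum fun k _ => (h _).const_mul _
  have h2 : HasFDerivAt (symb A) _ Ξ :=
    (((Complex.ofRealCLM.hasFDerivAt (x := phase A Ξ)).comp Ξ h1).const_mul Complex.I).cexp
  rw [pderiv, h2.fderiv]
  simp only [_root_.smul_apply, ContinuousLinearMap.comp_apply, smul_eq_mul,
    Complex.ofRealCLM_apply, _root_.sum_apply, _root_.add_apply,
    PiLp.proj_apply, Function.comp_apply]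
  rw [← symb]
  congr 3
  congr 1
  rw [Fintype.sum_sum_type]
  rcases i with i | i
  · simp [cf]
  · simp [cf, mul_comm]

/-- A coordinate is a derivative on the Fourier side. Differentiating the symbol brings down a
linear form in the dual variables of the other kind, that is, a first-order operator with constant
coefficients. -/
theorem MS_TS (A : Matrix (Fin d) (Fin d) ℝ) (i : Fin d ⊕ Fin d) (u : 𝓢(Phase d, ℂ)) :
    MS i (TS A u) = TS A (MS i u + Complex.I • ∑ k, (cf A i k : ℂ) • DS k u) := by
  have h := symb_hasTemperateGrowth A
  have hi : ∀ i : Fin d ⊕ Fin d, (fun X : Phase d => inner ℝ X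
    (EuclideanSpace.single i (1 : ℝ) : Phase d)).HasTemperateGrowth := fun i => by fun_prop
  have h2 : (2 * Real.pi * Complex.I : ℂ) ≠ 0 := by
    simp [Real.pi_ne_zero]
  have key : DS i (SchwartzMap.smulLeftCLM ℂ (symb A) (𝓕 u)) = -(2 * Real.pi * Complex.I : ℂ) •
      SchwartzMap.smulLeftCLM ℂ (symb A)
        (𝓕 (MS i u + Complex.I • ∑ k, (cf A i k : ℂ) • DS k u)) := by
    ext Ξ
    have e1 : DS i (SchwartzMap.smulLeftCLM ℂ (symb A) (𝓕 u)) Ξ =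
        pderiv i (symb A) Ξ * (𝓕 u) Ξ + symb A Ξ * DS i (𝓕 u) Ξ := by
      rw [coe_DS, SchwartzMap.smulLeftCLM_apply h]
      exact congrFun (pderiv_mul (f := symb A) (g := ⇑(𝓕 u : 𝓢(Phase d, ℂ))) h.1 ((𝓕 u).smooth _) i) Ξ
    have e2 : DS i (𝓕 u) = 𝓕 (-(2 * Real.pi * Complex.I : ℂ) • MS i u) :=
      SchwartzMap.lineDerivOp_fourier_eq u _
    have e3 : ∀ k, 𝓕 (DS k u) = (2 * Real.pi * Complex.I : ℂ) • MS k (𝓕 u) := fun k =>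
      SchwartzMap.fourier_lineDerivOp_eq u _
    have e4 : 𝓕 (MS i u + Complex.I • ∑ k, (cf A i k : ℂ) • DS k u) =
        𝓕 (MS i u) + Complex.I • ∑ k, (cf A i k : ℂ) •
          ((2 * Real.pi * Complex.I : ℂ) • MS k (𝓕 u)) := by
      rw [FourierTransform.fourier_add, FourierTransform.fourier_smul]
      congr 2
      have : 𝓕 (∑ k, (cf A i k : ℂ) • DS k u) = FourierTransform.fourierCLM ℂ 𝓢(Phase d, ℂ)
        (∑ k, (cf A i k : ℂ) • DS k u) := rfl
      rw [this, map_sum]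
      refine Finset.sum_congr rfl fun k _ => ?_
      rw [map_smul]
      congr 1
      exact e3 k
    rw [e1, pderiv_symb, e2, FourierTransform.fourier_smul, _root_.smul_apply, e4,
      _root_.smul_apply, SchwartzMap.smulLeftCLM_apply_apply h, _root_.add_apply,
      _root_.smul_apply, _root_.sum_apply]
    simp only [_root_.smul_apply, MS_apply, smul_eq_mul]
    push_cast
    have e5 : ∑ k, (cf A i k : ℂ) * (2 * Real.pi * Complex.I * ((Ξ k : ℂ) * (𝓕 u) Ξ)) =
        (∑ k, (cf A i k : ℂ) * (Ξ k : ℂ)) * (2 * Real.pi * Complex.I * (𝓕 u) Ξ) := by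
      rw [Finset.sum_mul]
      exact Finset.sum_congr rfl fun k _ => by ring
    rw [e5]
    linear_combination ((symb A Ξ) * Complex.I * (2 * Real.pi) ^ 2 *
      (∑ k, (cf A i k : ℂ) * (Ξ k : ℂ)) * (𝓕 u) Ξ) * Complex.I_sq
  have e6 := SchwartzMap.fourierInv_lineDerivOp_eq (SchwartzMap.smulLeftCLM ℂ (symb A) (𝓕 u))
    (EuclideanSpace.single i (1 : ℝ) : Phase d)
  -- Both sides carry the factor -2πi by which coordinates and Fourier derivatives differ; it is
  -- cancelled at the end.
  have e7 : (-(2 * Real.pi * Complex.I : ℂ)) • MS i (TS A u) = (-(2 * Real.pi * Complex.I : ℂ)) •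
      TS A (MS i u + Complex.I • ∑ k, (cf A i k : ℂ) • DS k u) := by
    calc _ = _ := e6.symm
      _ = 𝓕⁻ (DS i (SchwartzMap.smulLeftCLM ℂ (symb A) (𝓕 u))) := rfl
      _ = _ := by rw [key, FourierTransform.fourierInv_smul, ← TS_apply]
  exact smul_right_injective _ (neg_ne_zero.2 h2) e7

/-! ### Continuity of the operator on Gelfand–Shilov functions -/

theorem contDiff_coord (i : Fin d ⊕ Fin d) :
    ContDiff ℝ (⊤ : ℕ∞) (fun X : Phase d => (X i : ℂ)) :=
  (Complex.ofRealCLM.comp (EuclideanSpace.proj (𝕜 := ℝ) i : Phase d →L[ℝ] ℝ)).contDiff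

theorem pderiv_coord (i j : Fin d ⊕ Fin d) :
    pderiv j (fun X : Phase d => (X i : ℂ)) = fun _ => if i = j then 1 else 0 := by
  funext X
  have : HasFDerivAt (fun X : Phase d => (X i : ℂ))
      (Complex.ofRealCLM.comp (EuclideanSpace.proj (𝕜 := ℝ) i : Phase d →L[ℝ] ℝ)) X :=
    (Complex.ofRealCLM.comp (EuclideanSpace.proj (𝕜 := ℝ) i : Phase d →L[ℝ] ℝ)).hasFDerivAt
  rw [pderiv, this.fderiv]
  simp only [ContinuousLinearMap.comp_apply, PiLp.proj_apply, Complex.ofRealCLM_apply,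
    EuclideanSpace.single, PiLp.single_apply]
  split_ifs <;> simp

theorem dl_coord_mul {v : Phase d → ℂ} (hv : ContDiff ℝ (⊤ : ℕ∞) v) (i : Fin d ⊕ Fin d)
    (l : List (Fin d ⊕ Fin d)) :
    dl l ((fun X : Phase d => (X i : ℂ)) * v) =
      (fun X : Phase d => (X i : ℂ)) * dl l v + (l.count i : ℂ) • dl (l.erase i) v := by
  induction l with
  | nil => simp
  | cons j l ih =>
    have c1 := contDiff_coord (d := d) i
    have c2 := contDiff_dl hv l
    have c3 := contDiff_dl hv (l.erase i)
    have c12 : ContDiff ℝ (⊤ : ℕ∞) ((fun X : Phase d => (X i : ℂ)) * dl l v) := c1.mul c2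
    have c4 : ContDiff ℝ (⊤ : ℕ∞) ((l.count i : ℂ) • dl (l.erase i) v) := contDiff_const.smul c3
    rw [dl_cons, ih, pderiv_add c12 c4, pderiv_mul c1 c2,
      pderiv_smul c3, pderiv_coord, ← dl_cons, ← dl_cons]
    by_cases hij : i = j
    · subst hij
      rw [List.erase_cons_head, List.count_cons_self]
      -- If the letter does not occur in `l`, erasing does nothing, but the coefficient `l.count i`
      -- vanishes.
      by_cases hmem : i ∈ l
      · rw [dl_perm hv (List.perm_cons_erase hmem).symm]
        funext X
        simp
        ring
      · rw [List.count_eq_zero_of_not_mem hmem]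
        funext X
        simp
        ring
    · have hji : j ≠ i := fun h => hij h.symm
      rw [List.erase_cons_tail (by simpa using hji), List.count_cons_of_ne hji]
      funext X
      simp [hij]

theorem count_le_cnt (i : Fin d ⊕ Fin d) (l : List (Fin d ⊕ Fin d)) :
    l.count i ≤ cnt i.isLeft l := by
  refine List.countP_mono_left fun x _ hx => ?_
  have : x = i := by simpa using hx
  simp [this]

theorem cnt_erase_of_mem {i : Fin d ⊕ Fin d} {l : List (Fin d ⊕ Fin d)} (h : i ∈ l) (b : Bool) :
    cnt b l = cnt b (l.erase i) + if i.isLeft = b then 1 else 0 := by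
  rw [cnt_perm b (List.perm_cons_erase h), cnt_cons]

/-- Bounds on all products of a monomial and a derivative in terms of the numbers of letters. -/
def BD (b : Bool) (E : ℕ → ℕ → ℝ) (u : Phase d → ℂ) : Prop :=
  ∀ (m l : List (Fin d ⊕ Fin d)) (X : Phase d),
    |xl m X| * ‖dl l u X‖ ≤ E (cnt b m + cnt (!b) l) (cnt (!b) m + cnt b l)

theorem BD.mono {b : Bool} {E E' : ℕ → ℕ → ℝ} {u : Phase d → ℂ} (H : BD b E u)
    (h : ∀ P Q, E P Q ≤ E' P Q) : BD b E' u := fun m l X => (H m l X).trans (h _ _)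

theorem cf_eq_zero (A : Matrix (Fin d) (Fin d) ℝ) {i k : Fin d ⊕ Fin d}
    (h : k.isLeft ≠ !i.isLeft) : cf A i k = 0 := by
  rcases i with i | i <;> rcases k with k | k <;> simp_all [cf]

/-- Multiplication by a coordinate of kind `b` and differentiation in a variable of the other kind
both raise the first index `P` by one. The commutator involves only derivatives of the other kind.
The Leibniz term removes one derivative of kind `b`, and at most `Q` letters are available for this.
-/
theorem BD.step {b : Bool} {E : ℕ → ℕ → ℝ} {A : Matrix (Fin d) (Fin d) ℝ} {a : ℝ}
    {i : Fin d ⊕ Fin d} (hi : i.isLeft = b) (ha : ∑ k, |cf A i k| ≤ a)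
    {u : 𝓢(Phase d, ℂ)} (H : BD b E u) :
    BD b (fun P Q => (1 + a) * E (P + 1) Q + Q * E P (Q - 1))
      (MS i u + Complex.I • ∑ k, (cf A i k : ℂ) • DS k u : 𝓢(Phase d, ℂ)) := by
  intro m l X
  have hu : ContDiff ℝ (⊤ : ℕ∞) u := u.smooth _
  have e0 : ⇑(MS i u + Complex.I • ∑ k, (cf A i k : ℂ) • DS k u : 𝓢(Phase d, ℂ)) =
      ((fun X : Phase d => (X i : ℂ)) * u) +
        Complex.I • ∑ k, (cf A i k : ℂ) • pderiv k u := by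
    funext X
    simp [MS_apply, coe_DS]
  have hc : ContDiff ℝ (⊤ : ℕ∞) (∑ k, (cf A i k : ℂ) • pderiv k u) := by
    have : (∑ k, (cf A i k : ℂ) • pderiv k u) =
        fun X => ∑ k, ((cf A i k : ℂ) • pderiv k u) X := by ext; simp
    rw [this]
    exact ContDiff.sum fun k _ => contDiff_const.smul (contDiff_pderiv hu k)
  have hk : ∀ k, ContDiff ℝ (⊤ : ℕ∞) ((cf A i k : ℂ) • pderiv k u) := fun k =>
    contDiff_const.smul (contDiff_pderiv hu k)
  have e1 : dl l (MS i u + Complex.I • ∑ k, (cf A i k : ℂ) • DS k u : 𝓢(Phase d, ℂ)) X =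
      ((X i : ℂ) * dl l u X + (l.count i : ℂ) * dl (l.erase i) u X) +
        Complex.I * ∑ k, (cf A i k : ℂ) * dl (l ++ [k]) u X := by
    have c1 : ContDiff ℝ (⊤ : ℕ∞) ((fun X : Phase d => (X i : ℂ)) * ⇑u) :=
      (contDiff_coord i).mul hu
    have c2 : ContDiff ℝ (⊤ : ℕ∞) (Complex.I • ∑ k, (cf A i k : ℂ) • pderiv k u) :=
      contDiff_const.smul hc
    rw [e0, dl_add c1 c2, dl_coord_mul hu,
      dl_smul hc, dl_sum _ hk]
    simp only [Pi.add_apply, Pi.mul_apply, Pi.smul_apply, smul_eq_mul, Finset.sum_apply]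
    congr 2
    refine Finset.sum_congr rfl fun k _ => ?_
    rw [dl_smul (contDiff_pderiv hu k), Pi.smul_apply, smul_eq_mul, dl_append]
    rfl
  set P := cnt b m + cnt (!b) l with hP
  set Q := cnt (!b) m + cnt b l with hQ
  have hb : ∀ b' : Bool, (b' = !b) ↔ ¬ b' = b := by intro b'; cases b <;> cases b' <;> simp
  have t1 : |xl m X| * ‖(X i : ℂ) * dl l u X‖ ≤ E (P + 1) Q := by
    have := H (i :: m) l X
    rw [cnt_cons, cnt_cons, if_pos hi, if_neg (by rw [hb]; simp [hi]), xl_cons, abs_mul] at this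
    rw [norm_mul, Complex.norm_real, Real.norm_eq_abs]
    calc _ = |X i| * |xl m X| * ‖dl l u X‖ := by ring
      _ ≤ _ := this
      _ = _ := by congr 1; omega
  have t2 : |xl m X| * ‖(l.count i : ℂ) * dl (l.erase i) u X‖ ≤ Q * E P (Q - 1) := by
    rw [norm_mul, Complex.norm_natCast]
    by_cases hmem : i ∈ l
    · have h1 := H m (l.erase i) X
      have c1 := cnt_erase_of_mem hmem b
      have c2 := cnt_erase_of_mem hmem (!b)
      rw [if_pos hi] at c1
      rw [if_neg (by rw [hb]; simp [hi])] at c2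
      have e2 : cnt b m + cnt (!b) (l.erase i) = P := by omega
      have e3 : cnt (!b) m + cnt b (l.erase i) = Q - 1 := by omega
      rw [e2, e3] at h1
      have h2 := count_le_cnt i l
      rw [hi] at h2
      have h3 : (l.count i : ℝ) ≤ Q := by exact_mod_cast h2.trans (by omega)
      calc _ = (l.count i : ℝ) * (|xl m X| * ‖dl (l.erase i) u X‖) := by ring
        _ ≤ Q * E P (Q - 1) := mul_le_mul h3 h1 (by positivity) (by positivity)
    · rw [List.count_eq_zero_of_not_mem hmem]
      -- The right side must be nonnegative although the left side is zero. Words with the index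
      -- pair `(P, Q - 1)` exist, and the hypothesis bounds a nonnegative quantity by `E` there.
      have h0 : Q = 0 ∨ 0 ≤ E P (Q - 1) := by
        rcases Nat.eq_zero_or_pos Q with h | h
        · exact Or.inl h
        · right
          have h1 : ∃ m' l' : List (Fin d ⊕ Fin d), cnt b m' + cnt (!b) l' = P ∧
              cnt (!b) m' + cnt b l' = Q - 1 := by
            refine ⟨List.replicate P i, List.replicate (Q - 1) i, ?_, ?_⟩
            · rw [cnt_replicate, cnt_replicate, if_pos hi, if_neg (by rw [hb]; simp [hi])]; rfl
            · rw [cnt_replicate, cnt_replicate, if_pos hi, if_neg (by rw [hb]; simp [hi])]; omega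
          obtain ⟨m', l', h1, h2⟩ := h1
          have := H m' l' X
          rw [h1, h2] at this
          exact le_trans (by positivity) this
      rcases h0 with h0 | h0
      · simp [h0]
      · simp only [Nat.cast_zero, zero_mul, mul_zero]; positivity
  have t3 : |xl m X| * ‖∑ k, (cf A i k : ℂ) * dl (l ++ [k]) u X‖ ≤ a * E (P + 1) Q := by
    have hE : 0 ≤ E (P + 1) Q := le_trans (by positivity) t1
    calc _ ≤ |xl m X| * ∑ k, |cf A i k| * ‖dl (l ++ [k]) u X‖ := by
          gcongr
          refine (norm_sum_le _ _).trans (le_of_eq ?_)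
          refine Finset.sum_congr rfl fun k _ => ?_
          rw [norm_mul, Complex.norm_real, Real.norm_eq_abs]
      _ = ∑ k, |cf A i k| * (|xl m X| * ‖dl (l ++ [k]) u X‖) := by
          rw [Finset.mul_sum]
          exact Finset.sum_congr rfl fun k _ => by ring
      _ ≤ ∑ k, |cf A i k| * E (P + 1) Q := by
          refine Finset.sum_le_sum fun k _ => ?_
          by_cases hk : k.isLeft = !i.isLeft
          · have h1 := H m (l ++ [k]) X
            rw [hi] at hk
            rw [cnt_append, cnt_append, cnt_cons, cnt_cons, if_pos hk, if_neg ((hb _).1 hk)] at h1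
            simp only [cnt_nil, zero_add, add_zero] at h1
            gcongr
            exact h1.trans (le_of_eq (by rw [hP, add_assoc]))
          · rw [cf_eq_zero A hk]; simp
      _ = (∑ k, |cf A i k|) * E (P + 1) Q := by rw [Finset.sum_mul]
      _ ≤ _ := by gcongr
  rw [e1]
  calc _ ≤ |xl m X| * ((‖(X i : ℂ) * dl l u X‖ + ‖(l.count i : ℂ) * dl (l.erase i) u X‖) +
        ‖∑ k, (cf A i k : ℂ) * dl (l ++ [k]) u X‖) := by
        gcongr
        refine (norm_add_le _ _).trans ?_
        rw [norm_mul Complex.I, Complex.norm_I, one_mul]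
        gcongr
        exact norm_add_le _ _
    _ = |xl m X| * ‖(X i : ℂ) * dl l u X‖ +
        |xl m X| * ‖(l.count i : ℂ) * dl (l.erase i) u X‖ +
        |xl m X| * ‖∑ k, (cf A i k : ℂ) * dl (l ++ [k]) u X‖ := by ring
    _ ≤ E (P + 1) Q + Q * E P (Q - 1) + a * E (P + 1) Q := by gcongr
    _ = _ := by ring

/-! ### Bounds stable under commutation, and continuity on test functions. -/

/-- The factors that compensate the commutators of coordinates and derivatives. -/
def comF (s σ H : ℝ) (j : ℕ) : ℝ := max 1 ((j + 1 : ℝ) ^ (1 - s - σ) * (H ^ 2)⁻¹)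

/-- The product of the factors that compensate the commutators. -/
def comP (s σ H : ℝ) (Q : ℕ) : ℝ := ∏ j ∈ Finset.range Q, comF s σ H j

theorem one_le_comF (s σ H : ℝ) (j : ℕ) : 1 ≤ comF s σ H j := le_max_left _ _

theorem one_le_comP (s σ H : ℝ) (Q : ℕ) : 1 ≤ comP s σ H Q := by
  unfold comP
  induction Q with
  | zero => simp
  | succ n ih =>
    rw [Finset.prod_range_succ]
    exact one_le_mul_of_one_le_of_one_le ih (one_le_comF s σ H n)

theorem comP_mono (s σ H : ℝ) : Monotone (comP s σ H) := by
  refine monotone_nat_of_le_succ fun n => ?_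
  unfold comP
  rw [Finset.prod_range_succ]
  exact le_mul_of_one_le_right (zero_le_one.trans (one_le_comP s σ H n)) (one_le_comF s σ H n)

/-- All but finitely many factors equal 1: all of them if `H ≥ 1`, as the exponent 1 - s - σ is at
most 0; and for s + σ > 1 the power of j + 1 eventually falls below H². With s + σ = 1 and `H < 1`
the product would grow geometrically. -/
theorem exists_comP_le {s σ H : ℝ} (hsσ : 1 ≤ s + σ) (hH : 0 < H) (hG : 1 ≤ H ∨ 1 < s + σ) :
    ∃ B : ℝ, 1 ≤ B ∧ ∀ Q, comP s σ H Q ≤ B := by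
  obtain ⟨J, hJ⟩ : ∃ J : ℕ, ∀ j, J ≤ j → comF s σ H j = 1 := by
    rcases hG with hG | hG
    · refine ⟨0, fun j _ => max_eq_left ?_⟩
      have h1 : (j + 1 : ℝ) ^ (1 - s - σ) ≤ 1 :=
        Real.rpow_le_one_of_one_le_of_nonpos (by linarith [(Nat.cast_nonneg j : (0 : ℝ) ≤ j)])
          (by linarith)
      have h2 : (H ^ 2)⁻¹ ≤ 1 := inv_le_one_of_one_le₀ (one_le_pow₀ hG)
      have h3 : 0 ≤ (H ^ 2)⁻¹ := by positivity
      calc _ ≤ (1 : ℝ) * 1 := by gcongr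
        _ = 1 := one_mul 1
    · have hlim : Filter.Tendsto (fun j : ℕ => ((j + 1 : ℕ) : ℝ) ^ (-(s + σ - 1)))
          Filter.atTop (nhds 0) :=
        (tendsto_rpow_neg_atTop (by linarith)).comp
          (tendsto_natCast_atTop_atTop.comp (Filter.tendsto_add_atTop_nat 1))
      have hev := hlim.eventually_le_const (show (0 : ℝ) < H ^ 2 by positivity)
      obtain ⟨J, hJ⟩ := Filter.eventually_atTop.1 hev
      refine ⟨J, fun j hj => max_eq_left ?_⟩
      have := hJ j hj
      rw [← div_eq_mul_inv, div_le_one (by positivity)]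
      have e : 1 - s - σ = -(s + σ - 1) := by ring
      rw [e]
      push_cast at this
      exact this
  refine ⟨comP s σ H J, one_le_comP _ _ _ _, fun Q => ?_⟩
  rcases le_total Q J with h | h
  · exact comP_mono s σ H h
  · refine le_of_eq ?_
    unfold comP
    rw [← Finset.prod_range_mul_prod_Ico _ h]
    rw [Finset.prod_eq_one (s := Finset.Ico J Q) fun j hj => hJ j (Finset.mem_Ico.1 hj).1, mul_one]

/-- The bounds that are propagated along the letters of a monomial. -/
def prop (s σ H a C : ℝ) (p q n P Q : ℕ) : ℝ :=
  C * ((2 + a) ^ n * comP s σ H Q * (H ^ (P + Q + p + q + n) *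
    (fr s (P + Q + p + q + n) * fr (σ - s) (Q + q))))

/-- The form of `prop` is chosen to be closed under `BD.step`. The total order enters with exponent
s, corrected by the exponent σ - s for `Q + q`. From `(P, Q - 1)` to `(P + 1, Q)` the total order
rises by two and the corrected part by one, which gains about Q^{2s + (σ - s)} = Q^{s + σ}. This
pays for the factor `Q`, up to the compensating factor. -/
theorem prop_step {s σ H a C : ℝ} (hs : 0 < s) (hσ : 0 < σ) (hH : 0 < H) (ha : 0 ≤ a) (hC : 0 ≤ C)
    (p q n P Q : ℕ) : (1 + a) * prop s σ H a C p q n (P + 1) Q +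
      Q * prop s σ H a C p q n P (Q - 1) ≤ prop s σ H a C p q (n + 1) P Q := by
  have hK : (2 + a) * prop s σ H a C p q n (P + 1) Q = prop s σ H a C p q (n + 1) P Q := by
    unfold prop
    rw [show P + 1 + Q + p + q + n = P + Q + p + q + (n + 1) by ring, pow_succ (2 + a)]
    ring
  have h2 : Q * prop s σ H a C p q n P (Q - 1) ≤ prop s σ H a C p q n (P + 1) Q := by
    rcases Nat.eq_zero_or_pos Q with rfl | hQ
    · unfold prop
      have := one_le_comP s σ H 0
      have := fr_nonneg s (P + 1 + 0 + p + q + n)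
      have := fr_nonneg (σ - s) (0 + q)
      simp only [Nat.cast_zero, zero_mul]
      positivity
    obtain ⟨R, rfl⟩ : ∃ R, Q = R + 1 := ⟨Q - 1, by omega⟩
    rw [Nat.add_sub_cancel]
    unfold prop
    set N := P + R + p + q + n with hN
    rw [show P + 1 + (R + 1) + p + q + n = N + 1 + 1 by omega, show R + 1 + q = (R + q) + 1 by omega,
      fr_succ s, fr_succ s, fr_succ (σ - s)]
    have e1 : comP s σ H (R + 1) = comP s σ H R * comF s σ H R := by
      unfold comP; rw [Finset.prod_range_succ]
    rw [e1]
    set z : ℝ := ((R + q : ℕ) : ℝ) + 1 with hz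
    have hz0 : 0 < z := by positivity
    have hzN : z ≤ (N : ℝ) + 1 := by
      rw [hz]; have : R + q ≤ N := by omega
      have : ((R + q : ℕ) : ℝ) ≤ N := by exact_mod_cast this
      linarith
    have hRz : (R + 1 : ℝ) ≤ z := by rw [hz]; push_cast; linarith [(Nat.cast_nonneg q : (0 : ℝ) ≤ q)]
    have hF : (R + 1 : ℝ) ^ (1 - s - σ) ≤ comF s σ H R * H ^ 2 := by
      have := le_max_right 1 ((R + 1 : ℝ) ^ (1 - s - σ) * (H ^ 2)⁻¹)
      rw [← div_eq_mul_inv, div_le_iff₀ (by positivity)] at this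
      exact this.trans (le_of_eq rfl)
    -- The integer is split as (R+1)^{1-s-σ} (R+1)^{s+σ}; the first part is covered by `comF`, the
    -- second by the three new factorial factors.
    have key : (R + 1 : ℝ) ≤ comF s σ H R * H ^ 2 *
        ((((N + 1 : ℕ) : ℝ) + 1) ^ s * ((N : ℝ) + 1) ^ s) * z ^ (σ - s) := by
      have g1 : z ^ s ≤ ((N : ℝ) + 1) ^ s := by gcongr
      have g2 : z ^ s ≤ (((N + 1 : ℕ) : ℝ) + 1) ^ s := by
        gcongr; push_cast; linarith
      have g3 : (R + 1 : ℝ) ^ (s + σ) ≤ z ^ (s + σ) := by gcongr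
      have g4 : 0 ≤ comF s σ H R := zero_le_one.trans (one_le_comF s σ H R)
      have g5 : 0 ≤ comF s σ H R * H ^ 2 := by positivity
      calc (R + 1 : ℝ) = (R + 1 : ℝ) ^ (1 - s - σ) * (R + 1 : ℝ) ^ (s + σ) := by
            rw [← Real.rpow_add (by positivity)]
            rw [show 1 - s - σ + (s + σ) = 1 by ring, Real.rpow_one]
        _ ≤ (R + 1 : ℝ) ^ (1 - s - σ) * z ^ (s + σ) := by gcongr
        _ = (R + 1 : ℝ) ^ (1 - s - σ) * (z ^ s * z ^ s) * z ^ (σ - s) := by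
            rw [show s + σ = s + s + (σ - s) by ring, Real.rpow_add hz0, Real.rpow_add hz0]; ring
        _ ≤ _ := by gcongr
    have f1 := fr_nonneg s N
    have f2 := fr_nonneg (σ - s) (R + q)
    have f3 := one_le_comP s σ H R
    have f4 : 0 ≤ comF s σ H R := zero_le_one.trans (one_le_comF s σ H R)
    calc _ = (R + 1 : ℝ) * (C * ((2 + a) ^ n * comP s σ H R * (H ^ N *
          (fr s N * fr (σ - s) (R + q))))) := by push_cast; ring
      _ ≤ (comF s σ H R * H ^ 2 *
        ((((N + 1 : ℕ) : ℝ) + 1) ^ s * ((N : ℝ) + 1) ^ s) * z ^ (σ - s)) *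
          (C * ((2 + a) ^ n * comP s σ H R * (H ^ N * (fr s N * fr (σ - s) (R + q))))) := by
          gcongr
      _ = _ := by rw [pow_succ, pow_succ]; ring
  linarith [hK, h2]

/-- The form of the bounds before and after multiplication by a monomial. -/
def gsB (s σ H C : ℝ) (p q P Q : ℕ) : ℝ :=
  C * (H ^ (P + Q + p + q) * (fr s (P + p) * fr σ (Q + q)))

theorem gsB_le_prop {s σ H a C : ℝ} (hs : 0 < s) (hH : 0 < H) (hC : 0 ≤ C) (p q P Q : ℕ) :
    gsB s σ H C p q P Q ≤ prop s σ H a C p q 0 P Q := by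
  unfold gsB prop
  have h1 := fr_mul_le hs.le (P + p) (Q + q)
  have h2 : fr σ (Q + q) = fr s (Q + q) * fr (σ - s) (Q + q) := by
    rw [← fr_add_exp]; congr 1; ring
  have f1 := fr_nonneg (σ - s) (Q + q)
  have f2 := fr_nonneg s (P + Q + p + q)
  have h3 := one_le_comP s σ H Q
  rw [h2, add_zero, pow_zero, one_mul, ← mul_assoc (fr s (P + p))]
  rw [show P + p + (Q + q) = P + Q + p + q by ring] at h1
  calc _ ≤ C * (H ^ (P + Q + p + q) * (fr s (P + Q + p + q) * fr (σ - s) (Q + q))) := by gcongr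
    _ = C * (1 * (H ^ (P + Q + p + q) * (fr s (P + Q + p + q) * fr (σ - s) (Q + q)))) := by
        rw [one_mul]
    _ ≤ _ := by gcongr

/-- Return to separate factorials: the powers of 2 from splitting and the powers of 2 + a from the
commutations have exponents at most the total order and enter the parameter. -/
theorem prop_le_gsB {s σ H a C B : ℝ} (hs : 0 < s) (hH : 0 < H) (ha : 0 ≤ a) (hC : 0 ≤ C)
    (hB : ∀ Q, comP s σ H Q ≤ B) (p q n P Q : ℕ) :
    prop s σ H a C p q n P Q ≤ gsB s σ (2 ^ s * (2 + a) * H) (C * B) (p + n) q P Q := by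
  unfold gsB prop
  have h1 := fr_add_le hs.le (P + (p + n)) (Q + q)
  have h2 : fr σ (Q + q) = fr s (Q + q) * fr (σ - s) (Q + q) := by
    rw [← fr_add_exp]; congr 1; ring
  have f1 := fr_nonneg (σ - s) (Q + q)
  have f2 := fr_nonneg s (P + (p + n))
  have f3 := fr_nonneg s (Q + q)
  have h3 := one_le_comP s σ H Q
  have hB0 : 0 ≤ B := by linarith [hB Q]
  rw [show P + (p + n) + (Q + q) = P + Q + p + q + n by ring] at h1
  rw [h2, show P + Q + (p + n) + q = P + Q + p + q + n by ring]
  have h4 : (2 + a) ^ n ≤ (2 + a) ^ (P + Q + p + q + n) :=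
    pow_le_pow_right₀ (by linarith) (by omega)
  calc _ ≤ C * ((2 + a) ^ (P + Q + p + q + n) * B * (H ^ (P + Q + p + q + n) *
        ((((2 : ℝ) ^ s) ^ (P + Q + p + q + n) * (fr s (P + (p + n)) * fr s (Q + q))) *
          fr (σ - s) (Q + q)))) := by
        have := fr_nonneg s (P + Q + p + q + n)
        gcongr
        · exact hB Q
    _ = _ := by rw [mul_pow, mul_pow]; ring

/-- The monomial is moved through the operator letter by letter. As all letters are of one kind,
each commutation raises the same index. -/
theorem BD.monomial {b : Bool} {s σ H a C B : ℝ} (hs : 0 < s) (hσ : 0 < σ) (hH : 0 < H)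
    (ha : 0 ≤ a) (hC : 0 ≤ C) (hB : ∀ Q, comP s σ H Q ≤ B)
    {A : Matrix (Fin d) (Fin d) ℝ} (hA : ∀ i, ∑ k, |cf A i k| ≤ a) {p q : ℕ}
    {u : 𝓢(Phase d, ℂ)} (Hu : BD b (gsB s σ H C p q) u) (m : List (Fin d ⊕ Fin d))
    (hm : ∀ i ∈ m, i.isLeft = b) :
    ∃ v : 𝓢(Phase d, ℂ), (∀ X, (xl m X : ℂ) * TS A u X = TS A v X) ∧
      BD b (gsB s σ (2 ^ s * (2 + a) * H) (C * B) (p + m.length) q) v := by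
  have key : ∃ v : 𝓢(Phase d, ℂ), (∀ X, (xl m X : ℂ) * TS A u X = TS A v X) ∧
      BD b (prop s σ H a C p q m.length) v := by
    induction m with
    | nil => exact ⟨u, by simp, Hu.mono fun P Q => gsB_le_prop hs hH hC p q P Q⟩
    | cons i m ih =>
      obtain ⟨v, hv, hBv⟩ := ih fun j hj => hm j (List.mem_cons_of_mem _ hj)
      refine ⟨MS i v + Complex.I • ∑ k, (cf A i k : ℂ) • DS k v, fun X => ?_, ?_⟩
      · rw [← MS_TS, MS_apply, ← hv, xl_cons]
        push_cast
        ring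
      · refine (hBv.step (hm i List.mem_cons_self) (hA i)).mono fun P Q => ?_
        exact prop_step hs hσ hH ha hC p q m.length P Q
  obtain ⟨v, hv, hBv⟩ := key
  exact ⟨v, hv, hBv.mono fun P Q => prop_le_gsB hs hH ha hC hB p q _ P Q⟩

/-- The loss in the parameter of the Gelfand–Shilov norms caused by `e^{i⟨A D_ξ, D_x⟩}`. -/
def kap (s σ a : ℝ) : ℝ := 2 ^ (s + σ) * (2 ^ σ * (2 + a) * (2 ^ s * (2 + a)))

theorem kap_pos {s σ a : ℝ} (ha : 0 ≤ a) : 0 < kap s σ a := by unfold kap; positivity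

/-- The bounds are symmetric in the two kinds together with (s, p) and (σ, q). This lets the second
pass, over the letters of the other kind, reuse the first. -/
theorem BD.swap {b : Bool} {s σ H C : ℝ} {p q : ℕ} {u : Phase d → ℂ}
    (Hu : BD b (gsB s σ H C p q) u) : BD (!b) (gsB σ s H C q p) u := by
  intro m l X
  refine (Hu m l X).trans (le_of_eq ?_)
  unfold gsB
  rw [Bool.not_not, mul_comm (fr s _)]
  congr 3
  ring

/-- Derivatives commute with the operator, and the monomial is moved inside in two passes, x-letters
and then ξ-letters. This leaves the sup norm of the operator on a single function, bounded by
`exists_norm_TS_le`. The loss in the parameter is a fixed factor, and the constant depends on the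
matrix only through `a`. -/
theorem exists_GS_TS (d : ℕ) {s σ H a : ℝ} (hs : 0 < s) (hσ : 0 < σ) (hsσ : 1 ≤ s + σ) (hH : 0 < H)
    (hG : 1 ≤ H ∨ 1 < s + σ) (ha : 0 ≤ a) : ∃ K : ℝ, 0 ≤ K ∧
      ∀ A : Matrix (Fin d) (Fin d) ℝ, (∀ i, ∑ k, |cf A i k| ≤ a) →
        ∀ (u : 𝓢(Phase d, ℂ)) (C : ℝ), 0 ≤ C → GS s σ H C u →
          GS s σ (kap s σ a * H) (K * C) (TS A u) := by
  set H₁ : ℝ := 2 ^ s * (2 + a) * H with hH₁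
  set H₂ : ℝ := 2 ^ σ * (2 + a) * H₁ with hH₂
  have hH₁0 : 0 < H₁ := by positivity
  have hH₂0 : 0 < H₂ := by positivity
  have hG₁ : 1 ≤ H₁ ∨ 1 < σ + s := by
    rcases hG with h | h
    · left
      have o1 : (1 : ℝ) ≤ 2 ^ s := Real.one_le_rpow (by norm_num) hs.le
      rw [hH₁]
      exact one_le_mul_of_one_le_of_one_le
        (one_le_mul_of_one_le_of_one_le o1 (by linarith)) h
    · right; linarith
  obtain ⟨B₁, hB₁, hB₁'⟩ := exists_comP_le hsσ hH hG
  obtain ⟨B₂, hB₂, hB₂'⟩ := exists_comP_le (s := σ) (σ := s) (by linarith) hH₁0 hG₁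
  obtain ⟨N, K, hK, hKN⟩ := exists_norm_TS_le d
  -- The cost of the at most `2 * N` additional letters in the Schwartz seminorms.
  set R : ℝ := (max 1 H₂) ^ (2 * N) * (((2 : ℝ) ^ s) ^ (2 * N) * fr s (2 * N)) *
    (((2 : ℝ) ^ σ) ^ (2 * N) * fr σ (2 * N)) with hR
  have hR0 : 0 ≤ R := by
    have := fr_nonneg s (2 * N)
    have := fr_nonneg σ (2 * N)
    positivity
  refine ⟨K * (B₁ * B₂ * R), by positivity, fun A hA u C hC hu m l X => ?_⟩
  obtain ⟨v, hv, hTv⟩ := dl_TS A l u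
  -- The derivatives already taken enter as fixed offsets of the two indices.
  have hBv : BD true (gsB s σ H C (cnt false l) (cnt true l)) v := by
    intro m' l' Y
    have := hu m' (l' ++ l) Y
    rw [dl_append, ← hv, cnt_append, cnt_append, List.length_append] at this
    refine this.trans (le_of_eq ?_)
    unfold gsB
    have e : m'.length + (l'.length + l.length) =
        cnt true m' + cnt (!true) l' + (cnt (!true) m' + cnt true l') + cnt false l + cnt true l := by
      rw [← cnt_true_add_cnt_false m', ← cnt_true_add_cnt_false l', ← cnt_true_add_cnt_false l]
      simp only [Bool.not_true]
      ring
    rw [e]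
    simp only [Bool.not_true, add_assoc]
  set m₁ := m.filter (fun i => i.isLeft) with hm₁
  set m₂ := m.filter (fun i => !i.isLeft) with hm₂
  have hperm : m.Perm (m₂ ++ m₁) := by
    refine List.Perm.trans ?_ List.perm_append_comm
    exact (List.filter_append_perm (fun i : Fin d ⊕ Fin d => i.isLeft) m).symm
  have hl₁ : m₁.length = cnt true m := by
    rw [hm₁, ← List.countP_eq_length_filter, cnt]; congr 1; funext i; simp
  have hl₂ : m₂.length = cnt false m := by
    rw [hm₂, ← List.countP_eq_length_filter, cnt]; congr 1; funext i; simp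
  obtain ⟨v₁, hv₁, hBv₁⟩ := hBv.monomial hs hσ hH ha hC hB₁' hA m₁
    (fun i hi => by simpa using (List.mem_filter.1 hi).2)
  obtain ⟨v₂, hv₂, hBv₂⟩ := hBv₁.swap.monomial hσ hs hH₁0 ha (by positivity) hB₂' hA m₂
    (fun i hi => by simpa using (List.mem_filter.1 hi).2)
  have e1 : |xl m X| * ‖dl l (TS A u) X‖ = ‖TS A v₂ X‖ := by
    rw [← hv₂, ← hv₁, ← hTv, ← mul_assoc, norm_mul, xl_perm hperm, xl_append, ← Complex.ofReal_mul,
      Complex.norm_real, Real.norm_eq_abs]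
  rw [e1]
  set p := cnt false l + m₁.length with hp
  set q := cnt true l + m₂.length with hq
  have c1 := fr_nonneg s p
  have c2 := fr_nonneg σ q
  have final : ∀ (m' l' : List (Fin d ⊕ Fin d)) (Y : Phase d), m'.length ≤ N → l'.length ≤ N →
      |xl m' Y| * ‖dl l' v₂ Y‖ ≤ (B₁ * B₂ * R * C) *
        ((2 ^ (s + σ) * H₂) ^ (p + q) * (fr s p * fr σ q)) := by
    intro m' l' Y hm' hl'
    refine (hBv₂ m' l' Y).trans ?_
    have d1 := cnt_true_add_cnt_false m'
    have d2 := cnt_true_add_cnt_false l'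
    simp only [Bool.not_true, Bool.not_false]
    generalize hP : cnt false m' + cnt true l' = P
    generalize hQ : cnt true m' + cnt false l' = Q
    have hPQ : P + Q ≤ 2 * N := by omega
    unfold gsB
    rw [← hH₂]
    have aux : ∀ {x : ℝ}, 0 < x → ∀ {P r : ℕ}, P ≤ 2 * N → fr x (P + r) ≤
        (((2 : ℝ) ^ x) ^ (2 * N) * fr x (2 * N)) * (((2 : ℝ) ^ x) ^ r * fr x r) := by
      intro x hx P r hP
      have o1 : (1 : ℝ) ≤ 2 ^ x := Real.one_le_rpow (by norm_num) hx.le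
      have := fr_nonneg x r
      have := fr_nonneg x P
      calc _ ≤ _ := fr_add_le hx.le P r
        _ = (((2 : ℝ) ^ x) ^ P * fr x P) * (((2 : ℝ) ^ x) ^ r * fr x r) := by ring
        _ ≤ _ := by
          gcongr ?_ * ?_ * _
          · exact pow_le_pow_right₀ o1 hP
          · exact fr_mono hx.le hP
    have b1 := aux hs (P := Q) (r := p) (by omega)
    have b2 := aux hσ (P := P) (r := q) (by omega)
    have b3 : H₂ ^ (P + Q + q + p) ≤ (max 1 H₂) ^ (2 * N) * H₂ ^ (p + q) := by
      rw [show P + Q + q + p = (P + Q) + (p + q) by ring, pow_add]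
      gcongr
      calc H₂ ^ (P + Q) ≤ (max 1 H₂) ^ (P + Q) := by gcongr; exact le_max_right _ _
        _ ≤ _ := pow_le_pow_right₀ (le_max_left _ _) hPQ
    have o1 : (1 : ℝ) ≤ 2 ^ s := Real.one_le_rpow (by norm_num) hs.le
    have o2 : (1 : ℝ) ≤ 2 ^ σ := Real.one_le_rpow (by norm_num) hσ.le
    have b4 : ((2 : ℝ) ^ s) ^ p ≤ ((2 : ℝ) ^ s) ^ (p + q) := pow_le_pow_right₀ o1 (by omega)
    have b5 : ((2 : ℝ) ^ σ) ^ q ≤ ((2 : ℝ) ^ σ) ^ (p + q) := pow_le_pow_right₀ o2 (by omega)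
    have g1 := fr_nonneg s (2 * N)
    have g2 := fr_nonneg σ (2 * N)
    have g3 := fr_nonneg s (Q + p)
    have g4 := fr_nonneg σ (P + q)
    have g5 : 0 ≤ fr σ (P + q) * fr s (Q + p) := by positivity
    have e9 : (2 ^ (s + σ) * H₂) ^ (p + q) =
        ((2 : ℝ) ^ s) ^ (p + q) * ((2 : ℝ) ^ σ) ^ (p + q) * H₂ ^ (p + q) := by
      clear_value H₂
      rw [Real.rpow_add (by norm_num), mul_pow, mul_pow]
    calc _ ≤ C * B₁ * B₂ * (((max 1 H₂) ^ (2 * N) * H₂ ^ (p + q)) *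
          (((((2 : ℝ) ^ σ) ^ (2 * N) * fr σ (2 * N)) * (((2 : ℝ) ^ σ) ^ (p + q) * fr σ q)) *
          ((((2 : ℝ) ^ s) ^ (2 * N) * fr s (2 * N)) * (((2 : ℝ) ^ s) ^ (p + q) * fr s p)))) := by
          have b2' := b2.trans (show _ ≤ (((2 : ℝ) ^ σ) ^ (2 * N) * fr σ (2 * N)) *
            (((2 : ℝ) ^ σ) ^ (p + q) * fr σ q) by gcongr)
          have b1' := b1.trans (show _ ≤ (((2 : ℝ) ^ s) ^ (2 * N) * fr s (2 * N)) *
            (((2 : ℝ) ^ s) ^ (p + q) * fr s p) by gcongr)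
          gcongr
      _ = _ := by
          rw [hR, e9]
          ring
  refine (hKN A v₂ _ final X).trans (le_of_eq ?_)
  have e2 : m.length + l.length = p + q := by
    rw [hp, hq, hl₁, hl₂, ← cnt_true_add_cnt_false m, ← cnt_true_add_cnt_false l]; ring
  have e3 : kap s σ a * H = 2 ^ (s + σ) * H₂ := by rw [hH₂, hH₁, kap]; ring
  rw [e2, e3, show cnt true m + cnt false l = p by omega, show cnt false m + cnt true l = q by omega]
  ring

/-! ### The operator on the test function spaces and on their duals -/

/-- The factor `c` must not depend on `H`: the Beurling space is handled with `H = h / c` for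
arbitrary `h`. -/
theorem exists_gsNorm_TS_le {s σ : ℝ} (hs : 0 < s) (hσ : 0 < σ) (hsσ : 1 ≤ s + σ)
    (A : Matrix (Fin d) (Fin d) ℝ) :
    ∃ c : ℝ, 0 < c ∧ ∀ {H : ℝ}, 0 < H → (1 ≤ H ∨ 1 < s + σ) → ∃ K : ℝ≥0, ∀ u : 𝓢(Phase d, ℂ),
      gsNorm s σ σ s H u < ∞ → gsNorm s σ σ s (c * H) (TS A u) ≤ K * gsNorm s σ σ s H u := by
  set a : ℝ := ∑ i, ∑ k, |cf A i k| with ha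
  have ha0 : 0 ≤ a := by positivity
  refine ⟨(2 * (d + 1)) ^ (s + σ) * kap s σ a, mul_pos (by positivity) (kap_pos ha0),
    fun {H} hH hG => ?_⟩
  obtain ⟨K, hK, hKb⟩ := exists_GS_TS d hs hσ hsσ hH hG ha0
  refine ⟨K.toNNReal, fun u hu => ?_⟩
  have h1 := GS_of_gsNorm hs.le hσ.le hH (u.smooth _) hu
  have h2 := hKb A (fun i => Finset.single_le_sum (f := fun i => ∑ k, |cf A i k|)
    (fun i _ => by positivity) (Finset.mem_univ i)) u _ ENNReal.toReal_nonneg h1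
  have h3 := gsNorm_le_of_GS hs.le hσ.le (mul_pos (kap_pos ha0) hH) (by positivity) h2
  rw [mul_assoc]
  refine h3.trans (le_of_eq ?_)
  rw [ENNReal.ofReal_mul hK, ENNReal.ofReal_toReal hu.ne]
  rfl

/-! ### The test function spaces in terms of quantitative bounds. -/

theorem mem_SigmaSpace_iff {s σ : ℝ} (hs : 0 < s) (hσ : 0 < σ) {f : Phase d → ℂ} :
    f ∈ SigmaSpace d s σ σ s ↔ ContDiff ℝ (⊤ : ℕ∞) f ∧
      ∀ h, 0 < h → ∃ C, 0 ≤ C ∧ GS s σ h C f := by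
  refine ⟨fun hf => ⟨hf.1, fun h hh => ⟨_, ENNReal.toReal_nonneg,
    GS_of_gsNorm hs.le hσ.le hh hf.1 (hf.2 h hh)⟩⟩, fun hf => ⟨hf.1, fun h hh => ?_⟩⟩
  have hc : (0 : ℝ) < (2 * (d + 1)) ^ (s + σ) := by positivity
  obtain ⟨C, hC, H⟩ := hf.2 (h / (2 * (d + 1)) ^ (s + σ)) (by positivity)
  have := gsNorm_le_of_GS hs.le hσ.le (by positivity) hC H
  rw [mul_div_cancel₀ _ hc.ne'] at this
  exact this.trans_lt ENNReal.ofReal_lt_top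

theorem mem_SSpace_iff {s σ : ℝ} (hs : 0 < s) (hσ : 0 < σ) {f : Phase d → ℂ} :
    f ∈ SSpace d s σ σ s ↔ ContDiff ℝ (⊤ : ℕ∞) f ∧
      ∃ h, 0 < h ∧ ∃ C, 0 ≤ C ∧ GS s σ h C f := by
  constructor
  · rintro ⟨hf, h, hh, hn⟩
    exact ⟨hf, h, hh, _, ENNReal.toReal_nonneg, GS_of_gsNorm hs.le hσ.le hh hf hn⟩
  · rintro ⟨hf, h, hh, C, hC, H⟩
    exact ⟨hf, _, by positivity,
      (gsNorm_le_of_GS hs.le hσ.le hh hC H).trans_lt ENNReal.ofReal_lt_top⟩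

theorem mem_SigmaSpace_iff_Gam {s σ : ℝ} (hs : 0 < s) (hσ : 0 < σ) {f : Phase d → ℂ} :
    f ∈ SigmaSpace d s σ σ s ↔ ContDiff ℝ (⊤ : ℕ∞) f ∧ ∀ h r, 0 < h → 0 < r →
      ∃ C, 0 ≤ C ∧ Gam s σ h C (fun X => Real.exp (-r * gauge s σ X)) f := by
  rw [mem_SigmaSpace_iff hs hσ]
  refine and_congr_right fun hf => ⟨fun H h r hh hr => ?_, fun H h hh => ?_⟩
  · have hl := lam_pos d hs hσ hr
    have hc : (0 : ℝ) < 2 ^ (s + σ) := by positivity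
    -- The first entry meets the required Gevrey parameter, the second the smallness condition of
    -- `GS.gam` for the required decay.
    set k := min (h / 2 ^ (s + σ)) (1 / (lam d s σ r * 2 ^ (s + σ))) with hk
    have hk0 : 0 < k := by positivity
    obtain ⟨C, hC, HC⟩ := H k hk0
    have h1 : lam d s σ r * k * 2 ^ (s + σ) ≤ 1 := by
      have := min_le_right (h / 2 ^ (s + σ)) (1 / (lam d s σ r * 2 ^ (s + σ)))
      rw [← hk, le_div_iff₀ (by positivity)] at this
      linarith
    have h2 : 2 ^ (s + σ) * k ≤ h := by
      have := min_le_left (h / 2 ^ (s + σ)) (1 / (lam d s σ r * 2 ^ (s + σ)))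
      rw [← hk, le_div_iff₀ (by positivity)] at this
      linarith
    exact ⟨_, by positivity, (HC.gam hs hσ hk0.le hC hr h1).mono (by positivity) h2
      (fun X => by positivity) fun X => le_rfl⟩
  · obtain ⟨r, hr, hle⟩ := exists_monoFac_le hs hσ hh
    obtain ⟨C, hC, HC⟩ := H h r hh hr
    have := HC.gs hs hσ hh.le hC hr
    rw [max_eq_left hle] at this
    exact ⟨C, hC, this⟩

theorem mem_SSpace_iff_Gam {s σ : ℝ} (hs : 0 < s) (hσ : 0 < σ) {f : Phase d → ℂ} :
    f ∈ SSpace d s σ σ s ↔ ContDiff ℝ (⊤ : ℕ∞) f ∧ ∃ h r, 0 < h ∧ 0 < r ∧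
      ∃ C, 0 ≤ C ∧ Gam s σ h C (fun X => Real.exp (-r * gauge s σ X)) f := by
  rw [mem_SSpace_iff hs hσ]
  refine and_congr_right fun hf => ⟨?_, ?_⟩
  · rintro ⟨h, hh, C, hC, H⟩
    obtain ⟨r, hr, hle⟩ := exists_lam_le d hs hσ (h := 1 / (h * 2 ^ (s + σ))) (by positivity)
    refine ⟨_, r, by positivity, hr, _, by positivity, H.gam hs hσ hh.le hC hr ?_⟩
    rw [le_div_iff₀ (by positivity)] at hle
    linarith
  · rintro ⟨h, r, hh, hr, C, hC, H⟩
    exact ⟨_, lt_max_of_lt_left hh, C, hC, H.gs hs hσ hh.le hC hr⟩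

/-! ### Transposition on the dual of an invariant space. -/

/-- Spaces of Schwartz functions that are invariant under the operators `e^{i⟨A D_ξ, D_x⟩}`. -/
structure IsInvariant (V : Submodule ℂ (Phase d → ℂ)) : Prop where
  exists_schwartz : ∀ f ∈ V, ∃ u : 𝓢(Phase d, ℂ), ⇑u = f
  mem : ∀ (A : Matrix (Fin d) (Fin d) ℝ) (u : 𝓢(Phase d, ℂ)), ⇑u ∈ V → ⇑(TS A u) ∈ V

namespace IsInvariant

variable {V : Submodule ℂ (Phase d → ℂ)}

/-- The Schwartz function given by an element of `V`. -/
def toS (hV : IsInvariant V) (φ : V) : 𝓢(Phase d, ℂ) := (hV.exists_schwartz φ φ.2).choose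

@[simp] theorem coe_toS (hV : IsInvariant V) (φ : V) : ⇑(hV.toS φ) = φ :=
  (hV.exists_schwartz φ φ.2).choose_spec

theorem toS_mk (hV : IsInvariant V) (u : 𝓢(Phase d, ℂ)) (hu : ⇑u ∈ V) : hV.toS ⟨u, hu⟩ = u :=
  DFunLike.coe_injective (hV.coe_toS _)

/-- The operator `e^{i⟨A D_ξ, D_x⟩}` on `V`. -/
def op (hV : IsInvariant V) (A : Matrix (Fin d) (Fin d) ℝ) : V →ₗ[ℂ] V where
  toFun φ := ⟨TS A (hV.toS φ), hV.mem A _ (by rw [coe_toS]; exact φ.2)⟩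
  map_add' φ ψ := by
    have : hV.toS (φ + ψ) = hV.toS φ + hV.toS ψ := DFunLike.coe_injective (by simp)
    apply Subtype.ext
    simp [this]
  map_smul' c φ := by
    have : hV.toS (c • φ) = c • hV.toS φ := DFunLike.coe_injective (by simp)
    apply Subtype.ext
    simp [this]

theorem coe_op (hV : IsInvariant V) (A : Matrix (Fin d) (Fin d) ℝ) (φ : V) :
    (hV.op A φ : Phase d → ℂ) = TS A (hV.toS φ) := rfl

theorem toS_op (hV : IsInvariant V) (A : Matrix (Fin d) (Fin d) ℝ) (φ : V) :
    hV.toS (hV.op A φ) = TS A (hV.toS φ) := DFunLike.coe_injective (by rw [coe_toS, coe_op])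

theorem op_neg_op (hV : IsInvariant V) (A : Matrix (Fin d) (Fin d) ℝ) (φ : V) :
    hV.op A (hV.op (-A) φ) = φ := by
  apply Subtype.ext
  rw [coe_op, toS_op, ← TS_add, add_neg_cancel, TS_zero, coe_toS]

theorem isExpADD_iff (hV : IsInvariant V) (A : Matrix (Fin d) (Fin d) ℝ) (a b : V →ₗ[ℂ] ℂ) :
    IsExpADD A a b ↔ b = a ∘ₗ hV.op A := by
  have h1 : ∀ φ : V, (hV.op A φ : Phase d → ℂ) = expADD A φ := fun φ => by
    rw [coe_op, coe_TS, coe_toS]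
  constructor
  · intro h
    ext φ
    obtain ⟨ψ, hψ, hb⟩ := h φ
    rw [hb, LinearMap.comp_apply]
    congr 1
    exact Subtype.ext (hψ.trans (h1 φ).symm)
  · rintro rfl φ
    exact ⟨hV.op A φ, h1 φ, rfl⟩

/-- The assertion on existence, uniqueness and symbols for a dual space that is stable under the
transposed operators, if the operators map symbols to symbols. -/
theorem exists_unique_and_iff (hV : IsInvariant V) {P : (V →ₗ[ℂ] ℂ) → Prop}
    (hP : ∀ A a, P a → P (a ∘ₗ hV.op A)) {s σ : ℝ} {ω : Phase d → ℝ}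
    (hM : ∀ A a, P a → MemGammaZero s σ ω a → MemGammaZero s σ ω (a ∘ₗ hV.op A))
    (A : Matrix (Fin d) (Fin d) ℝ) (a : {a : V →ₗ[ℂ] ℂ // P a}) :
    (∃! b : {a : V →ₗ[ℂ] ℂ // P a}, IsExpADD A a.1 b.1) ∧
      ∀ b : {a : V →ₗ[ℂ] ℂ // P a}, IsExpADD A a.1 b.1 →
        (MemGammaZero s σ ω a.1 ↔ MemGammaZero s σ ω b.1) := by
  refine ⟨⟨⟨a.1 ∘ₗ hV.op A, hP A a.1 a.2⟩, (hV.isExpADD_iff A _ _).2 rfl, fun b hb =>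
    Subtype.ext ((hV.isExpADD_iff A _ _).1 hb)⟩, fun b hb => ?_⟩
  have hb' := (hV.isExpADD_iff A _ _).1 hb
  refine ⟨fun h => hb' ▸ hM A a.1 a.2 h, fun h => ?_⟩
  -- The converse is the direct implication for the inverse operator, which belongs to -A.
  have h1 := hM (-A) b.1 b.2 h
  have h2 : b.1 ∘ₗ hV.op (-A) = a.1 := by
    rw [hb']
    ext φ
    simp only [LinearMap.comp_apply, hV.op_neg_op]
  rwa [h2] at h1

end IsInvariant

theorem isInvariant_SSpace {s σ : ℝ} (hs : 0 < s) (hσ : 0 < σ) (hsσ : 1 ≤ s + σ) :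
    IsInvariant (SSpace d s σ σ s) where
  exists_schwartz f hf := by
    obtain ⟨h1, h, hh, C, hC, H⟩ := (mem_SSpace_iff hs hσ).1 hf
    exact H.exists_schwartz h1
  mem A u hu := by
    obtain ⟨h1, h, hh, hn⟩ := hu
    obtain ⟨c, hc, hcK⟩ := exists_gsNorm_TS_le hs hσ hsσ A
    -- The Roumieu norms may be weakened, so the parameter is raised to at least 1; this covers s +
    -- σ = 1.
    obtain ⟨K, hK⟩ := hcK (H := max h 1) (by positivity) (Or.inl (le_max_right _ _))
    have h2 := (gsNorm_anti hh (le_max_left h 1) u).trans_lt hn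
    exact ⟨(TS A u).smooth _, _, mul_pos hc (by positivity),
      (hK u h2).trans_lt (ENNReal.mul_lt_top ENNReal.coe_lt_top h2)⟩

theorem SDual_op {s σ : ℝ} (hs : 0 < s) (hσ : 0 < σ) (hsσ : 1 ≤ s + σ)
    (hV : IsInvariant (SSpace d s σ σ s)) (A : Matrix (Fin d) (Fin d) ℝ)
    (a : SSpace d s σ σ s →ₗ[ℂ] ℂ)
    (ha : ∀ h : ℝ, 0 < h → ∃ C : ℝ≥0, ∀ φ : SSpace d s σ σ s,
      gsNorm s σ σ s h (φ : Phase d → ℂ) < ∞ →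
      ‖a φ‖ₑ ≤ C * gsNorm s σ σ s h (φ : Phase d → ℂ)) (h : ℝ) (hh : 0 < h) :
    ∃ C : ℝ≥0, ∀ φ : SSpace d s σ σ s, gsNorm s σ σ s h (φ : Phase d → ℂ) < ∞ →
      ‖(a ∘ₗ hV.op A) φ‖ₑ ≤ C * gsNorm s σ σ s h (φ : Phase d → ℂ) := by
  obtain ⟨c, hc, hcK⟩ := exists_gsNorm_TS_le hs hσ hsσ A
  obtain ⟨K, hK⟩ := hcK (H := max h 1) (by positivity) (Or.inl (le_max_right _ _))
  obtain ⟨C, hC⟩ := ha (c * max h 1) (by positivity)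
  refine ⟨C * K, fun φ hφ => ?_⟩
  have h1 := gsNorm_anti (s₁ := s) (s₂ := σ) (σ₁ := σ) (σ₂ := s) hh (le_max_left h 1)
    (φ : Phase d → ℂ)
  have h2 := h1.trans_lt hφ
  have h3 := hK (hV.toS φ)
  rw [hV.coe_toS] at h3
  have h4 := h3 h2
  have h5 := hC (hV.op A φ) (h4.trans_lt (ENNReal.mul_lt_top ENNReal.coe_lt_top h2))
  calc ‖(a ∘ₗ hV.op A) φ‖ₑ ≤ C * (K * gsNorm s σ σ s h (φ : Phase d → ℂ)) :=
        h5.trans (mul_le_mul_right (h4.trans (mul_le_mul_right h1 _)) _)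
    _ = _ := by rw [ENNReal.coe_mul, mul_assoc]

theorem isInvariant_SigmaSpace {s σ : ℝ} (hs : 0 < s) (hσ : 0 < σ) (hsσ : 1 < s + σ) :
    IsInvariant (SigmaSpace d s σ σ s) where
  exists_schwartz f hf := by
    obtain ⟨h1, H⟩ := (mem_SigmaSpace_iff hs hσ).1 hf
    obtain ⟨C, hC, H⟩ := H 1 one_pos
    exact H.exists_schwartz h1
  mem A u hu := by
    obtain ⟨c, hc, hcK⟩ := exists_gsNorm_TS_le hs hσ hsσ.le A
    refine ⟨(TS A u).smooth _, fun h hh => ?_⟩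
    -- Arbitrarily small parameters are needed here, which is why the strict inequality s + σ > 1 is
    -- used.
    obtain ⟨K, hK⟩ := hcK (H := h / c) (by positivity) (Or.inr hsσ)
    have h2 := hu.2 (h / c) (by positivity)
    have h3 := hK u h2
    rw [mul_div_cancel₀ _ hc.ne'] at h3
    exact h3.trans_lt (ENNReal.mul_lt_top ENNReal.coe_lt_top h2)

theorem SigmaDual_op {s σ : ℝ} (hs : 0 < s) (hσ : 0 < σ) (hsσ : 1 < s + σ)
    (hV : IsInvariant (SigmaSpace d s σ σ s)) (A : Matrix (Fin d) (Fin d) ℝ)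
    (a : SigmaSpace d s σ σ s →ₗ[ℂ] ℂ)
    (ha : ∃ h : ℝ, 0 < h ∧ ∃ C : ℝ≥0, ∀ φ : SigmaSpace d s σ σ s,
      ‖a φ‖ₑ ≤ C * gsNorm s σ σ s h (φ : Phase d → ℂ)) :
    ∃ h : ℝ, 0 < h ∧ ∃ C : ℝ≥0, ∀ φ : SigmaSpace d s σ σ s,
      ‖(a ∘ₗ hV.op A) φ‖ₑ ≤ C * gsNorm s σ σ s h (φ : Phase d → ℂ) := by
  obtain ⟨h, hh, C, hC⟩ := ha
  obtain ⟨c, hc, hcK⟩ := exists_gsNorm_TS_le hs hσ hsσ.le A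
  obtain ⟨K, hK⟩ := hcK (H := h / c) (by positivity) (Or.inr hsσ)
  refine ⟨h / c, by positivity, C * K, fun φ => ?_⟩
  have h3 := hK (hV.toS φ)
  rw [hV.coe_toS, mul_div_cancel₀ _ hc.ne'] at h3
  have h4 := h3 (φ.2.2 _ (by positivity))
  calc ‖(a ∘ₗ hV.op A) φ‖ₑ ≤ C * (K * gsNorm s σ σ s (h / c) (φ : Phase d → ℂ)) :=
        (hC (hV.op A φ)).trans (mul_le_mul_right h4 _)
    _ = _ := by rw [ENNReal.coe_mul, mul_assoc]

/-! ### Characters, translations, and triviality of the critical Beurling space -/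

/-- The character `X ↦ e^{i⟨X, Z⟩}`. -/
def ch (Z X : Phase d) : ℂ := Complex.exp (Complex.I * (inner ℝ X Z : ℝ))

theorem norm_ch (Z X : Phase d) : ‖ch Z X‖ = 1 := by
  rw [ch, mul_comm]; exact Complex.norm_exp_ofReal_mul_I _

theorem hasFDerivAt_ch (Z X : Phase d) : HasFDerivAt (ch Z)
    (ch Z X • Complex.I • (Complex.ofRealCLM.comp (innerSL ℝ Z))) X := by
  have h0 : HasFDerivAt (fun X : Phase d => (inner ℝ X Z : ℝ)) (innerSL ℝ Z) X := by
    have : (fun X : Phase d => (inner ℝ X Z : ℝ)) = innerSL ℝ Z := by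
      funext X; rw [innerSL_apply_apply, real_inner_comm]
    rw [this]
    exact (innerSL ℝ Z).hasFDerivAt
  exact ((Complex.ofRealCLM.hasFDerivAt.comp X h0).const_mul Complex.I).cexp

theorem contDiff_ch (Z : Phase d) : ContDiff ℝ (⊤ : ℕ∞) (ch Z) := by
  have h0 : ContDiff ℝ (⊤ : ℕ∞) (fun X : Phase d => (inner ℝ X Z : ℝ)) :=
    contDiff_id.inner ℝ contDiff_const
  exact (contDiff_const.mul (Complex.ofRealCLM.contDiff.comp h0)).cexp

theorem pderiv_ch (Z : Phase d) (i : Fin d ⊕ Fin d) : pderiv i (ch Z) = (Complex.I * Z i) • ch Z := by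
  funext X
  rw [pderiv, (hasFDerivAt_ch Z X).fderiv]
  have h : inner ℝ Z (EuclideanSpace.single i (1 : ℝ) : Phase d) = Z i := by
    rw [EuclideanSpace.inner_single_right]; simp
  simp [mul_comm, h]

theorem dl_ch (Z : Phase d) (l : List (Fin d ⊕ Fin d)) :
    dl l (ch Z) = (Complex.I ^ l.length * xl l Z) • ch Z := by
  induction l with
  | nil => simp
  | cons i l ih =>
    rw [dl_cons, ih, pderiv_smul (contDiff_ch Z), pderiv_ch, smul_smul, xl_cons, List.length_cons]
    congr 1
    push_cast
    ring

/-- Derivatives of a character are monomials in the frequency. Since derivatives in x carry σ and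
those in ξ carry s, the frequency is measured by the gauge with exchanged exponents. The rate `r`
trades the Gevrey parameter against the size of the constant. -/
theorem Gam_ch {s σ r : ℝ} (hs : 0 < s) (hσ : 0 < σ) (hr : 0 < r) (Z : Phase d) :
    Gam s σ (monoFac σ s r) (Real.exp (r * gauge σ s Z)) (fun _ => 1) (ch Z) := by
  intro l X
  rw [dl_ch, Pi.smul_apply, norm_smul, norm_ch, norm_mul, norm_pow, Complex.norm_I, one_pow,
    one_mul, mul_one, mul_one, Complex.norm_real, Real.norm_eq_abs]
  exact (abs_xl_le_exp hσ hs hr l Z).trans (le_of_eq (by ring))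

theorem fourier_eq_integral_ch (f : Phase d → ℂ) (Ξ : Phase d) :
    𝓕 f Ξ = ∫ X, ch ((-(2 * Real.pi)) • Ξ) X * f X := by
  rw [Real.fourier_eq']
  congr 1
  funext X
  rw [ch, smul_eq_mul, inner_smul_right]
  congr 2
  push_cast
  ring

theorem eq_zero_of_integral_ch_eq_zero (u : 𝓢(Phase d, ℂ)) (h : ∀ Z, ∫ X, ch Z X * u X = 0) :
    u = 0 := by
  have : 𝓕 u = 0 := by
    ext Ξ
    rw [SchwartzMap.fourier_coe, fourier_eq_integral_ch, h]
    rfl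
  rw [← FourierTransform.fourierInv_fourier_eq (F := 𝓢(Phase d, ℂ)) u, this]
  exact map_zero (FourierTransform.fourierInvCLM ℂ 𝓢(Phase d, ℂ))

/-! Translations -/

theorem dl_translate (l : List (Fin d ⊕ Fin d)) (f : Phase d → ℂ) (Y : Phase d) :
    dl l (fun X => f (X + Y)) = fun X => dl l f (X + Y) := by
  induction l with
  | nil => rfl
  | cons i l ih =>
    rw [dl_cons, ih]
    funext X
    rw [pderiv, fderiv_comp_add_right]
    rfl

theorem Gam.translate {s σ h C : ℝ} {w : Phase d → ℝ} {f : Phase d → ℂ} (H : Gam s σ h C w f)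
    (Y : Phase d) : Gam s σ h C (fun X => w (X + Y)) (fun X => f (X + Y)) := by
  intro l X
  rw [dl_translate]
  exact H l (X + Y)

/-- The quasi-triangle inequality for X = (X + Y) - Y: translation preserves exponential decay, with
the rate divided by the quasi-norm constant. -/
theorem neg_gauge_add_le {s σ r : ℝ} (hs : 0 < s) (hσ : 0 < σ) (hr : 0 ≤ r) (X Y : Phase d) :
    -r * gauge s σ (X + Y) ≤ -(r / quasi s σ) * gauge s σ X + r * gauge s σ Y := by
  have h := gauge_add_le hs hσ (X + Y) (-Y)
  rw [add_neg_cancel_right, gauge_neg] at h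
  have hq := quasi_pos s σ
  have : r / quasi s σ * gauge s σ X ≤
      r / quasi s σ * (quasi s σ * (gauge s σ (X + Y) + gauge s σ Y)) := by gcongr
  rw [← mul_assoc, div_mul_cancel₀ _ hq.ne'] at this
  linarith

theorem Gam.translate_exp {s σ h C r : ℝ} (hs : 0 < s) (hσ : 0 < σ) (hh : 0 ≤ h) (hC : 0 ≤ C)
    (hr : 0 ≤ r) {f : Phase d → ℂ} (H : Gam s σ h C (fun X => Real.exp (-r * gauge s σ X)) f)
    (Y : Phase d) : Gam s σ h (C * Real.exp (r * gauge s σ Y))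
      (fun X => Real.exp (-(r / quasi s σ) * gauge s σ X)) (fun X => f (X + Y)) := by
  refine (H.translate Y).mono hh le_rfl (fun X => by positivity) fun X => ?_
  rw [mul_assoc, ← Real.exp_add]
  gcongr
  linarith [neg_gauge_add_le hs hσ hr X Y]

theorem contDiff_translate {f : Phase d → ℂ} (hf : ContDiff ℝ (⊤ : ℕ∞) f) (Y : Phase d) :
    ContDiff ℝ (⊤ : ℕ∞) (fun X => f (X + Y)) :=
  hf.comp (contDiff_id.add contDiff_const)

theorem SigmaSpace_translate {s σ : ℝ} (hs : 0 < s) (hσ : 0 < σ) {f : Phase d → ℂ}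
    (hf : f ∈ SigmaSpace d s σ σ s) (Y : Phase d) :
    (fun X => f (X + Y)) ∈ SigmaSpace d s σ σ s := by
  rw [mem_SigmaSpace_iff_Gam hs hσ] at hf ⊢
  refine ⟨contDiff_translate hf.1 Y, fun h r hh hr => ?_⟩
  have hq := quasi_pos s σ
  obtain ⟨C, hC, H⟩ := hf.2 h (r * quasi s σ) hh (by positivity)
  have := H.translate_exp hs hσ hh.le hC (by positivity) Y
  rw [mul_div_cancel_right₀ _ hq.ne'] at this
  exact ⟨_, by positivity, this⟩

theorem SSpace_translate {s σ : ℝ} (hs : 0 < s) (hσ : 0 < σ) {f : Phase d → ℂ}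
    (hf : f ∈ SSpace d s σ σ s) (Y : Phase d) :
    (fun X => f (X + Y)) ∈ SSpace d s σ σ s := by
  rw [mem_SSpace_iff_Gam hs hσ] at hf ⊢
  obtain ⟨h1, h, r, hh, hr, C, hC, H⟩ := hf
  have hq := quasi_pos s σ
  exact ⟨contDiff_translate h1 Y, h, _, hh, by positivity, _, by positivity,
    H.translate_exp hs hσ hh.le hC hr.le Y⟩

/-! ### Products with symbols, and the critical Beurling space. -/

theorem SigmaSpace_mul {s σ r₀ : ℝ} (hs : 0 < s) (hσ : 0 < σ) {e φ : Phase d → ℂ}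
    (he : ContDiff ℝ (⊤ : ℕ∞) e)
    (H : ∀ h, 0 < h → ∃ C, 0 ≤ C ∧ Gam s σ h C (fun X => Real.exp (r₀ * gauge s σ X)) e)
    (hφ : φ ∈ SigmaSpace d s σ σ s) : e * φ ∈ SigmaSpace d s σ σ s := by
  rw [mem_SigmaSpace_iff_Gam hs hσ] at hφ ⊢
  refine ⟨he.mul hφ.1, fun h r hh hr => ?_⟩
  obtain ⟨C, hC, HC⟩ := H (h / 2) (by positivity)
  obtain ⟨C', hC', HC'⟩ := hφ.2 (h / 2) (r + |r₀|) (by positivity) (by positivity)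
  have h1 := Gam.mul hs.le hσ.le (by positivity) he hφ.1 (fun X => by positivity)
    (fun X => by positivity) HC HC'
  refine ⟨C * C', by positivity, h1.mono (by positivity) (by linarith) (fun X => by positivity)
    fun X => ?_⟩
  rw [← Real.exp_add]
  gcongr
  nlinarith [gauge_nonneg s σ X, le_abs_self r₀]

theorem SigmaSpace_ch_mul {s σ : ℝ} (hs : 0 < s) (hσ : 0 < σ) (Z : Phase d) {φ : Phase d → ℂ}
    (hφ : φ ∈ SigmaSpace d s σ σ s) : ch Z * φ ∈ SigmaSpace d s σ σ s := by
  refine SigmaSpace_mul (r₀ := 0) hs hσ (contDiff_ch Z) (fun h hh => ?_) hφ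
  obtain ⟨r, hr, hle⟩ := exists_monoFac_le hσ hs hh
  refine ⟨_, by positivity, (Gam_ch hs hσ hr Z).mono (monoFac_pos hσ hs hr).le hle
    (fun X => zero_le_one) (C' := Real.exp (r * gauge σ s Z)) fun X => ?_⟩
  simp

/-- The space is stable under multiplication by characters. If all integrals vanished, so would all
Fourier transforms. -/
theorem SigmaSpace_exists_integral_ne_zero {s σ : ℝ} (hs : 0 < s) (hσ : 0 < σ)
    (h : SigmaSpace d s σ σ s ≠ ⊥) : ∃ φ ∈ SigmaSpace d s σ σ s, ∫ X, φ X ≠ 0 := by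
  by_contra! hc
  refine h ((Submodule.eq_bot_iff _).2 fun φ hφ => ?_)
  obtain ⟨h1, H⟩ := (mem_SigmaSpace_iff hs hσ).1 hφ
  obtain ⟨C, hC, H⟩ := H 1 one_pos
  obtain ⟨u, rfl⟩ := H.exists_schwartz h1
  rw [eq_zero_of_integral_ch_eq_zero u fun Z => hc _ (SigmaSpace_ch_mul hs hσ Z hφ)]
  rfl

theorem integral_DS_eq_zero (i : Fin d ⊕ Fin d) (u : 𝓢(Phase d, ℂ)) : ∫ X, DS i u X = 0 := by
  have := integral_mul_fderiv_eq_neg_fderiv_mul_of_integrable (μ := (volume : Measure (Phase d)))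
    (f := fun _ => (1 : ℂ)) (g := u) (v := EuclideanSpace.single i (1 : ℝ)) (by simp)
    (by simp only [one_mul]; exact (DS i u).integrable) (by simpa using u.integrable)
    (fun X _ => differentiableAt_const _) (fun X _ => u.differentiableAt)
  simp only [one_mul, fderiv_fun_const, Pi.zero_apply, _root_.zero_apply, zero_mul,
    integral_zero, neg_zero] at this
  exact this

theorem DS_MS (i : Fin d ⊕ Fin d) (u : 𝓢(Phase d, ℂ)) : DS i (MS i u) = u + MS i (DS i u) := by
  have hu : ContDiff ℝ (⊤ : ℕ∞) u := u.smooth _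
  have h := dl_coord_mul hu i [i]
  ext X
  have e : ⇑(MS i u) = (fun X : Phase d => (X i : ℂ)) * ⇑u := by funext X; exact MS_apply i u X
  rw [coe_DS, e]
  change dl [i] _ X = _
  rw [h]
  simp [MS_apply, dl_nil, dl_cons, ← coe_DS, add_comm]

theorem DS_MS_iterate (i : Fin d ⊕ Fin d) (n : ℕ) (u : 𝓢(Phase d, ℂ)) :
    DS i ((MS i)^[n + 1] u) = (n + 1 : ℂ) • (MS i)^[n] u + (MS i)^[n + 1] (DS i u) := by
  induction n with
  | zero => simp [DS_MS]
  | succ n ih =>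
    rw [Function.iterate_succ_apply' _ (n + 1), DS_MS, ih, Function.iterate_succ_apply' _ (n + 1)]
    ext X
    simp [MS_apply, Function.iterate_succ_apply']
    ring

/-- Repeated integration by parts: each derivative hits the power and produces the next factor of
the factorial. -/
theorem integral_MS_DS_iterate (i : Fin d ⊕ Fin d) (n : ℕ) (u : 𝓢(Phase d, ℂ)) :
    ∫ X, (MS i)^[n] ((DS i)^[n] u) X = (-1) ^ n * (n.factorial : ℂ) * ∫ X, u X := by
  induction n with
  | zero => simp
  | succ n ih =>
    have h1 := DS_MS_iterate i n ((DS i)^[n] u)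
    have h2 : ∫ X, ((n + 1 : ℂ) • (MS i)^[n] ((DS i)^[n] u) + (MS i)^[n + 1] (DS i ((DS i)^[n] u)) :
      𝓢(Phase d, ℂ)) X = 0 := by rw [← h1]; exact integral_DS_eq_zero i _
    simp only [_root_.add_apply, _root_.smul_apply] at h2
    have hi : Integrable (fun X => (n + 1 : ℂ) • ((MS i)^[n] ((DS i)^[n] u)) X) :=
      (SchwartzMap.integrable _).smul (n + 1 : ℂ)
    rw [integral_add hi (SchwartzMap.integrable _), integral_smul, ih] at h2
    rw [Function.iterate_succ_apply' (DS i)]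
    rw [eq_neg_of_add_eq_zero_right h2, Nat.factorial_succ]
    push_cast
    rw [smul_eq_mul]
    ring

theorem MS_DS_iterate_apply (i : Fin d ⊕ Fin d) (n k : ℕ) (u : 𝓢(Phase d, ℂ)) (X : Phase d) :
    (MS i)^[n] ((DS i)^[k] u) X =
      (xl (List.replicate n i) X : ℂ) * dl (List.replicate k i) u X := by
  have h : ∀ k, ⇑((DS i)^[k] u) = dl (List.replicate k i) u := by
    intro k
    induction k with
    | zero => rfl
    | succ k ih => rw [Function.iterate_succ_apply', coe_DS, ih]; rfl
  rw [← h]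
  induction n with
  | zero => simp
  | succ n ih =>
    rw [Function.iterate_succ_apply', MS_apply, ih, List.replicate_succ, xl_cons]
    push_cast
    ring

/-- The integral of x_j^n ∂_j^n u is ± n! ∫ u, while the Beurling bounds make it at most a constant
times ε^n n!^{s+σ} = ε^n n! with ε as small as desired. Hence every integral vanishes, which
contradicts `SigmaSpace_exists_integral_ne_zero` for a nontrivial space. -/
theorem SigmaSpace_eq_bot {s σ : ℝ} (hs : 0 < s) (hσ : 0 < σ) (hsσ : s + σ = 1) (j : Fin d) :
    SigmaSpace d s σ σ s = ⊥ := by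
  by_contra hne
  obtain ⟨φ, hφ, hint⟩ := SigmaSpace_exists_integral_ne_zero hs hσ hne
  obtain ⟨h0, H0⟩ := (mem_SigmaSpace_iff hs hσ).1 hφ
  obtain ⟨C0, hC0, H1⟩ := H0 1 one_pos
  obtain ⟨u, rfl⟩ := H1.exists_schwartz h0
  have hM := monoFac_pos hs hσ one_pos
  -- The parameter turns the cost of the monomial into (1/2)^n. Decay at rate 2 leaves rate 1, after
  -- the monomial has used rate 1, and the result is integrable.
  obtain ⟨C, hC, H⟩ := ((mem_SigmaSpace_iff_Gam hs hσ).1 hφ).2 (1 / (2 * monoFac s σ 1)) 2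
    (by positivity) two_pos
  set i : Fin d ⊕ Fin d := Sum.inl j
  set J := ∫ X : Phase d, Real.exp (-1 * gauge s σ X) with hJ
  have key : ∀ n : ℕ, ‖∫ X, u X‖ ≤ C * J * (1 / 2) ^ n := by
    intro n
    have hn : (0 : ℝ) < (n.factorial : ℝ) := by exact_mod_cast n.factorial_pos
    have hb : ∀ X, ‖(MS i)^[n] ((DS i)^[n] u) X‖ ≤
        C * (1 / 2) ^ n * n.factorial * Real.exp (-1 * gauge s σ X) := by
      intro X
      rw [MS_DS_iterate_apply, norm_mul, Complex.norm_real, Real.norm_eq_abs]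
      have a1 := abs_xl_le_exp hs hσ one_pos (List.replicate n i) X
      have a2 := H (List.replicate n i) X
      simp only [cnt_replicate, List.length_replicate, i, Sum.isLeft_inl, if_true,
        Bool.true_eq_false, if_false, fr_zero, mul_one] at a1 a2
      have f1 : fr s n * fr σ n = n.factorial := by
        rw [fr, fr, ← Real.rpow_add hn, hsσ, Real.rpow_one]
      have f2 := fr_nonneg s n
      have f3 := fr_nonneg σ n
      calc _ ≤ (monoFac s σ 1 ^ n * fr s n * Real.exp (1 * gauge s σ X)) *
            (C * ((1 / (2 * monoFac s σ 1)) ^ n * fr σ n) * Real.exp (-2 * gauge s σ X)) := by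
              gcongr
        _ = C * ((monoFac s σ 1) * (1 / (2 * monoFac s σ 1))) ^ n * (fr s n * fr σ n) *
            (Real.exp (1 * gauge s σ X) * Real.exp (-2 * gauge s σ X)) := by rw [mul_pow]; ring
        _ = _ := by
          rw [f1, ← Real.exp_add]
          congr 2
          · congr 2
            field_simp
          · ring
    have h1 : ‖∫ X, (MS i)^[n] ((DS i)^[n] u) X‖ ≤ C * (1 / 2) ^ n * n.factorial * J := by
      rw [hJ, ← integral_const_mul]
      exact norm_integral_le_of_norm_le ((integrable_exp_gauge hs hσ one_pos).const_mul _)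
        (Filter.Eventually.of_forall hb)
    rw [integral_MS_DS_iterate, norm_mul, norm_mul, norm_pow, norm_neg, norm_one, one_pow, one_mul,
      Complex.norm_natCast] at h1
    refine le_of_mul_le_mul_left (h1.trans (le_of_eq ?_)) hn
    ring
  have hlim : Filter.Tendsto (fun n : ℕ => C * J * (1 / 2) ^ n) Filter.atTop (nhds 0) := by
    simpa using (tendsto_pow_atTop_nhds_zero_of_lt_one (by norm_num : (0 : ℝ) ≤ 1 / 2)
      (by norm_num)).const_mul (C * J)
  have := ge_of_tendsto' hlim key
  exact hint (norm_le_zero_iff.1 this)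

/-! ### Smoothness of families of functions, moderate weights -/

/-- The coordinate `i` as a complex valued linear map. -/
def coordC (i : Fin d ⊕ Fin d) : Phase d →L[ℝ] ℂ :=
  Complex.ofRealCLM.comp (EuclideanSpace.proj (𝕜 := ℝ) i : Phase d →L[ℝ] ℝ)

theorem coordC_single (i j : Fin d ⊕ Fin d) :
    coordC i (EuclideanSpace.single j (1 : ℝ) : Phase d) = if i = j then 1 else 0 := by
  simp only [coordC, ContinuousLinearMap.comp_apply, PiLp.proj_apply, Complex.ofRealCLM_apply,
    EuclideanSpace.single, PiLp.single_apply]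
  split_ifs <;> simp

theorem fderiv_eq_sum_coordC (f : Phase d → ℂ) (X : Phase d) :
    fderiv ℝ f X = ∑ i, pderiv i f X • coordC i := by
  rw [fderiv_eq_sum_pderiv]
  refine Finset.sum_congr rfl fun i _ => ?_
  ext v
  simp [coordC, mul_comm]

theorem hasFDerivAt_dl {f : Phase d → ℂ} (hf : ContDiff ℝ (⊤ : ℕ∞) f)
    (l : List (Fin d ⊕ Fin d)) (X : Phase d) :
    HasFDerivAt (dl l f) (∑ i, dl (i :: l) f X • coordC i) X := by
  have h := ((contDiff_dl hf l).differentiable (by simp) X).hasFDerivAt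
  rwa [fderiv_eq_sum_coordC] at h

/-- A family indexed by words in which prefixing a letter is differentiation consists of smooth
functions. It thus suffices to differentiate parameter integrals and series once, for all words. -/
theorem contDiff_of_family {G : List (Fin d ⊕ Fin d) → Phase d → ℂ}
    (hG : ∀ l X, HasFDerivAt (G l) (∑ i, G (i :: l) X • coordC i) X)
    (l : List (Fin d ⊕ Fin d)) : ContDiff ℝ (⊤ : ℕ∞) (G l) := by
  refine contDiff_infty.2 fun n => ?_
  induction n generalizing l with
  | zero =>
    exact contDiff_zero.2 (continuous_iff_continuousAt.2 fun X => (hG l X).continuousAt)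
  | succ n ih =>
    push_cast
    exact contDiff_succ_iff_hasFDerivAt.2 ⟨fun X => ∑ i, G (i :: l) X • coordC i,
      ContDiff.sum fun i _ => (ih (i :: l)).smul contDiff_const, hG l⟩

theorem dl_family {G : List (Fin d ⊕ Fin d) → Phase d → ℂ}
    (hG : ∀ l X, HasFDerivAt (G l) (∑ i, G (i :: l) X • coordC i) X)
    (l : List (Fin d ⊕ Fin d)) : dl l (G []) = G l := by
  induction l with
  | nil => rfl
  | cons j l ih =>
    rw [dl_cons, ih]
    funext X
    rw [pderiv, (hG l X).fderiv]
    simp only [_root_.sum_apply, _root_.smul_apply, coordC_single, smul_eq_mul, mul_ite, mul_one,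
      mul_zero, Finset.sum_ite_eq', Finset.mem_univ, if_true]

/-! ### Moderate weights. -/

/-- Positive functions of controlled growth relative to `e^{r(|x|^{1/s} + |ξ|^{1/σ})}`. -/
structure IsModerate (s σ : ℝ) (w : Phase d → ℝ) : Prop where
  pos : ∀ X, 0 < w X
  le : ∃ r C : ℝ, 0 < r ∧ 0 ≤ C ∧ ∀ X Y, w Y ≤ C * w X * Real.exp (r * gauge s σ (X - Y))

/-- Submultiplicativity for Y = X + (Y - X), with the upper exponential bound on the weight of the
difference. -/
theorem IsWeightP.isModerate {s σ : ℝ} {w : Phase d → ℝ} (hw : IsWeightP s σ w) :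
    IsModerate s σ w := by
  refine ⟨hw.weight.pos, ?_⟩
  obtain ⟨r, hr, C, hC⟩ := hw.bounds
  obtain ⟨C', hC'⟩ := hw.submultiplicative.submul
  refine ⟨r, |C'| * |C|, hr, by positivity, fun X Y => ?_⟩
  have h1 := hC' X (Y - X)
  rw [add_sub_cancel] at h1
  have h2 := (hC (X - Y)).2
  rw [← hw.submultiplicative.even, neg_sub] at h2
  have p1 := hw.weight.pos X
  have p2 := hw.weight.pos (Y - X)
  calc _ ≤ _ := h1
    _ ≤ |C'| * w X * w (Y - X) := by gcongr; exact le_abs_self _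
    _ ≤ |C'| * w X * (|C| * Real.exp (r * gauge s σ (X - Y))) := by
        gcongr
        exact h2.trans (by gcongr; exact le_abs_self _)
    _ = _ := by ring

theorem IsModerate.exists_le_exp {s σ : ℝ} {w : Phase d → ℝ} (hw : IsModerate s σ w) :
    ∃ r C : ℝ, 0 < r ∧ 0 ≤ C ∧ ∀ X, w X ≤ C * Real.exp (r * gauge s σ X) := by
  obtain ⟨r, C, hr, hC, h⟩ := hw.le
  have := hw.pos 0
  refine ⟨r, C * w 0, hr, by positivity, fun X => ?_⟩
  have := h 0 X
  rwa [zero_sub, gauge_neg] at this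

/-! ### Measurability -/

/-- A partial derivative is a pointwise limit of difference quotients, so joint measurability of the
family passes to it without any continuity in the parameter. -/
theorem stronglyMeasurable_DS {U : Phase d → 𝓢(Phase d, ℂ)}
    (hU : StronglyMeasurable fun p : Phase d × Phase d => U p.1 p.2) (i : Fin d ⊕ Fin d) :
    StronglyMeasurable fun p : Phase d × Phase d => DS i (U p.1) p.2 := by
  set e : Phase d := EuclideanSpace.single i (1 : ℝ)
  refine stronglyMeasurable_of_tendsto (f := fun (n : ℕ) (p : Phase d × Phase d) =>
    ((n : ℝ) + 1) • (U p.1 (p.2 + ((n : ℝ) + 1)⁻¹ • e) - U p.1 p.2)) Filter.atTop (fun n => ?_) ?_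
  · have h1 : Measurable fun p : Phase d × Phase d => (p.1, p.2 + ((n : ℝ) + 1)⁻¹ • e) :=
      measurable_fst.prodMk (measurable_snd.add_const _)
    exact ((hU.comp_measurable h1).sub hU).const_smul ((n : ℝ) + 1)
  · rw [tendsto_pi_nhds]
    intro p
    have h1 := ((U p.1).differentiableAt (x := p.2)).hasFDerivAt
    exact (h1.lim_real e).comp (Filter.tendsto_atTop_add_const_right _ 1 tendsto_natCast_atTop_atTop)

theorem stronglyMeasurable_dl {U : Phase d → 𝓢(Phase d, ℂ)}
    (hU : StronglyMeasurable fun p : Phase d × Phase d => U p.1 p.2) (l : List (Fin d ⊕ Fin d)) :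
    StronglyMeasurable fun p : Phase d × Phase d => dl l (U p.1) p.2 := by
  have : ∃ V : Phase d → 𝓢(Phase d, ℂ), (∀ Y, ⇑(V Y) = dl l (U Y)) ∧
      StronglyMeasurable fun p : Phase d × Phase d => V p.1 p.2 := by
    induction l with
    | nil => exact ⟨U, fun Y => rfl, hU⟩
    | cons i l ih =>
      obtain ⟨V, hV, hVm⟩ := ih
      exact ⟨fun Y => DS i (V Y), fun Y => by rw [coe_DS, hV]; rfl, stronglyMeasurable_DS hVm i⟩
  obtain ⟨V, hV, hVm⟩ := this
  simpa only [hV] using hVm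

theorem TS_eq_integral_ch (A : Matrix (Fin d) (Fin d) ℝ) (u : 𝓢(Phase d, ℂ)) (X : Phase d) :
    TS A u X = ∫ Ξ, ch ((2 * Real.pi) • Ξ) X * (symb A Ξ * 𝓕 u Ξ) := by
  rw [TS_apply, SchwartzMap.fourierInv_coe, Real.fourierInv_eq']
  congr 1
  funext Ξ
  rw [SchwartzMap.smulLeftCLM_apply_apply (symb_hasTemperateGrowth A), smul_eq_mul, smul_eq_mul,
    ch, inner_smul_right, real_inner_comm]
  congr 2
  push_cast
  ring

theorem stronglyMeasurable_TS {U : Phase d → 𝓢(Phase d, ℂ)}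
    (hU : StronglyMeasurable fun p : Phase d × Phase d => U p.1 p.2)
    (A : Matrix (Fin d) (Fin d) ℝ) :
    StronglyMeasurable fun p : Phase d × Phase d => TS A (U p.1) p.2 := by
  have hch : Continuous fun p : Phase d × Phase d => ch p.1 p.2 := by
    unfold ch; fun_prop
  have h1 : StronglyMeasurable fun p : Phase d × Phase d => 𝓕 (U p.1) p.2 := by
    simp only [SchwartzMap.fourier_coe, fourier_eq_integral_ch]
    refine StronglyMeasurable.integral_prod_right (f := fun (p : Phase d × Phase d) X =>
      ch (-(2 * Real.pi) • p.2) X * U p.1 X) ?_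
    refine StronglyMeasurable.mul ?_ ?_
    · refine Continuous.stronglyMeasurable (hch.comp (f := fun q : (Phase d × Phase d) × Phase d =>
        (-(2 * Real.pi) • q.1.2, q.2)) (by fun_prop))
    · exact hU.comp_measurable (measurable_fst.fst.prodMk measurable_snd)
  have hs : Continuous (symb A) := (symb_hasTemperateGrowth A).1.continuous
  simp only [TS_eq_integral_ch]
  generalize hF : (fun Y Ξ : Phase d => 𝓕 (U Y) Ξ) = F
  have hF' : ∀ Y Ξ : Phase d, 𝓕 (U Y) Ξ = F Y Ξ := fun Y Ξ => by rw [← hF]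
  simp only [hF'] at h1 ⊢
  refine StronglyMeasurable.integral_prod_right (f := fun (p : Phase d × Phase d) Ξ =>
      ch ((2 * Real.pi) • Ξ) p.2 * (symb A Ξ * F p.1 Ξ)) ?_
  refine StronglyMeasurable.mul ?_ (StronglyMeasurable.mul ?_ ?_)
  · exact Continuous.stronglyMeasurable (hch.comp (f := fun q : (Phase d × Phase d) × Phase d =>
        ((2 * Real.pi) • q.2, q.1.2)) (by fun_prop))
  · exact (hs.comp continuous_snd).stronglyMeasurable
  · exact h1.comp_measurable (measurable_fst.fst.prodMk measurable_snd)

/-! ### Integrals of translated families -/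

theorem integrable_exp_gauge_sub {s σ r : ℝ} (hs : 0 < s) (hσ : 0 < σ) (hr : 0 < r) (X : Phase d) :
    Integrable fun Y : Phase d => Real.exp (-r * gauge s σ (X - Y)) :=
  (integrable_exp_gauge hs hσ hr).comp_sub_left X

theorem gauge_le_two {s σ : ℝ} (hs : 0 < s) (hσ : 0 < σ) {X : Phase d} (hX : ‖X‖ ≤ 1) :
    gauge s σ X ≤ 2 := by
  have h1 : ‖xPart X‖ ≤ 1 := by
    refine le_trans ?_ hX
    rw [EuclideanSpace.norm_eq, EuclideanSpace.norm_eq, Fintype.sum_sum_type]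
    refine Real.sqrt_le_sqrt (le_add_of_nonneg_right (by positivity))
  have h2 : ‖xiPart X‖ ≤ 1 := by
    refine le_trans ?_ hX
    rw [EuclideanSpace.norm_eq, EuclideanSpace.norm_eq, Fintype.sum_sum_type]
    refine Real.sqrt_le_sqrt (le_add_of_nonneg_left (by positivity))
  have h3 := Real.rpow_le_one (norm_nonneg _) h1 (by positivity : 0 ≤ 1 / s)
  have h4 := Real.rpow_le_one (norm_nonneg _) h2 (by positivity : 0 ≤ 1 / σ)
  unfold gauge
  linarith

section Window

variable {s σ : ℝ} {w : Phase d → ℝ} {W : Phase d → 𝓢(Phase d, ℂ)}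

/-- Moderateness replaces the weight at the centre `Y` by the weight at `X`; the exponential cost is
paid by extra decay of the piece. -/
theorem window_bound (hw : IsModerate s σ w)
    (hW : ∀ h r, 0 < h → 0 < r → ∃ C, 0 ≤ C ∧ ∀ Y,
      Gam s σ h (C * w Y) (fun X => Real.exp (-r * gauge s σ X)) (W Y))
    {h r : ℝ} (hh : 0 < h) (hr : 0 < r) : ∃ C, 0 ≤ C ∧ ∀ l X Y, ‖dl l (W Y) (X - Y)‖ ≤
      C * (h ^ l.length * (fr σ (cnt true l) * fr s (cnt false l))) * w X *
        Real.exp (-r * gauge s σ (X - Y)) := by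
  obtain ⟨r₀, C₀, hr₀, hC₀, h0⟩ := hw.le
  obtain ⟨C, hC, H⟩ := hW h (r + r₀) hh (by positivity)
  refine ⟨C * C₀, by positivity, fun l X Y => (H Y l (X - Y)).trans ?_⟩
  have f1 := fr_nonneg σ (cnt true l)
  have f2 := fr_nonneg s (cnt false l)
  have e : Real.exp (-(r + r₀) * gauge s σ (X - Y)) =
      Real.exp (-r * gauge s σ (X - Y)) * Real.exp (-r₀ * gauge s σ (X - Y)) := by
    rw [← Real.exp_add]; ring_nf
  have e2 : Real.exp (r₀ * gauge s σ (X - Y)) * Real.exp (-r₀ * gauge s σ (X - Y)) = 1 := by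
    rw [← Real.exp_add]; ring_nf; simp
  calc _ ≤ C * (C₀ * w X * Real.exp (r₀ * gauge s σ (X - Y))) *
        (h ^ l.length * (fr σ (cnt true l) * fr s (cnt false l))) *
        Real.exp (-(r + r₀) * gauge s σ (X - Y)) := by gcongr; exact h0 X Y
    _ = C * C₀ * w X * (h ^ l.length * (fr σ (cnt true l) * fr s (cnt false l))) *
        Real.exp (-r * gauge s σ (X - Y)) *
        (Real.exp (r₀ * gauge s σ (X - Y)) * Real.exp (-r₀ * gauge s σ (X - Y))) := by
        rw [e]; ring
    _ = _ := by rw [e2]; ring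

theorem hasFDerivAt_window (hs : 0 < s) (hσ : 0 < σ) (hw : IsModerate s σ w)
    (hm : StronglyMeasurable fun p : Phase d × Phase d => W p.1 p.2)
    (hW : ∀ h r, 0 < h → 0 < r → ∃ C, 0 ≤ C ∧ ∀ Y,
      Gam s σ h (C * w Y) (fun X => Real.exp (-r * gauge s σ X)) (W Y))
    (l : List (Fin d ⊕ Fin d)) (X₀ : Phase d) :
    HasFDerivAt (fun X => ∫ Y, dl l (W Y) (X - Y))
      (∑ i, (∫ Y, dl (i :: l) (W Y) (X₀ - Y)) • coordC i) X₀ := by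
  have hmeas : ∀ (l : List (Fin d ⊕ Fin d)) (X : Phase d),
      StronglyMeasurable fun Y => dl l (W Y) (X - Y) := fun l X =>
    (stronglyMeasurable_dl hm l).comp_measurable (measurable_id.prodMk (measurable_id.const_sub X))
  have hint : ∀ (l : List (Fin d ⊕ Fin d)) (X : Phase d),
      Integrable fun Y => dl l (W Y) (X - Y) := by
    intro l X
    obtain ⟨C, hC, H⟩ := window_bound hw hW one_pos one_pos
    exact ((integrable_exp_gauge_sub hs hσ one_pos X).const_mul _).mono'
      (hmeas l X).aestronglyMeasurable (Filter.Eventually.of_forall fun Y => H l X Y)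
  have e : ∑ i, (∫ Y, dl (i :: l) (W Y) (X₀ - Y)) • coordC i =
      ∫ Y, ∑ i, dl (i :: l) (W Y) (X₀ - Y) • coordC i := by
    rw [integral_finsetSum _ fun i _ => (hint (i :: l) X₀).smul_const _]
    exact Finset.sum_congr rfl fun i _ =>
      (((ContinuousLinearMap.lsmul ℝ ℂ).flip
        (coordC i : Phase d →L[ℝ] ℂ)).integral_comp_comm (hint (i :: l) X₀)).symm
  rw [e]
  obtain ⟨r₀, C₀, hr₀, hC₀, h0⟩ := hw.le
  have hq := quasi_pos s σ
  -- With this rate, moving the base point within the unit ball leaves decay at rate exactly 1, by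
  -- the quasi-triangle inequality.
  set r := quasi s σ with hr
  obtain ⟨C, hC, H⟩ := window_bound hw hW one_pos hq
  set D : List (Fin d ⊕ Fin d) → ℝ := fun l =>
    C * (1 ^ l.length * (fr σ (cnt true l) * fr s (cnt false l))) with hD
  have hD0 : ∀ l, 0 ≤ D l := fun l => by
    have f1 := fr_nonneg σ (cnt true l)
    have f2 := fr_nonneg s (cnt false l)
    positivity
  have hwX := hw.pos X₀
  refine hasFDerivAt_integral_of_dominated_of_fderiv_le
    (F := fun X Y => dl l (W Y) (X - Y))
    (F' := fun X Y => ∑ i, dl (i :: l) (W Y) (X - Y) • coordC i)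
    (bound := fun Y => (∑ i, D (i :: l) * (C₀ * w X₀ * Real.exp (r₀ * 2)) * Real.exp (r * 2) *
      ‖(coordC i : Phase d →L[ℝ] ℂ)‖) * Real.exp (-1 * gauge s σ (X₀ - Y)))
    (Metric.closedBall_mem_nhds X₀ one_pos)
    (Filter.Eventually.of_forall fun X => (hmeas l X).aestronglyMeasurable) (hint l X₀)
    ?_ ?_ ((integrable_exp_gauge_sub hs hσ one_pos X₀).const_mul _) ?_
  · refine StronglyMeasurable.aestronglyMeasurable ?_
    exact Finset.stronglyMeasurable_fun_sum _ fun i _ => (hmeas (i :: l) X₀).smul_const _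
  · refine Filter.Eventually.of_forall fun Y X hX => ?_
    rw [Metric.mem_closedBall, dist_eq_norm] at hX
    rw [Finset.sum_mul]
    refine (norm_sum_le _ _).trans (Finset.sum_le_sum fun i _ => ?_)
    rw [norm_smul]
    have g1 : gauge s σ (X₀ - X) ≤ 2 := gauge_le_two hs hσ (by rwa [norm_sub_rev])
    have g2 := neg_gauge_add_le hs hσ hq.le (X₀ - Y) (X - X₀)
    rw [show X₀ - Y + (X - X₀) = X - Y by abel, div_self hq.ne'] at g2
    have g3 : gauge s σ (X - X₀) ≤ 2 := gauge_le_two hs hσ hX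
    have hDi := hD0 (i :: l)
    calc _ ≤ D (i :: l) * w X * Real.exp (-r * gauge s σ (X - Y)) *
          ‖(coordC i : Phase d →L[ℝ] ℂ)‖ := by gcongr; exact H (i :: l) X Y
      _ ≤ D (i :: l) * (C₀ * w X₀ * Real.exp (r₀ * 2)) *
          Real.exp (r * 2 + -1 * gauge s σ (X₀ - Y)) * ‖(coordC i : Phase d →L[ℝ] ℂ)‖ := by
          gcongr
          · exact (h0 X₀ X).trans (by gcongr)
          · refine g2.trans ?_
            have : r * gauge s σ (X - X₀) ≤ r * 2 := by gcongr
            linarith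
      _ = _ := by rw [Real.exp_add]; ring
  · refine Filter.Eventually.of_forall fun Y X _ => ?_
    exact ((hasFDerivAt_dl ((W Y).smooth _) l (X - Y)).comp X
      ((hasFDerivAt_id X).sub_const Y)).congr_fderiv (ContinuousLinearMap.comp_id _)

/-- Localized pieces of size `w Y`, placed at `Y` and superposed, form a symbol of weight `w`:
differentiation passes under the integral, and the remaining decay is integrable in `Y`. -/
theorem window_integral (hs : 0 < s) (hσ : 0 < σ) (hw : IsModerate s σ w)
    (hm : StronglyMeasurable fun p : Phase d × Phase d => W p.1 p.2)
    (hW : ∀ h r, 0 < h → 0 < r → ∃ C, 0 ≤ C ∧ ∀ Y,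
      Gam s σ h (C * w Y) (fun X => Real.exp (-r * gauge s σ X)) (W Y)) :
    IsGammaZero s σ w (fun X => ∫ Y, W Y (X - Y)) := by
  have hG := fun l X => hasFDerivAt_window hs hσ hw hm hW l X
  have e := dl_family (G := fun l X => ∫ Y, dl l (W Y) (X - Y)) hG
  simp only [dl_nil] at e
  refine (isGammaZero_iff hs.le hσ.le hw.pos).2 ⟨contDiff_of_family
    (G := fun l X => ∫ Y, dl l (W Y) (X - Y)) hG [], fun h hh => ?_⟩
  obtain ⟨C, hC, H⟩ := window_bound hw hW hh one_pos
  have hJ : 0 ≤ ∫ Y : Phase d, Real.exp (-1 * gauge s σ Y) :=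
    integral_nonneg fun Y => by positivity
  refine ⟨C * ∫ Y : Phase d, Real.exp (-1 * gauge s σ Y), by positivity, fun l X => ?_⟩
  rw [e]
  refine (norm_integral_le_of_norm_le ((integrable_exp_gauge_sub hs hσ one_pos X).const_mul _)
    (Filter.Eventually.of_forall fun Y => H l X Y)).trans (le_of_eq ?_)
  rw [integral_const_mul, integral_sub_left_eq_self (fun Y => Real.exp (-1 * gauge s σ Y))]
  ring

end Window

/-! ### Symbols as distributions: the Beurling case -/

theorem exists_Gam_imp_GS {s σ h : ℝ} (hs : 0 < s) (hσ : 0 < σ) (hh : 0 < h) :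
    ∃ r, 0 < r ∧ ∀ {f : Phase d → ℂ} {C : ℝ}, 0 ≤ C →
      Gam s σ h C (fun X => Real.exp (-r * gauge s σ X)) f → GS s σ h C f := by
  obtain ⟨r, hr, hle⟩ := exists_monoFac_le hs hσ hh
  refine ⟨r, hr, fun hC H => ?_⟩
  have := H.gs hs hσ hh.le hC hr
  rwa [max_eq_left hle] at this

/-- The parameter is chosen before the function, so that the conversion is uniform over a family of
pieces. -/
theorem exists_GS_imp_Gam (d : ℕ) {s σ h r : ℝ} (hs : 0 < s) (hσ : 0 < σ) (hh : 0 < h)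
    (hr : 0 < r) : ∃ h', 0 < h' ∧ ∀ {f : Phase d → ℂ} {C : ℝ}, 0 ≤ C → GS s σ h' C f →
      Gam s σ h (2 ^ (s + σ) * C) (fun X => Real.exp (-r * gauge s σ X)) f := by
  have hl := lam_pos d hs hσ hr
  have hc : (0 : ℝ) < 2 ^ (s + σ) := by positivity
  set k := min (h / 2 ^ (s + σ)) (1 / (lam d s σ r * 2 ^ (s + σ))) with hk
  have hk0 : 0 < k := by positivity
  refine ⟨k, hk0, fun {f C} hC HC => ?_⟩
  have h1 : lam d s σ r * k * 2 ^ (s + σ) ≤ 1 := by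
    have := min_le_right (h / 2 ^ (s + σ)) (1 / (lam d s σ r * 2 ^ (s + σ)))
    rw [← hk, le_div_iff₀ (by positivity)] at this
    linarith
  have h2 : 2 ^ (s + σ) * k ≤ h := by
    have := min_le_left (h / 2 ^ (s + σ)) (1 / (lam d s σ r * 2 ^ (s + σ)))
    rw [← hk, le_div_iff₀ (by positivity)] at this
    linarith
  exact (HC.gam hs hσ hk0.le hC hr h1).mono (by positivity) h2
    (fun X => by positivity) fun X => le_rfl

theorem sum_abs_cf_le (A : Matrix (Fin d) (Fin d) ℝ) (i : Fin d ⊕ Fin d) :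
    ∑ k, |cf A i k| ≤ ∑ i, ∑ k, |cf A i k| :=
  Finset.single_le_sum (f := fun i => ∑ k, |cf A i k|) (fun i _ => by positivity)
    (Finset.mem_univ i)

theorem ch_add (Z X Y : Phase d) : ch Z (X + Y) = ch Z X * ch Z Y := by
  rw [ch, ch, ch, ← Complex.exp_add, inner_add_left]
  congr 1
  push_cast
  ring

theorem ch_neg_left (Z X : Phase d) : ch (-Z) X = ch Z (-X) := by
  rw [ch, ch, inner_neg_left, inner_neg_right]

theorem TS_translate (A : Matrix (Fin d) (Fin d) ℝ) {u v : 𝓢(Phase d, ℂ)} {Y : Phase d}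
    (h : ∀ X, v X = u (X + Y)) (X : Phase d) : TS A v X = TS A u (X + Y) := by
  have h1 : ∀ Ξ, 𝓕 v Ξ = ch ((2 * Real.pi) • Ξ) Y * 𝓕 u Ξ := by
    intro Ξ
    rw [SchwartzMap.fourier_coe, SchwartzMap.fourier_coe, fourier_eq_integral_ch,
      fourier_eq_integral_ch, ← integral_const_mul,
      ← integral_add_right_eq_self (fun X => ch ((2 * Real.pi) • Ξ) Y *
        (ch (-(2 * Real.pi) • Ξ) X * u X)) Y]
    congr 1
    funext X
    rw [h, ch_add, neg_smul, ch_neg_left _ Y]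
    have : ch ((2 * Real.pi) • Ξ) Y * ch ((2 * Real.pi) • Ξ) (-Y) = 1 := by
      rw [← ch_add, add_neg_cancel]; simp [ch]
    linear_combination (-ch (-((2 * Real.pi) • Ξ)) X * u (X + Y)) * this
  rw [TS_eq_integral_ch, TS_eq_integral_ch]
  congr 1
  funext Ξ
  rw [h1, ch_add]
  ring

theorem integrable_gauge_conv {s σ : ℝ} (hs : 0 < s) (hσ : 0 < σ) :
    Integrable (fun p : Phase d × Phase d => Real.exp (-1 * gauge s σ p.2) *
      Real.exp (-1 * gauge s σ (p.1 - p.2))) (volume.prod volume) :=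
  (integrable_exp_gauge hs hσ one_pos).convolution_integrand (ContinuousLinearMap.mul ℝ ℝ)
    (integrable_exp_gauge hs hσ one_pos)

section Window

variable {s σ : ℝ} {w : Phase d → ℝ} {W : Phase d → 𝓢(Phase d, ℂ)}

theorem integrable_window (hs : 0 < s) (hσ : 0 < σ) (hw : IsModerate s σ w)
    (hm : StronglyMeasurable fun p : Phase d × Phase d => W p.1 p.2)
    (hW : ∀ h r, 0 < h → 0 < r → ∃ C, 0 ≤ C ∧ ∀ Y,
      Gam s σ h (C * w Y) (fun X => Real.exp (-r * gauge s σ X)) (W Y))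
    {p : 𝓢(Phase d, ℂ)} (hp : ⇑p ∈ SigmaSpace d s σ σ s) :
    Integrable (Function.uncurry fun Y X => W Y (X - Y) * p X) (volume.prod volume) := by
  obtain ⟨C, hC, H⟩ := window_bound hw hW one_pos one_pos
  obtain ⟨r₁, C₁, hr₁, hC₁, h1⟩ := hw.exists_le_exp
  obtain ⟨C₂, hC₂, H₂⟩ := ((mem_SigmaSpace_iff_Gam hs hσ).1 hp).2 1 (r₁ + 1) one_pos
    (by positivity)
  refine ((integrable_gauge_conv hs hσ).const_mul (C * C₁ * C₂)).mono' ?_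
    (Filter.Eventually.of_forall fun q => ?_)
  · refine StronglyMeasurable.aestronglyMeasurable (StronglyMeasurable.mul ?_ ?_)
    · have : Measurable fun q : Phase d × Phase d => (q.1, q.2 - q.1) :=
        measurable_fst.prodMk (measurable_snd.sub measurable_fst)
      exact hm.comp_measurable this
    · exact (p.continuous.comp continuous_snd).stronglyMeasurable
  · obtain ⟨Y, X⟩ := q
    have a1 := H [] X Y
    have a2 := H₂ [] X
    simp only [dl_nil, List.length_nil, pow_zero, cnt_nil, fr_zero, mul_one] at a1 a2
    rw [Function.uncurry_apply_pair, norm_mul]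
    have hwX := hw.pos X
    have e : Real.exp (r₁ * gauge s σ X) * Real.exp (-(r₁ + 1) * gauge s σ X) =
        Real.exp (-1 * gauge s σ X) := by rw [← Real.exp_add]; ring_nf
    calc _ ≤ (C * w X * Real.exp (-1 * gauge s σ (X - Y))) *
          (C₂ * Real.exp (-(r₁ + 1) * gauge s σ X)) := by gcongr
      _ ≤ (C * (C₁ * Real.exp (r₁ * gauge s σ X)) * Real.exp (-1 * gauge s σ (X - Y))) *
          (C₂ * Real.exp (-(r₁ + 1) * gauge s σ X)) := by gcongr; exact h1 X
      _ = C * C₁ * C₂ * ((Real.exp (r₁ * gauge s σ X) * Real.exp (-(r₁ + 1) * gauge s σ X)) *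
          Real.exp (-1 * gauge s σ (X - Y))) := by ring
      _ = _ := by rw [e, ← gauge_neg s σ (X - Y), neg_sub]

/-- Since φ has integral 1, f is the integral over Y of f φ(· - Y). The operator is applied to each
piece after translation to the origin, where its bounds are uniform up to the factor `w Y`; the
images are translated back and integrated. -/
theorem MemGammaZero.sigma_op (hs : 0 < s) (hσ : 0 < σ) (hsσ : 1 < s + σ) (hw : IsModerate s σ w)
    (hV : IsInvariant (SigmaSpace d s σ σ s)) (A : Matrix (Fin d) (Fin d) ℝ)
    {a : SigmaSpace d s σ σ s →ₗ[ℂ] ℂ} (ha : MemGammaZero s σ w a) :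
    MemGammaZero s σ w (a ∘ₗ hV.op A) := by
  obtain ⟨f, hf, haf⟩ := ha
  -- A window exists only in a nontrivial space. In the trivial one every pairing is zero, and the
  -- old symbol serves.
  by_cases hbot : SigmaSpace d s σ σ s = ⊥
  · have h0 : ∀ φ : SigmaSpace d s σ σ s, φ = 0 := fun φ =>
      Subtype.ext ((Submodule.eq_bot_iff _).1 hbot φ φ.2)
    refine ⟨f, hf, fun φ => ⟨(haf φ).1, ?_⟩⟩
    rw [h0 φ]
    simp
  obtain ⟨φ₀, hφ₀, hint⟩ := SigmaSpace_exists_integral_ne_zero hs hσ hbot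
  obtain ⟨φ, hφ, hφ1⟩ : ∃ φ ∈ SigmaSpace d s σ σ s, ∫ X, φ X = 1 := by
    refine ⟨(∫ X, φ₀ X)⁻¹ • φ₀, Submodule.smul_mem _ _ hφ₀, ?_⟩
    simp only [Pi.smul_apply, smul_eq_mul]
    rw [integral_const_mul, inv_mul_cancel₀ hint]
  obtain ⟨hfs, hfG⟩ := (isGammaZero_iff hs.le hσ.le hw.pos).1 hf
  obtain ⟨hφs, hφG⟩ := (mem_SigmaSpace_iff_Gam hs hσ).1 hφ
  obtain ⟨r₀, C₀, hr₀, hC₀, h0⟩ := hw.le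
  have hfY : ∀ h, 0 < h → ∃ C, 0 ≤ C ∧ ∀ Y, Gam s σ h (C * w Y)
      (fun X => Real.exp (r₀ * gauge s σ X)) (fun X => f (X + Y)) := by
    intro h hh
    obtain ⟨C, hC, H⟩ := hfG h hh
    refine ⟨C * C₀, by positivity, fun Y => (H.translate Y).mono hh.le le_rfl
      (fun X => (hw.pos _).le) fun X => ?_⟩
    have := h0 Y (X + Y)
    rw [show Y - (X + Y) = -X by abel, gauge_neg] at this
    calc _ ≤ C * (C₀ * w Y * Real.exp (r₀ * gauge s σ X)) := by gcongr
      _ = _ := by ring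
  have hUY : ∀ Y, ∃ u : 𝓢(Phase d, ℂ), ⇑u = (fun X => f (X + Y)) * φ := fun Y => by
    refine hV.exists_schwartz _ (SigmaSpace_mul (r₀ := r₀) hs hσ (contDiff_translate hfs Y)
      (fun h hh => ?_) hφ)
    obtain ⟨C, hC, H⟩ := hfY h hh
    exact ⟨_, mul_nonneg hC (hw.pos Y).le, H Y⟩
  choose U hU using hUY
  have hUG : ∀ h r, 0 < h → 0 < r → ∃ C, 0 ≤ C ∧ ∀ Y,
      Gam s σ h (C * w Y) (fun X => Real.exp (-r * gauge s σ X)) (U Y) := by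
    intro h r hh hr
    obtain ⟨C, hC, H⟩ := hfY (h / 2) (by positivity)
    obtain ⟨C', hC', H'⟩ := hφG (h / 2) (r + r₀) (by positivity) (by positivity)
    refine ⟨C * C', by positivity, fun Y => ?_⟩
    have hwY := hw.pos Y
    have h1 := Gam.mul hs.le hσ.le (by positivity) (contDiff_translate hfs Y) hφs
      (fun X => by positivity) (fun X => by positivity) (H Y) H'
    rw [hU]
    refine h1.mono (by positivity) (by linarith) (fun X => by positivity) fun X => ?_
    rw [← Real.exp_add, show r₀ * gauge s σ X + -(r + r₀) * gauge s σ X = -r * gauge s σ X by ring]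
    exact le_of_eq (by ring)
  have hWG : ∀ h r, 0 < h → 0 < r → ∃ C, 0 ≤ C ∧ ∀ Y,
      Gam s σ h (C * w Y) (fun X => Real.exp (-r * gauge s σ X)) (TS A (U Y)) := by
    intro h r hh hr
    obtain ⟨h', hh', H1⟩ := exists_GS_imp_Gam d hs hσ hh hr
    set a := ∑ i, ∑ k, |cf A i k| with ha
    have ha0 : 0 ≤ a := by positivity
    have hk := kap_pos (s := s) (σ := σ) ha0
    -- The input parameter is divided in advance by the loss of the operator. It may be smaller than
    -- 1, which s + σ > 1 permits.
    obtain ⟨K, hK, H2⟩ := exists_GS_TS d hs hσ hsσ.le (H := h' / kap s σ a) (by positivity)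
      (Or.inr hsσ) ha0
    obtain ⟨r', hr', H3⟩ := exists_Gam_imp_GS (d := d) hs hσ (h := h' / kap s σ a) (by positivity)
    obtain ⟨C, hC, H4⟩ := hUG _ r' (show 0 < h' / kap s σ a by positivity) hr'
    refine ⟨2 ^ (s + σ) * (K * C), by positivity, fun Y => ?_⟩
    have hwY := hw.pos Y
    have h5 := H2 A (sum_abs_cf_le A) (U Y) (C * w Y) (by positivity)
      (H3 (by positivity) (H4 Y))
    rw [mul_div_cancel₀ _ hk.ne'] at h5
    have h6 := H1 (by positivity) h5
    rwa [show 2 ^ (s + σ) * (K * (C * w Y)) = 2 ^ (s + σ) * (K * C) * w Y by ring] at h6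
  have hUm : StronglyMeasurable fun p : Phase d × Phase d => U p.1 p.2 := by
    have : (fun p : Phase d × Phase d => U p.1 p.2) = fun p => f (p.2 + p.1) * φ p.2 := by
      funext p; rw [hU]; rfl
    rw [this]
    exact ((hfs.continuous.comp (continuous_snd.add continuous_fst)).mul
      (hφs.continuous.comp continuous_snd)).stronglyMeasurable
  have hWm := stronglyMeasurable_TS hUm A
  refine ⟨_, window_integral hs hσ hw hWm hWG, fun ψ => ?_⟩
  set p := hV.toS ψ with hp
  set q := TS A p with hq
  have hpψ : ⇑p = ψ := hV.coe_toS ψ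
  have hpS : ⇑p ∈ SigmaSpace d s σ σ s := by rw [hpψ]; exact ψ.2
  have hqa := haf (hV.op A ψ)
  rw [hV.coe_op, ← hp, ← hq] at hqa
  have hF1 := integrable_window hs hσ hw hWm hWG hpS
  obtain ⟨uφ, huφ⟩ := hV.exists_schwartz φ hφ
  have hF2 : Integrable (Function.uncurry fun Y X => f X * q X * φ (X - Y))
      (volume.prod volume) := by
    have h2 : Integrable fun X : Phase d => φ (-X) := by
      rw [← huφ]; exact uφ.integrable.comp_neg
    refine (hqa.1.convolution_integrand (ContinuousLinearMap.mul ℝ ℂ) h2).congr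
      (Filter.Eventually.of_forall fun z => ?_)
    simp [Function.uncurry]
  -- For fixed `Y` the operator is moved to the translated test function, and it commutes with that
  -- translation.
  have hYX : ∀ Y, ∫ X, TS A (U Y) (X - Y) * p X = ∫ X, f X * q X * φ (X - Y) := by
    intro Y
    obtain ⟨v, hv⟩ := hV.exists_schwartz _ (SigmaSpace_translate hs hσ hpS Y)
    have hv' : ∀ X, v X = p (X + Y) := fun X => congrFun hv X
    rw [← integral_add_right_eq_self (fun X => TS A (U Y) (X - Y) * p X) Y,
      ← integral_add_right_eq_self (fun X => f X * q X * φ (X - Y)) Y]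
    simp only [add_sub_cancel_right, ← hv']
    rw [integral_TS_mul]
    congr 1
    funext X
    rw [TS_translate A hv', hU, Pi.mul_apply]
    ring
  have hg : ∀ X, (∫ Y, TS A (U Y) (X - Y)) * (ψ : Phase d → ℂ) X =
      ∫ Y, TS A (U Y) (X - Y) * p X := fun X => by rw [integral_mul_const, hpψ]
  simp only [hg]
  refine ⟨hF1.integral_prod_right, ?_⟩
  rw [← integral_integral_swap hF1]
  simp only [hYX]
  -- Integrating over `Y` first removes the window, whose translates and reflections also have
  -- integral 1.
  rw [integral_integral_swap hF2, LinearMap.comp_apply, hqa.2]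
  congr 1
  funext X
  rw [integral_const_mul, integral_sub_left_eq_self φ, hφ1, mul_one]

end Window

/-! ### The generator and its exponential series on symbols -/

/-- The generator `i⟨A D_ξ, D_x⟩`. -/
def gen (A : Matrix (Fin d) (Fin d) ℝ) (f : Phase d → ℂ) : Phase d → ℂ :=
  (-Complex.I) • ∑ p : Fin d × Fin d, (A p.1 p.2 : ℂ) • dl [Sum.inl p.1, Sum.inr p.2] f

/-- The sum of the absolute values of the coefficients of the generator. -/
def genNorm (A : Matrix (Fin d) (Fin d) ℝ) : ℝ := ∑ p : Fin d × Fin d, |A p.1 p.2|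

theorem genNorm_nonneg (A : Matrix (Fin d) (Fin d) ℝ) : 0 ≤ genNorm A := by
  unfold genNorm; positivity

theorem contDiff_sum_smul {κ : Type*} (t : Finset κ) {g : κ → Phase d → ℂ}
    (hg : ∀ k, ContDiff ℝ (⊤ : ℕ∞) (g k)) : ContDiff ℝ (⊤ : ℕ∞) (∑ k ∈ t, g k) := by
  have : (∑ k ∈ t, g k) = fun X => ∑ k ∈ t, g k X := by ext; simp
  rw [this]
  exact ContDiff.sum fun k _ => hg k

theorem contDiff_gen {f : Phase d → ℂ} (hf : ContDiff ℝ (⊤ : ℕ∞) f)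
    (A : Matrix (Fin d) (Fin d) ℝ) : ContDiff ℝ (⊤ : ℕ∞) (gen A f) :=
  contDiff_const.smul (contDiff_sum_smul _ fun _ => contDiff_const.smul (contDiff_dl hf _))

theorem contDiff_gen_iterate {f : Phase d → ℂ} (hf : ContDiff ℝ (⊤ : ℕ∞) f)
    (A : Matrix (Fin d) (Fin d) ℝ) (n : ℕ) : ContDiff ℝ (⊤ : ℕ∞) ((gen A)^[n] f) := by
  induction n with
  | zero => exact hf
  | succ n ih => rw [Function.iterate_succ_apply']; exact contDiff_gen ih A

theorem dl_gen {f : Phase d → ℂ} (hf : ContDiff ℝ (⊤ : ℕ∞) f) (A : Matrix (Fin d) (Fin d) ℝ)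
    (l : List (Fin d ⊕ Fin d)) : dl l (gen A f) = (-Complex.I) •
      ∑ p : Fin d × Fin d, (A p.1 p.2 : ℂ) • dl (l ++ [Sum.inl p.1, Sum.inr p.2]) f := by
  have h1 : ∀ p : Fin d × Fin d, ContDiff ℝ (⊤ : ℕ∞)
      ((A p.1 p.2 : ℂ) • dl [Sum.inl p.1, Sum.inr p.2] f) := fun p =>
    contDiff_const.smul (contDiff_dl hf _)
  rw [gen, dl_smul (contDiff_sum_smul _ h1), dl_sum _ h1]
  congr 1
  refine Finset.sum_congr rfl fun p _ => ?_
  rw [dl_smul (contDiff_dl hf _), dl_append]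

theorem norm_dl_gen_le {f : Phase d → ℂ} (hf : ContDiff ℝ (⊤ : ℕ∞) f)
    (A : Matrix (Fin d) (Fin d) ℝ) (l : List (Fin d ⊕ Fin d)) {X : Phase d} {B : ℝ}
    (H : ∀ j k, ‖dl (l ++ [Sum.inl j, Sum.inr k]) f X‖ ≤ B) :
    ‖dl l (gen A f) X‖ ≤ genNorm A * B := by
  rw [dl_gen hf, Pi.smul_apply, norm_smul, norm_neg, Complex.norm_I, one_mul, Finset.sum_apply,
    genNorm, Finset.sum_mul]
  refine (norm_sum_le _ _).trans (Finset.sum_le_sum fun p _ => ?_)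
  rw [Pi.smul_apply, norm_smul, Complex.norm_real, Real.norm_eq_abs]
  gcongr
  exact H _ _

/-- Each application of the generator adds one derivative of either kind. -/
theorem Gam.norm_gen_iterate {s σ h C : ℝ} {w : Phase d → ℝ} {f : Phase d → ℂ}
    (hf : ContDiff ℝ (⊤ : ℕ∞) f) (H : Gam s σ h C w f) (A : Matrix (Fin d) (Fin d) ℝ) (n : ℕ)
    (l : List (Fin d ⊕ Fin d)) (X : Phase d) : ‖dl l ((gen A)^[n] f) X‖ ≤ genNorm A ^ n *
      (C * (h ^ (l.length + 2 * n) * (fr σ (cnt true l + n) * fr s (cnt false l + n))) * w X) := by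
  induction n generalizing l with
  | zero => simpa using H l X
  | succ n ih =>
    rw [Function.iterate_succ_apply', pow_succ', mul_assoc]
    refine norm_dl_gen_le (contDiff_gen_iterate hf A n) A l fun j k => (ih _).trans (le_of_eq ?_)
    have e1 : cnt true (l ++ [Sum.inl j, Sum.inr k]) + n = cnt true l + (n + 1) := by
      simp [cnt_append, cnt_cons]; ring
    have e2 : cnt false (l ++ [Sum.inl j, Sum.inr k]) + n = cnt false l + (n + 1) := by
      simp [cnt_append, cnt_cons]; ring
    have e3 : (l ++ [Sum.inl j, Sum.inr k]).length + 2 * n = l.length + 2 * (n + 1) := by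
      simp; ring
    rw [e1, e2, e3]

/-- The factorial cost of n applications is n!^σ n!^s = n!, exactly what the exponential series
divides by. The remaining factor is geometric and small with `h`. -/
theorem Gam.norm_gen_iterate_le {s σ h C : ℝ} {w : Phase d → ℝ} {f : Phase d → ℂ} (hs : 0 < s)
    (hσ : 0 < σ) (hsσ : s + σ = 1) (hh : 0 ≤ h) (hC : ∀ X, 0 ≤ C * w X)
    (hf : ContDiff ℝ (⊤ : ℕ∞) f) (H : Gam s σ h C w f) (A : Matrix (Fin d) (Fin d) ℝ) (n : ℕ)
    (l : List (Fin d ⊕ Fin d)) (X : Phase d) : ‖dl l ((gen A)^[n] f) X‖ ≤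
      C * ((2 * h) ^ l.length * (fr σ (cnt true l) * fr s (cnt false l))) * w X *
        ((genNorm A * (2 * h) ^ 2) ^ n * n.factorial) := by
  refine (H.norm_gen_iterate hf A n l X).trans ?_
  have g := genNorm_nonneg A
  have h1 := fr_add_le hσ.le (cnt true l) n
  have h2 := fr_add_le hs.le (cnt false l) n
  have c := cnt_true_add_cnt_false l
  have o1 : (1 : ℝ) ≤ 2 ^ s := Real.one_le_rpow (by norm_num) hs.le
  have o2 : (1 : ℝ) ≤ 2 ^ σ := Real.one_le_rpow (by norm_num) hσ.le
  have h3 : ((2 : ℝ) ^ σ) ^ (cnt true l + n) ≤ ((2 : ℝ) ^ σ) ^ (l.length + 2 * n) :=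
    pow_le_pow_right₀ o2 (by omega)
  have h4 : ((2 : ℝ) ^ s) ^ (cnt false l + n) ≤ ((2 : ℝ) ^ s) ^ (l.length + 2 * n) :=
    pow_le_pow_right₀ o1 (by omega)
  have f1 := fr_nonneg σ (cnt true l)
  have f2 := fr_nonneg s (cnt false l)
  have f3 := fr_nonneg σ n
  have f4 := fr_nonneg s n
  have f5 := fr_nonneg s (cnt false l + n)
  have hn : (0 : ℝ) < (n.factorial : ℝ) := by exact_mod_cast n.factorial_pos
  have e1 : fr σ n * fr s n = n.factorial := by
    rw [← fr_add_exp, add_comm, hsσ, fr_one]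
  have e2 : ((2 : ℝ) ^ σ) ^ (l.length + 2 * n) * ((2 : ℝ) ^ s) ^ (l.length + 2 * n) =
      2 ^ (l.length + 2 * n) := by
    rw [← mul_pow, ← Real.rpow_add (by norm_num), add_comm σ s, hsσ, Real.rpow_one]
  have hCX := hC X
  calc _ = genNorm A ^ n * (h ^ (l.length + 2 * n) *
        (fr σ (cnt true l + n) * fr s (cnt false l + n))) * (C * w X) := by ring
    _ ≤ genNorm A ^ n * (h ^ (l.length + 2 * n) *
        ((((2 : ℝ) ^ σ) ^ (l.length + 2 * n) * (fr σ (cnt true l) * fr σ n)) *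
        (((2 : ℝ) ^ s) ^ (l.length + 2 * n) * (fr s (cnt false l) * fr s n)))) * (C * w X) := by
        have h1' := h1.trans (show _ ≤ ((2 : ℝ) ^ σ) ^ (l.length + 2 * n) *
          (fr σ (cnt true l) * fr σ n) by gcongr)
        have h2' := h2.trans (show _ ≤ ((2 : ℝ) ^ s) ^ (l.length + 2 * n) *
          (fr s (cnt false l) * fr s n) by gcongr)
        gcongr
    _ = genNorm A ^ n * (h ^ (l.length + 2 * n) *
        ((((2 : ℝ) ^ σ) ^ (l.length + 2 * n) * ((2 : ℝ) ^ s) ^ (l.length + 2 * n)) *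
        (fr σ (cnt true l) * fr s (cnt false l)) * (fr σ n * fr s n))) * (C * w X) := by ring
    _ = _ := by
        rw [e1, e2, mul_pow, mul_pow, ← pow_mul, pow_add, pow_add, mul_pow]
        ring

theorem exists_small {a h : ℝ} (ha : 0 ≤ a) (hh : 0 < h) :
    ∃ k, 0 < k ∧ 2 * k ≤ h ∧ a * (2 * k) ^ 2 ≤ 1 / 2 := by
  refine ⟨min (h / 2) (1 / (4 * (a + 1))), by positivity, ?_, ?_⟩
  · linarith [min_le_left (h / 2) (1 / (4 * (a + 1)))]
  · have h1 := min_le_right (h / 2) (1 / (4 * (a + 1)))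
    set k := min (h / 2) (1 / (4 * (a + 1)))
    have hk : 0 < k := by positivity
    rw [le_div_iff₀ (by positivity)] at h1
    have h2 : k ≤ 1 / 4 := by nlinarith
    nlinarith

/-- The terms of the exponential series of the generator. -/
def expTerm (A : Matrix (Fin d) (Fin d) ℝ) (f : Phase d → ℂ) (l : List (Fin d ⊕ Fin d)) (n : ℕ)
    (X : Phase d) : ℂ := (n.factorial : ℂ)⁻¹ * dl l ((gen A)^[n] f) X

theorem norm_expTerm_le {s σ h C : ℝ} {w : Phase d → ℝ} {f : Phase d → ℂ} (hs : 0 < s)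
    (hσ : 0 < σ) (hsσ : s + σ = 1) (hh : 0 ≤ h) (hC : ∀ X, 0 ≤ C * w X)
    (hf : ContDiff ℝ (⊤ : ℕ∞) f) (H : Gam s σ h C w f) {A : Matrix (Fin d) (Fin d) ℝ}
    (hA : genNorm A * (2 * h) ^ 2 ≤ 1 / 2) (n : ℕ)
    (l : List (Fin d ⊕ Fin d)) (X : Phase d) : ‖expTerm A f l n X‖ ≤
      C * ((2 * h) ^ l.length * (fr σ (cnt true l) * fr s (cnt false l))) * w X * (1 / 2) ^ n := by
  have h1 := H.norm_gen_iterate_le hs hσ hsσ hh hC hf A n l X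
  have hn : (0 : ℝ) < (n.factorial : ℝ) := by exact_mod_cast n.factorial_pos
  have g := genNorm_nonneg A
  rw [expTerm, norm_mul, norm_inv, Complex.norm_natCast]
  have f1 := fr_nonneg σ (cnt true l)
  have f2 := fr_nonneg s (cnt false l)
  have hCX := hC X
  calc _ ≤ (n.factorial : ℝ)⁻¹ *
        (C * ((2 * h) ^ l.length * (fr σ (cnt true l) * fr s (cnt false l))) * w X *
        ((genNorm A * (2 * h) ^ 2) ^ n * n.factorial)) := by gcongr
    _ = (C * w X) * ((2 * h) ^ l.length * (fr σ (cnt true l) * fr s (cnt false l))) *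
        (genNorm A * (2 * h) ^ 2) ^ n * ((n.factorial : ℝ)⁻¹ * n.factorial) := by ring
    _ ≤ (C * w X) * ((2 * h) ^ l.length * (fr σ (cnt true l) * fr s (cnt false l))) *
        (1 / 2) ^ n * 1 := by
        rw [inv_mul_cancel₀ hn.ne']
        gcongr
    _ = _ := by ring

theorem summable_half (c : ℝ) : Summable fun n : ℕ => c * (1 / 2 : ℝ) ^ n :=
  (summable_geometric_of_lt_one (by norm_num) (by norm_num)).mul_left c

/-- The exponential series of the generator. -/
def expGen (A : Matrix (Fin d) (Fin d) ℝ) (f : Phase d → ℂ) (l : List (Fin d ⊕ Fin d))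
    (X : Phase d) : ℂ := ∑' n, expTerm A f l n X

theorem hasFDerivAt_expGen {s σ h C : ℝ} {w : Phase d → ℝ} {f : Phase d → ℂ} (hs : 0 < s)
    (hσ : 0 < σ) (hsσ : s + σ = 1) (hh : 0 ≤ h) (hC : 0 ≤ C) (hw : IsModerate s σ w)
    (hf : ContDiff ℝ (⊤ : ℕ∞) f) (H : Gam s σ h C w f) {A : Matrix (Fin d) (Fin d) ℝ}
    (hA : genNorm A * (2 * h) ^ 2 ≤ 1 / 2) (l : List (Fin d ⊕ Fin d)) (X₀ : Phase d) :
    HasFDerivAt (expGen A f l) (∑ i, expGen A f (i :: l) X₀ • coordC i) X₀ := by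
  obtain ⟨r₀, C₀, hr₀, hC₀, h0⟩ := hw.le
  have hCw : ∀ X, 0 ≤ C * w X := fun X => mul_nonneg hC (hw.pos X).le
  have hb := norm_expTerm_le hs hσ hsσ hh hCw hf H hA
  have hsum : ∀ l X, Summable fun n => expTerm A f l n X := fun l X =>
    Summable.of_norm_bounded (summable_half _) fun n => hb n l X
  set D : List (Fin d ⊕ Fin d) → ℝ := fun l =>
    C * ((2 * h) ^ l.length * (fr σ (cnt true l) * fr s (cnt false l))) with hD
  have hD0 : ∀ l, 0 ≤ D l := fun l => by
    have f1 := fr_nonneg σ (cnt true l)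
    have f2 := fr_nonneg s (cnt false l)
    positivity
  have e : ∑ i, expGen A f (i :: l) X₀ • coordC i =
      ∑' n, ∑ i, expTerm A f (i :: l) n X₀ • (coordC i : Phase d →L[ℝ] ℂ) := by
    rw [Summable.tsum_finsetSum fun i _ => (hsum (i :: l) X₀).smul_const _]
    exact Finset.sum_congr rfl fun i _ =>
      ((ContinuousLinearMap.lsmul ℝ ℂ).flip (coordC i : Phase d →L[ℝ] ℂ)).map_tsum
        (hsum (i :: l) X₀)
  rw [e]
  refine hasFDerivAt_tsum_of_isPreconnected (s := Metric.ball X₀ 1) (x₀ := X₀)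
    (u := fun n => (∑ i, D (i :: l) * (C₀ * w X₀ * Real.exp (r₀ * 2)) *
      ‖(coordC i : Phase d →L[ℝ] ℂ)‖) * (1 / 2) ^ n)
    (f := fun n => expTerm A f l n)
    (f' := fun n X => ∑ i, expTerm A f (i :: l) n X • (coordC i : Phase d →L[ℝ] ℂ))
    (summable_half _) Metric.isOpen_ball (convex_ball X₀ 1).isPreconnected (fun n X _ => ?_)
    (fun n X hX => ?_) (Metric.mem_ball_self one_pos) (hsum l X₀) (Metric.mem_ball_self one_pos)
  · have h1 := (hasFDerivAt_dl (contDiff_gen_iterate hf A n) l X).const_mul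
      ((n.factorial : ℂ)⁻¹)
    refine h1.congr_fderiv ?_
    rw [Finset.smul_sum]
    exact Finset.sum_congr rfl fun i _ => by rw [smul_smul]; rfl
  · rw [Metric.mem_ball, dist_eq_norm] at hX
    rw [Finset.sum_mul]
    refine (norm_sum_le _ _).trans (Finset.sum_le_sum fun i _ => ?_)
    rw [norm_smul]
    have g1 : gauge s σ (X₀ - X) ≤ 2 := gauge_le_two hs hσ (by rw [norm_sub_rev]; exact hX.le)
    have hDi := hD0 (i :: l)
    have hwX := hw.pos X₀
    calc _ ≤ D (i :: l) * w X * (1 / 2) ^ n * ‖(coordC i : Phase d →L[ℝ] ℂ)‖ := by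
          gcongr; exact hb n (i :: l) X
      _ ≤ D (i :: l) * (C₀ * w X₀ * Real.exp (r₀ * 2)) * (1 / 2) ^ n *
          ‖(coordC i : Phase d →L[ℝ] ℂ)‖ := by
          gcongr
          exact (h0 X₀ X).trans (by gcongr)
      _ = _ := by ring

/-- The series does not depend on the parameter used to estimate it. One parameter gives smoothness
and the termwise derivatives; afterwards every `h` gets its own smaller parameter for the bounds. -/
theorem IsGammaZero.expGen {s σ : ℝ} {w : Phase d → ℝ} {f : Phase d → ℂ} (hs : 0 < s)
    (hσ : 0 < σ) (hsσ : s + σ = 1) (hw : IsModerate s σ w) (hf : IsGammaZero s σ w f)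
    (A : Matrix (Fin d) (Fin d) ℝ) : IsGammaZero s σ w (expGen A f []) := by
  obtain ⟨hfs, hfG⟩ := (isGammaZero_iff hs.le hσ.le hw.pos).1 hf
  have key : ∀ h, 0 < h → ∃ k C, 0 < k ∧ 2 * k ≤ h ∧ genNorm A * (2 * k) ^ 2 ≤ 1 / 2 ∧ 0 ≤ C ∧
      Gam s σ k C w f := by
    intro h hh
    obtain ⟨k, hk, hkh, hkA⟩ := exists_small (genNorm_nonneg A) hh
    obtain ⟨C, hC, H⟩ := hfG k hk
    exact ⟨k, C, hk, hkh, hkA, hC, H⟩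
  obtain ⟨k, C, hk, -, hkA, hC, H⟩ := key 1 one_pos
  have hG := hasFDerivAt_expGen hs hσ hsσ hk.le hC hw hfs H hkA
  refine (isGammaZero_iff hs.le hσ.le hw.pos).2 ⟨contDiff_of_family hG [], fun h hh => ?_⟩
  obtain ⟨k, C, hk, hkh, hkA, hC, H⟩ := key h hh
  refine ⟨C * 2, by positivity, Gam.mono (h := 2 * k) (C := C * 2) (w := w) (fun l X => ?_)
    (by positivity) hkh (fun X => (hw.pos X).le) fun X => le_rfl⟩
  rw [dl_family hG]
  have hb := fun n => norm_expTerm_le hs hσ hsσ hk.le (fun X => mul_nonneg hC (hw.pos X).le)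
    hfs H hkA n l X
  refine (tsum_of_norm_bounded ((hasSum_geometric_of_lt_one (by norm_num : (0 : ℝ) ≤ 1 / 2)
    (by norm_num)).mul_left _) hb).trans (le_of_eq ?_)
  norm_num
  ring

/-! ### Derivatives and symbol estimates -/

theorem fr_shift_le {s σ : ℝ} (hs : 0 ≤ s) (hσ : 0 ≤ σ) {a b p q N : ℕ} (h1 : a + p ≤ N)
    (h2 : b + q ≤ N) : fr s (a + p) * fr σ (b + q) ≤
      ((2 : ℝ) ^ (s + σ)) ^ N * (fr s a * fr σ b) * (fr s p * fr σ q) := by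
  have o1 : (1 : ℝ) ≤ 2 ^ s := Real.one_le_rpow (by norm_num) hs
  have o2 : (1 : ℝ) ≤ 2 ^ σ := Real.one_le_rpow (by norm_num) hσ
  have f1 := fr_nonneg s a
  have f2 := fr_nonneg s p
  have f3 := fr_nonneg σ b
  have f4 := fr_nonneg σ q
  have f5 := fr_nonneg σ (b + q)
  have e1 := (fr_add_le hs a p).trans (show _ ≤ ((2 : ℝ) ^ s) ^ N * (fr s a * fr s p) by
    gcongr)
  have e2 := (fr_add_le hσ b q).trans (show _ ≤ ((2 : ℝ) ^ σ) ^ N * (fr σ b * fr σ q) by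
    gcongr)
  calc _ ≤ (((2 : ℝ) ^ s) ^ N * (fr s a * fr s p)) * (((2 : ℝ) ^ σ) ^ N * (fr σ b * fr σ q)) := by
        gcongr
    _ = _ := by rw [Real.rpow_add (by norm_num), mul_pow]; ring

theorem GS.dl {s σ h C : ℝ} {f : Phase d → ℂ} (hs : 0 ≤ s) (hσ : 0 ≤ σ) (hh : 0 ≤ h) (hC : 0 ≤ C)
    (H : GS s σ h C f) (l : List (Fin d ⊕ Fin d)) : GS s σ (2 ^ (s + σ) * h)
      (C * ((2 ^ (s + σ) * h) ^ l.length * (fr σ (cnt true l) * fr s (cnt false l)))) (dl l f) := by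
  intro m l' X
  have h1 := H m (l' ++ l) X
  rw [dl_append, cnt_append, cnt_append, List.length_append, ← add_assoc, ← add_assoc,
    ← add_assoc] at h1
  have c1 := cnt_true_add_cnt_false m
  have c2 := cnt_true_add_cnt_false l
  have c3 := cnt_true_add_cnt_false l'
  have h2 := fr_shift_le hs hσ (a := cnt true m + cnt false l') (b := cnt false m + cnt true l')
    (p := cnt false l) (q := cnt true l) (N := m.length + l'.length + l.length) (by omega)
    (by omega)
  calc _ ≤ _ := h1
    _ ≤ C * (h ^ (m.length + l'.length + l.length) *
        (((2 : ℝ) ^ (s + σ)) ^ (m.length + l'.length + l.length) *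
        (fr s (cnt true m + cnt false l') * fr σ (cnt false m + cnt true l')) *
        (fr s (cnt false l) * fr σ (cnt true l)))) := by gcongr
    _ = _ := by rw [mul_pow, mul_pow, pow_add _ (m.length + l'.length), pow_add _ (m.length + l'.length)]; ring

theorem Gam.dl {s σ h C : ℝ} {w : Phase d → ℝ} {f : Phase d → ℂ} (hs : 0 ≤ s) (hσ : 0 ≤ σ)
    (hh : 0 ≤ h) (hC : ∀ X, 0 ≤ C * w X) (H : Gam s σ h C w f) (l : List (Fin d ⊕ Fin d)) :
    Gam s σ (2 ^ (s + σ) * h)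
      (C * ((2 ^ (s + σ) * h) ^ l.length * (fr σ (cnt true l) * fr s (cnt false l)))) w
      (dl l f) := by
  intro l' X
  have h1 := H (l' ++ l) X
  rw [dl_append, cnt_append, cnt_append, List.length_append] at h1
  have c2 := cnt_true_add_cnt_false l
  have c3 := cnt_true_add_cnt_false l'
  have h2 := fr_shift_le hs hσ (a := cnt false l') (b := cnt true l')
    (p := cnt false l) (q := cnt true l) (N := l'.length + l.length) (by omega) (by omega)
  have hCX := hC X
  calc _ ≤ _ := h1
    _ = (C * w X) * (h ^ (l'.length + l.length) * (fr s (cnt false l' + cnt false l) *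
        fr σ (cnt true l' + cnt true l))) := by ring
    _ ≤ (C * w X) * (h ^ (l'.length + l.length) *
        (((2 : ℝ) ^ (s + σ)) ^ (l'.length + l.length) *
        (fr s (cnt false l') * fr σ (cnt true l')) *
        (fr s (cnt false l) * fr σ (cnt true l)))) := by gcongr
    _ = _ := by rw [mul_pow, mul_pow, pow_add, pow_add]; ring

theorem SSpace_dl {s σ : ℝ} (hs : 0 < s) (hσ : 0 < σ) {f : Phase d → ℂ}
    (hf : f ∈ SSpace d s σ σ s) (l : List (Fin d ⊕ Fin d)) : dl l f ∈ SSpace d s σ σ s := by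
  obtain ⟨h1, h, hh, C, hC, H⟩ := (mem_SSpace_iff hs hσ).1 hf
  have f1 := fr_nonneg σ (cnt true l)
  have f2 := fr_nonneg s (cnt false l)
  exact (mem_SSpace_iff hs hσ).2 ⟨contDiff_dl h1 l, _, by positivity, _, by positivity,
    H.dl hs.le hσ.le hh.le hC l⟩

/-! ### Integration by parts -/

theorem integral_dl_mul {f ψ : Phase d → ℂ} (hf : ContDiff ℝ (⊤ : ℕ∞) f)
    (hψ : ContDiff ℝ (⊤ : ℕ∞) ψ) (hint : ∀ l l', Integrable fun X => dl l f X * dl l' ψ X)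
    (l : List (Fin d ⊕ Fin d)) :
    ∫ X, dl l f X * ψ X = (-1) ^ l.length * ∫ X, f X * dl l ψ X := by
  induction l generalizing ψ with
  | nil => simp
  | cons i l ih =>
    have h1 := integral_mul_fderiv_eq_neg_fderiv_mul_of_integrable
      (μ := (volume : Measure (Phase d))) (f := dl l f) (g := ψ)
      (v := EuclideanSpace.single i (1 : ℝ)) (hint (i :: l) []) (hint l [i]) (hint l [])
      (fun X _ => (contDiff_dl hf l).differentiable (by simp) X)
      (fun X _ => hψ.differentiable (by simp) X)
    have h2 := ih (ψ := pderiv i ψ) (contDiff_pderiv hψ i) fun l₁ l₂ => by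
      have := hint l₁ (l₂ ++ [i])
      rw [dl_append] at this
      exact this
    have h3 : ∫ X, dl (i :: l) f X * ψ X = -∫ X, dl l f X * pderiv i ψ X :=
      neg_eq_iff_eq_neg.1 h1.symm
    have h4 : dl l (pderiv i ψ) = dl (i :: l) ψ := by
      have : dl l (pderiv i ψ) = dl (l ++ [i]) ψ := by rw [dl_append]; rfl
      rw [this]
      exact dl_perm hψ (List.perm_append_singleton i l)
    rw [h3, h2, h4, List.length_cons, pow_succ]
    ring

/-- The generator has order two, so the signs from the two integrations by parts cancel. -/
theorem integral_gen_mul {f ψ : Phase d → ℂ} (hf : ContDiff ℝ (⊤ : ℕ∞) f)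
    (hψ : ContDiff ℝ (⊤ : ℕ∞) ψ) (hint : ∀ l l', Integrable fun X => dl l f X * dl l' ψ X)
    (A : Matrix (Fin d) (Fin d) ℝ) :
    ∫ X, gen A f X * ψ X = ∫ X, f X * gen A ψ X := by
  have e1 : ∀ X, gen A f X * ψ X = ∑ p : Fin d × Fin d, (-Complex.I * (A p.1 p.2 : ℂ)) *
      (dl [Sum.inl p.1, Sum.inr p.2] f X * ψ X) := fun X => by
    simp only [gen, Pi.smul_apply, Finset.sum_apply, smul_eq_mul, Finset.mul_sum, Finset.sum_mul]
    exact Finset.sum_congr rfl fun p _ => by ring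
  have e2 : ∀ X, f X * gen A ψ X = ∑ p : Fin d × Fin d, (-Complex.I * (A p.1 p.2 : ℂ)) *
      (f X * dl [Sum.inl p.1, Sum.inr p.2] ψ X) := fun X => by
    simp only [gen, Pi.smul_apply, Finset.sum_apply, smul_eq_mul, Finset.mul_sum]
    exact Finset.sum_congr rfl fun p _ => by ring
  have i1 : ∀ p ∈ (Finset.univ : Finset (Fin d × Fin d)), Integrable fun X =>
      (-Complex.I * (A p.1 p.2 : ℂ)) * (dl [Sum.inl p.1, Sum.inr p.2] f X * ψ X) := fun p _ =>
    (hint _ []).const_mul _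
  have i2 : ∀ p ∈ (Finset.univ : Finset (Fin d × Fin d)), Integrable fun X =>
      (-Complex.I * (A p.1 p.2 : ℂ)) * (f X * dl [Sum.inl p.1, Sum.inr p.2] ψ X) := fun p _ =>
    (hint [] _).const_mul _
  rw [integral_congr_ae (Filter.Eventually.of_forall e1),
    integral_congr_ae (Filter.Eventually.of_forall e2), integral_finsetSum _ i1,
    integral_finsetSum _ i2]
  refine Finset.sum_congr rfl fun p _ => ?_
  rw [integral_const_mul, integral_const_mul, integral_dl_mul hf hψ hint]
  simp

theorem integrable_mul_of_le {s σ r ε C C' : ℝ} (hs : 0 < s) (hσ : 0 < σ) (hr : ε < r)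
    {F P : Phase d → ℂ} (hF : Continuous F) (hP : Continuous P)
    (h1 : ∀ X, ‖F X‖ ≤ C * Real.exp (ε * gauge s σ X))
    (h2 : ∀ X, ‖P X‖ ≤ C' * Real.exp (-r * gauge s σ X)) :
    Integrable fun X => F X * P X := by
  refine ((integrable_exp_gauge hs hσ (sub_pos.2 hr)).const_mul (C * C')).mono'
    (hF.mul hP).aestronglyMeasurable (Filter.Eventually.of_forall fun X => ?_)
  rw [norm_mul]
  calc _ ≤ (C * Real.exp (ε * gauge s σ X)) * (C' * Real.exp (-r * gauge s σ X)) :=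
        mul_le_mul (h1 X) (h2 X) (norm_nonneg _) ((norm_nonneg _).trans (h1 X))
    _ = C * C' * (Real.exp (ε * gauge s σ X) * Real.exp (-r * gauge s σ X)) := by ring
    _ = _ := by rw [← Real.exp_add]; ring_nf

/-! ### The generator on Schwartz functions -/

/-- The generator on Schwartz functions. -/
def genS (A : Matrix (Fin d) (Fin d) ℝ) (u : 𝓢(Phase d, ℂ)) : 𝓢(Phase d, ℂ) :=
  (-Complex.I) • ∑ p : Fin d × Fin d, (A p.1 p.2 : ℂ) • DS (Sum.inl p.1) (DS (Sum.inr p.2) u)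

theorem coe_genS (A : Matrix (Fin d) (Fin d) ℝ) (u : 𝓢(Phase d, ℂ)) :
    ⇑(genS A u) = gen A u := by
  funext X
  simp only [genS, gen, _root_.smul_apply, _root_.sum_apply, Pi.smul_apply, Finset.sum_apply]
  rfl

theorem TS_genS (A B : Matrix (Fin d) (Fin d) ℝ) (u : 𝓢(Phase d, ℂ)) :
    TS B (genS A u) = genS A (TS B u) := by
  simp only [genS, map_smul, map_sum, DS_TS]

theorem fourier_DS (i : Fin d ⊕ Fin d) (u : 𝓢(Phase d, ℂ)) (Ξ : Phase d) :
    𝓕 (DS i u) Ξ = 2 * Real.pi * Complex.I * Ξ i * 𝓕 u Ξ := by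
  have h' : (fun X : Phase d => inner ℝ X
    (EuclideanSpace.single i (1 : ℝ) : Phase d)).HasTemperateGrowth := by fun_prop
  rw [DS, SchwartzMap.fourier_lineDerivOp_eq]
  have h : inner ℝ Ξ (EuclideanSpace.single i (1 : ℝ) : Phase d) = Ξ i := by
    rw [EuclideanSpace.inner_single_right]; simp
  simp only [_root_.smul_apply, SchwartzMap.smulLeftCLM_apply_apply h', h]
  simp
  ring

theorem fourier_genS (A : Matrix (Fin d) (Fin d) ℝ) (u : 𝓢(Phase d, ℂ)) (Ξ : Phase d) :
    𝓕 (genS A u) Ξ = Complex.I * (phase A Ξ : ℂ) * 𝓕 u Ξ := by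
  have e : 𝓕 (genS A u) = (-Complex.I) • ∑ p : Fin d × Fin d, (A p.1 p.2 : ℂ) •
      𝓕 (DS (Sum.inl p.1) (DS (Sum.inr p.2) u)) := by
    have := fun v : 𝓢(Phase d, ℂ) => FourierTransform.fourierCLM_apply (R := ℂ) v
    simp only [← this, genS, map_smul, map_sum]
  rw [e]
  simp only [_root_.smul_apply, _root_.sum_apply, fourier_DS, smul_eq_mul, phase, dotProduct,
    Matrix.mulVec]
  rw [Fintype.sum_prod_type, Finset.mul_sum, Finset.mul_sum]
  push_cast
  rw [Finset.mul_sum, Finset.sum_mul]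
  refine Finset.sum_congr rfl fun j _ => ?_
  rw [Finset.mul_sum, Finset.sum_mul, Finset.mul_sum, Finset.mul_sum, Finset.sum_mul]
  refine Finset.sum_congr rfl fun k _ => ?_
  linear_combination (-(Complex.I) * 4 * Real.pi ^ 2 * A j k * Ξ (Sum.inl j) * Ξ (Sum.inr k) *
    𝓕 u Ξ) * Complex.I_mul_I

theorem phase_smul (t : ℝ) (A : Matrix (Fin d) (Fin d) ℝ) (Ξ : Phase d) :
    phase (t • A) Ξ = t * phase A Ξ := by
  simp only [phase, Matrix.smul_mulVec, smul_dotProduct, smul_eq_mul]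
  ring

/-- The derivative of the symbol in `t` brings down the Fourier symbol of the generator. As the
symbol has modulus one, the modulus of the transform of `genS A u` dominates for all `t`. -/
theorem hasDerivAt_TS (A : Matrix (Fin d) (Fin d) ℝ) (u : 𝓢(Phase d, ℂ)) (X : Phase d) (t : ℝ) :
    HasDerivAt (fun t : ℝ => TS (t • A) u X) (TS (t • A) (genS A u) X) t := by
  have hch : Continuous fun Ξ : Phase d => ch ((2 * Real.pi) • Ξ) X := by
    unfold ch; fun_prop
  have hs : ∀ A : Matrix (Fin d) (Fin d) ℝ, Continuous (symb A) := fun A =>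
    (symb_hasTemperateGrowth A).1.continuous
  have hc : ∀ (t : ℝ) (v : 𝓢(Phase d, ℂ)),
      Continuous fun Ξ => ch ((2 * Real.pi) • Ξ) X * (symb (t • A) Ξ * 𝓕 v Ξ) := fun t v =>
    hch.mul ((hs _).mul (𝓕 v).continuous)
  have hn : ∀ (t : ℝ) (v : 𝓢(Phase d, ℂ)) (Ξ : Phase d),
      ‖ch ((2 * Real.pi) • Ξ) X * (symb (t • A) Ξ * 𝓕 v Ξ)‖ = ‖𝓕 v Ξ‖ := fun t v Ξ => by
    rw [norm_mul, norm_mul, norm_ch, norm_symb, one_mul, one_mul]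
  simp only [TS_eq_integral_ch]
  refine (hasDerivAt_integral_of_dominated_loc_of_deriv_le (s := Set.univ) Filter.univ_mem
    (F := fun (t : ℝ) Ξ => ch ((2 * Real.pi) • Ξ) X * (symb (t • A) Ξ * 𝓕 u Ξ))
    (F' := fun (t : ℝ) Ξ => ch ((2 * Real.pi) • Ξ) X * (symb (t • A) Ξ * 𝓕 (genS A u) Ξ))
    (bound := fun Ξ => ‖𝓕 (genS A u) Ξ‖)
    (Filter.Eventually.of_forall fun t => (hc t u).aestronglyMeasurable)
    ((𝓕 u).integrable.norm.mono' (hc t u).aestronglyMeasurable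
      (Filter.Eventually.of_forall fun Ξ => (hn t u Ξ).le))
    (hc t _).aestronglyMeasurable
    (Filter.Eventually.of_forall fun Ξ t _ => (hn t _ Ξ).le)
    (𝓕 (genS A u)).integrable.norm
    (Filter.Eventually.of_forall fun Ξ t _ => ?_)).2
  have h1 : HasDerivAt (fun t : ℝ => symb (t • A) Ξ)
      (symb (t • A) Ξ * (Complex.I * (phase A Ξ : ℂ))) t := by
    simp only [symb, phase_smul]
    have h2 : HasDerivAt (fun t : ℝ => Complex.I * ((t * phase A Ξ : ℝ) : ℂ))
        (Complex.I * (phase A Ξ : ℂ)) t := by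
      have := ((hasDerivAt_id t).mul_const (phase A Ξ)).ofReal_comp.const_mul Complex.I
      simpa using this
    exact h2.cexp
  rw [fourier_genS]
  exact ((h1.mul_const (𝓕 u Ξ)).const_mul _).congr_deriv (by ring)

/-! ### Taylor expansion -/

/-- Taylor's formula on [0, 1]: derivatives bounded by C n!/2^n leave a remainder of order n/2^n. -/
theorem hasSum_of_hasDerivAt {E : ℕ → ℝ → ℂ} {C : ℝ}
    (hE : ∀ n, ∀ t ∈ Set.Icc (0 : ℝ) 1, HasDerivAt (E n) (E (n + 1) t) t)
    (hb : ∀ n, ∀ t ∈ Set.Icc (0 : ℝ) 1, ‖E n t‖ ≤ C * ((1 / 2) ^ n * n.factorial)) :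
    HasSum (fun n => (n.factorial : ℂ)⁻¹ * E n 0) (E 0 1) := by
  -- Taylor polynomials at the variable base point t, evaluated at 1. Their derivative in t
  -- telescopes to one term; at t = 1 they equal `E 0 1`, and at t = 0 they are the partial sums.
  set T : ℕ → ℝ → ℂ := fun n t => ∑ k ∈ Finset.range n,
    (k.factorial : ℂ)⁻¹ * (E k t * (((1 - t) ^ k : ℝ) : ℂ)) with hT
  have hd : ∀ n, ∀ t ∈ Set.Icc (0 : ℝ) 1, HasDerivAt (T (n + 1))
      ((n.factorial : ℂ)⁻¹ * (E (n + 1) t * (((1 - t) ^ n : ℝ) : ℂ))) t := by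
    intro n t ht
    induction n with
    | zero =>
      have : T (0 + 1) = E 0 := by funext t; simp [hT]
      rw [this]
      simpa using hE 0 t ht
    | succ n ih =>
      have e : T (n + 1 + 1) = fun t => T (n + 1) t +
          ((n + 1).factorial : ℂ)⁻¹ * (E (n + 1) t * (((1 - t) ^ (n + 1) : ℝ) : ℂ)) := by
        funext t; rw [hT]; simp only [Finset.sum_range_succ _ (n + 1)]
      rw [e]
      have h1 : HasDerivAt (fun t : ℝ => (((1 - t) ^ (n + 1) : ℝ) : ℂ))
          (-((n + 1 : ℂ) * (((1 - t) ^ n : ℝ) : ℂ))) t := by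
        have := (((hasDerivAt_id t).const_sub 1).pow (n + 1)).ofReal_comp
        refine this.congr_deriv ?_
        simp
      refine (ih.add (((hE (n + 1) t ht).mul h1).const_mul _)).congr_deriv ?_
      have hn : ((n + 1 : ℕ) : ℂ) ≠ 0 := by exact_mod_cast n.succ_ne_zero
      have hn' : (n.factorial : ℂ) ≠ 0 := by exact_mod_cast n.factorial_ne_zero
      rw [Nat.factorial_succ]
      push_cast at hn ⊢
      field_simp
      ring
  have hle : ∀ n, ‖E 0 1 - ∑ k ∈ Finset.range (n + 1), (k.factorial : ℂ)⁻¹ * E k 0‖ ≤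
      C * ((1 / 2) ^ (n + 1) * (n + 1 : ℝ)) := by
    intro n
    have hn : (0 : ℝ) < (n.factorial : ℝ) := by exact_mod_cast n.factorial_pos
    have h1 := norm_image_sub_le_of_norm_deriv_le_segment_01' (f := T (n + 1))
      (C := C * ((1 / 2) ^ (n + 1) * (n + 1 : ℝ)))
      (fun t ht => (hd n t ht).hasDerivWithinAt) fun t ht => ?_
    · have e1 : T (n + 1) 1 = E 0 1 := by
        simp only [hT, Finset.sum_range_succ']
        simp
      have e0 : T (n + 1) 0 = ∑ k ∈ Finset.range (n + 1), (k.factorial : ℂ)⁻¹ * E k 0 := by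
        simp [hT]
      rwa [e1, e0] at h1
    · have h2 := hb (n + 1) t ⟨ht.1, ht.2.le⟩
      have h3 : |1 - t| ≤ 1 := by rw [abs_le]; constructor <;> linarith [ht.1, ht.2]
      rw [norm_mul, norm_mul, norm_inv, Complex.norm_natCast, Complex.norm_real, Real.norm_eq_abs,
        abs_pow]
      have h4 : |1 - t| ^ n ≤ 1 := pow_le_one₀ (abs_nonneg _) h3
      calc _ ≤ (n.factorial : ℝ)⁻¹ * (C * ((1 / 2) ^ (n + 1) * (n + 1).factorial) * 1) := by
            gcongr
            exact (norm_nonneg _).trans h2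
        _ = C * ((1 / 2) ^ (n + 1) * (n + 1 : ℝ)) * ((n.factorial : ℝ)⁻¹ * n.factorial) := by
            rw [Nat.factorial_succ]; push_cast; ring
        _ = _ := by rw [inv_mul_cancel₀ hn.ne', mul_one]
  have hsum : Summable fun n => ‖(n.factorial : ℂ)⁻¹ * E n 0‖ := by
    refine Summable.of_nonneg_of_le (fun n => norm_nonneg _) (fun n => ?_) (summable_half C)
    have hn : (0 : ℝ) < (n.factorial : ℝ) := by exact_mod_cast n.factorial_pos
    rw [norm_mul, norm_inv, Complex.norm_natCast]
    calc _ ≤ (n.factorial : ℝ)⁻¹ * (C * ((1 / 2) ^ n * n.factorial)) := by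
          gcongr; exact hb n 0 (by simp)
      _ = C * (1 / 2) ^ n * ((n.factorial : ℝ)⁻¹ * n.factorial) := by ring
      _ = _ := by rw [inv_mul_cancel₀ hn.ne', mul_one]
  rw [hasSum_iff_tendsto_nat_of_summable_norm hsum, ← Filter.tendsto_add_atTop_iff_nat 1,
    ← tendsto_sub_nhds_zero_iff]
  refine squeeze_zero_norm (a := fun n : ℕ => C * ((1 / 2) ^ (n + 1) * (n + 1 : ℝ))) (fun n => by rw [norm_sub_rev]; exact hle n) ?_
  have h1 := (tendsto_self_mul_const_pow_of_lt_one (by norm_num : (0 : ℝ) ≤ 1 / 2)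
    (by norm_num)).const_mul C
  rw [mul_zero] at h1
  have h2 := h1.comp (Filter.tendsto_add_atTop_nat 1)
  refine h2.congr fun n => ?_
  simp only [Function.comp_apply]
  push_cast
  ring

/-! ### The exponential series represents the transposed operator -/

theorem GS.mono {s σ h h' C : ℝ} {f : Phase d → ℂ} (H : GS s σ h C f) (hh : 0 ≤ h) (hle : h ≤ h')
    (hC : 0 ≤ C) : GS s σ h' C f := by
  intro m l X
  have f1 := fr_nonneg s (cnt true m + cnt false l)
  have f2 := fr_nonneg σ (cnt false m + cnt true l)
  exact (H m l X).trans (by gcongr)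

/-- Decay uniform in `t`, possible because the continuity estimate depends on the matrix only
through the size of its entries. The range |t| ≤ 2 contains the unit balls around the points of [0,
1], on which derivatives in `t` are taken. -/
theorem exists_TS_bound {s σ : ℝ} (hs : 0 < s) (hσ : 0 < σ) (hsσ : 1 ≤ s + σ)
    (A : Matrix (Fin d) (Fin d) ℝ) {u : 𝓢(Phase d, ℂ)} (hu : ⇑u ∈ SSpace d s σ σ s) :
    ∃ r C : ℝ, 0 < r ∧ 0 ≤ C ∧ ∀ t : ℝ, |t| ≤ 2 → ∃ h C', 0 ≤ h ∧ 0 ≤ C' ∧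
      Gam s σ h C' (fun X => Real.exp (-r * gauge s σ X)) (TS (t • A) u) ∧ C' ≤ C := by
  obtain ⟨-, h, hh, C, hC, H⟩ := (mem_SSpace_iff hs hσ).1 hu
  set a := 2 * ∑ i, ∑ k, |cf A i k| with ha
  have ha0 : 0 ≤ a := by positivity
  have H' : GS s σ (max h 1) C u := H.mono hh.le (le_max_left _ _) hC
  obtain ⟨K, hK, H2⟩ := exists_GS_TS d hs hσ hsσ (H := max h 1) (by positivity)
    (Or.inl (le_max_right _ _)) ha0
  have hk := kap_pos (s := s) (σ := σ) ha0
  obtain ⟨r, hr, hle⟩ := exists_lam_le d hs hσ (h := 1 / (kap s σ a * max h 1 * 2 ^ (s + σ)))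
    (by positivity)
  refine ⟨r, 2 ^ (s + σ) * (K * C), hr, by positivity, fun t ht =>
    ⟨_, _, ?_, ?_, (H2 (t • A) ?_ u C hC H').gam hs hσ (by positivity) (by positivity) hr ?_,
      le_rfl⟩⟩
  · positivity
  · positivity
  · intro i
    have e : ∀ k, |cf (t • A) i k| = |t| * |cf A i k| := by
      intro k
      rw [← abs_mul]
      congr 1
      rcases i with i | i <;> rcases k with k | k <;> simp [cf]
    simp only [e, ← Finset.mul_sum]
    rw [ha]
    exact mul_le_mul ht (sum_abs_cf_le A i) (by positivity) (by positivity)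
  · rw [le_div_iff₀ (by positivity)] at hle
    linarith

theorem genNorm_mul_sq_le {a h : ℝ} (n : ℕ) (ha : 0 ≤ a) (hA : a * (2 * h) ^ 2 ≤ 1 / 2) :
    (a * (2 * h) ^ 2) ^ n * n.factorial ≤ (1 / 2) ^ n * n.factorial := by gcongr

/-- With E_n(t) the integral of gen^n f · T_{tA} u, symmetry of the generator gives E_n' = E_{n+1}.
The Taylor series of E_0 at 0, evaluated at 1, is the exponential series on one side and the pairing
with T_A u on the other. -/
theorem integral_expGen_mul {s σ : ℝ} (hs : 0 < s) (hσ : 0 < σ) (hsσ : s + σ = 1)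
    (A : Matrix (Fin d) (Fin d) ℝ) {f : Phase d → ℂ} (hf : ContDiff ℝ (⊤ : ℕ∞) f)
    (hG : ∀ h ε, 0 < h → 0 < ε → ∃ C, 0 ≤ C ∧
      Gam s σ h C (fun X => Real.exp (ε * gauge s σ X)) f)
    (hc : Continuous (expGen A f [])) {u : 𝓢(Phase d, ℂ)} (hu : ⇑u ∈ SSpace d s σ σ s) :
    Integrable (fun X => expGen A f [] X * u X) ∧
      ∫ X, expGen A f [] X * u X = ∫ X, f X * TS A u X := by
  have hgen : ⇑(genS A u) ∈ SSpace d s σ σ s := by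
    rw [coe_genS, gen]
    refine Submodule.smul_mem _ _ (Submodule.sum_mem _ fun p _ => Submodule.smul_mem _ _ ?_)
    exact SSpace_dl hs hσ hu _
  obtain ⟨r₁, K₁, hr₁, hK₁, H₁⟩ := exists_TS_bound hs hσ hsσ.ge A hu
  obtain ⟨r₂, K₂, hr₂, hK₂, H₂⟩ := exists_TS_bound hs hσ hsσ.ge A hgen
  set r := min r₁ r₂ with hr
  have hr0 : 0 < r := lt_min hr₁ hr₂
  obtain ⟨δ, hδ, -, hδA⟩ := exists_small (genNorm_nonneg A) one_pos
  -- The decay rate of the test functions is given, so the symbol must be allowed to grow at half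
  -- that rate only; rate r/2 of decay remains for integration.
  obtain ⟨C, hC, H⟩ := hG δ (r / 2) hδ (by positivity)
  have hCw : ∀ X : Phase d, 0 ≤ C * Real.exp (r / 2 * gauge s σ X) := fun X => by positivity
  have hgl : ∀ n l X, ‖dl l ((gen A)^[n] f) X‖ ≤
      (C * ((2 * δ) ^ l.length * (fr σ (cnt true l) * fr s (cnt false l))) *
        ((1 / 2) ^ n * n.factorial)) * Real.exp (r / 2 * gauge s σ X) := by
    intro n l X
    refine (H.norm_gen_iterate_le hs hσ hsσ hδ.le hCw hf A n l X).trans ?_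
    have f1 := fr_nonneg σ (cnt true l)
    have f2 := fr_nonneg s (cnt false l)
    have h1 := genNorm_mul_sq_le n (genNorm_nonneg A) hδA
    calc _ ≤ C * ((2 * δ) ^ l.length * (fr σ (cnt true l) * fr s (cnt false l))) *
          Real.exp (r / 2 * gauge s σ X) * ((1 / 2) ^ n * n.factorial) := by gcongr
      _ = _ := by ring
  have hg0 : ∀ n X, ‖(gen A)^[n] f X‖ ≤
      (C * ((1 / 2) ^ n * n.factorial)) * Real.exp (r / 2 * gauge s σ X) := by
    intro n X
    simpa using hgl n [] X
  have hT1 : ∀ t : ℝ, |t| ≤ 2 → ∀ X, ‖TS (t • A) u X‖ ≤ K₁ * Real.exp (-r * gauge s σ X) := by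
    intro t ht X
    obtain ⟨h, C', -, -, h1, h2⟩ := H₁ t ht
    have := h1 [] X
    simp only [dl_nil, List.length_nil, pow_zero, cnt_nil, fr_zero, mul_one] at this
    refine this.trans ?_
    have := gauge_nonneg s σ X
    gcongr
    exact min_le_left _ _
  have hT2 : ∀ t : ℝ, |t| ≤ 2 → ∀ X, ‖TS (t • A) (genS A u) X‖ ≤
      K₂ * Real.exp (-r * gauge s σ X) := by
    intro t ht X
    obtain ⟨h, C', -, -, h1, h2⟩ := H₂ t ht
    have := h1 [] X
    simp only [dl_nil, List.length_nil, pow_zero, cnt_nil, fr_zero, mul_one] at this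
    refine this.trans ?_
    have := gauge_nonneg s σ X
    gcongr
    exact min_le_right _ _
  have hcg : ∀ n, ContDiff ℝ (⊤ : ℕ∞) ((gen A)^[n] f) := contDiff_gen_iterate hf A
  have hrr : r / 2 < r := by linarith
  set E : ℕ → ℝ → ℂ := fun n t => ∫ X, (gen A)^[n] f X * TS (t • A) u X with hE
  set J := ∫ X : Phase d, Real.exp (-(r / 2) * gauge s σ X) with hJ
  have hJ0 : 0 ≤ J := integral_nonneg fun X => by positivity
  have hprod : ∀ n (t : ℝ), |t| ≤ 2 → ∀ X, ‖(gen A)^[n] f X * TS (t • A) u X‖ ≤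
      (C * K₁ * ((1 / 2) ^ n * n.factorial)) * Real.exp (-(r / 2) * gauge s σ X) := by
    intro n t ht X
    rw [norm_mul]
    calc _ ≤ ((C * ((1 / 2) ^ n * n.factorial)) * Real.exp (r / 2 * gauge s σ X)) *
          (K₁ * Real.exp (-r * gauge s σ X)) := by
          gcongr
          · exact hg0 n X
          · exact hT1 t ht X
      _ = (C * K₁ * ((1 / 2) ^ n * n.factorial)) *
          (Real.exp (r / 2 * gauge s σ X) * Real.exp (-r * gauge s σ X)) := by ring
      _ = _ := by rw [← Real.exp_add]; ring_nf
  have hEb : ∀ n, ∀ t ∈ Set.Icc (0 : ℝ) 1, ‖E n t‖ ≤ C * K₁ * J * ((1 / 2) ^ n * n.factorial) := by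
    intro n t ht
    have ht2 : |t| ≤ 2 := by rw [abs_le]; constructor <;> linarith [ht.1, ht.2]
    refine (norm_integral_le_of_norm_le ((integrable_exp_gauge hs hσ (half_pos hr0)).const_mul _)
      (Filter.Eventually.of_forall (hprod n t ht2))).trans (le_of_eq ?_)
    rw [integral_const_mul]
    ring
  have hEd : ∀ n, ∀ t ∈ Set.Icc (0 : ℝ) 1, HasDerivAt (E n) (E (n + 1) t) t := by
    intro n t ht
    have hball : ∀ x ∈ Metric.ball t 1, |x| ≤ 2 := by
      intro x hx
      rw [Metric.mem_ball, Real.dist_eq, abs_lt] at hx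
      rw [abs_le]; constructor <;> linarith [ht.1, ht.2, hx.1, hx.2]
    have ht2 := hball t (Metric.mem_ball_self one_pos)
    have hcont : ∀ (x : ℝ) (v : 𝓢(Phase d, ℂ)),
        Continuous fun X => (gen A)^[n] f X * TS (x • A) v X := fun x v =>
      (hcg n).continuous.mul (TS (x • A) v).continuous
    have h1 := (hasDerivAt_integral_of_dominated_loc_of_deriv_le (μ := (volume : Measure (Phase d)))
      (x₀ := t) (F := fun x X => (gen A)^[n] f X * TS (x • A) u X)
      (F' := fun x X => (gen A)^[n] f X * TS (x • A) (genS A u) X)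
      (bound := fun X => (C * ((1 / 2) ^ n * n.factorial)) * Real.exp (r / 2 * gauge s σ X) *
        (K₂ * Real.exp (-r * gauge s σ X)))
      (Metric.ball_mem_nhds t one_pos)
      (Filter.Eventually.of_forall fun x => (hcont x u).aestronglyMeasurable)
      (integrable_mul_of_le hs hσ hrr (hcg n).continuous (TS (t • A) u).continuous (hg0 n)
        (hT1 t ht2))
      (hcont t _).aestronglyMeasurable
      (Filter.Eventually.of_forall fun X x hx => ?_) ?_
      (Filter.Eventually.of_forall fun X x _ => (hasDerivAt_TS A u X x).const_mul _)).2
    · refine h1.congr_deriv ?_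
      simp only [TS_genS, coe_genS]
      rw [hE]
      simp only [Function.iterate_succ_apply' (gen A) n]
      refine (integral_gen_mul (hcg n) ((TS (t • A) u).smooth _) (fun l l' => ?_) A).symm
      obtain ⟨h, C', -, -, h1, -⟩ := H₁ t ht2
      refine integrable_mul_of_le (r := r₁) hs hσ (by linarith [min_le_left r₁ r₂])
        (contDiff_dl (hcg n) l).continuous
        (contDiff_dl ((TS (t • A) u).smooth _) l').continuous (hgl n l) fun X => h1 l' X
    · rw [norm_mul]
      gcongr
      · exact hg0 n X
      · exact hT2 x (hball x hx) X
    · refine ((integrable_exp_gauge hs hσ (half_pos hr0)).const_mul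
        (C * ((1 / 2) ^ n * n.factorial) * K₂)).congr (Filter.Eventually.of_forall fun X => ?_)
      have e : Real.exp (-(r / 2) * gauge s σ X) =
          Real.exp (r / 2 * gauge s σ X) * Real.exp (-r * gauge s σ X) := by
        rw [← Real.exp_add]; ring_nf
      simp only [e]
      ring
  have hTaylor := hasSum_of_hasDerivAt hEd hEb
  have e0 : ∀ n X, (gen A)^[n] f X * TS ((0 : ℝ) • A) u X = (gen A)^[n] f X * u X := by
    intro n X; rw [zero_smul, TS_zero]
  have hF : ∀ n X, ‖expTerm A f [] n X * u X‖ ≤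
      C * K₁ * (1 / 2) ^ n * Real.exp (-(r / 2) * gauge s σ X) := by
    intro n X
    have h1 := hprod n 0 (by simp) X
    have hn : (0 : ℝ) < (n.factorial : ℝ) := by exact_mod_cast n.factorial_pos
    rw [e0] at h1
    rw [expTerm, dl_nil, mul_assoc, norm_mul, norm_inv, Complex.norm_natCast]
    calc _ ≤ (n.factorial : ℝ)⁻¹ * _ := mul_le_mul_of_nonneg_left h1 (by positivity)
      _ = C * K₁ * (1 / 2) ^ n * Real.exp (-(r / 2) * gauge s σ X) *
          ((n.factorial : ℝ)⁻¹ * n.factorial) := by ring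
      _ = _ := by rw [inv_mul_cancel₀ hn.ne', mul_one]
  have hFc : ∀ n, Continuous fun X => expTerm A f [] n X * u X := fun n =>
    (continuous_const.mul (hcg n).continuous).mul u.continuous
  have hI := integrable_exp_gauge (d := d) hs hσ (half_pos hr0)
  have hFi : ∀ n, Integrable fun X => expTerm A f [] n X * u X := fun n =>
    (hI.const_mul _).mono' (hFc n).aestronglyMeasurable (Filter.Eventually.of_forall (hF n))
  have hsumF := hasSum_integral_of_summable_integral_norm hFi
    (Summable.of_nonneg_of_le (fun n => integral_nonneg fun X => norm_nonneg _)
      (fun n => (integral_mono (hFi n).norm (hI.const_mul (C * K₁ * (1 / 2) ^ n)) (hF n)).trans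
        (le_of_eq (by rw [integral_const_mul, ← hJ]; ring : _ = C * K₁ * J * (1 / 2) ^ n)))
      (summable_half (C * K₁ * J)))
  have e1 : ∀ X, ∑' n, expTerm A f [] n X * u X = expGen A f [] X * u X := fun X => tsum_mul_right
  have e2 : ∀ n, ∫ X, expTerm A f [] n X * u X = (n.factorial : ℂ)⁻¹ * E n 0 := by
    intro n
    simp only [hE, e0, expTerm, mul_assoc, dl_nil]
    rw [integral_const_mul]
  simp only [e1, e2] at hsumF
  refine ⟨((hI.const_mul (C * K₁ * 2))).mono' (hc.mul u.continuous).aestronglyMeasurable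
    (Filter.Eventually.of_forall fun X => ?_), ?_⟩
  · rw [← e1]
    refine (tsum_of_norm_bounded (((hasSum_geometric_of_lt_one (by norm_num : (0 : ℝ) ≤ 1 / 2)
      (by norm_num)).mul_left (C * K₁ * Real.exp (-(r / 2) * gauge s σ X)))) fun n =>
        (hF n X).trans (le_of_eq (by ring))).trans (le_of_eq ?_)
    norm_num
    ring
  · rw [hsumF.unique hTaylor, hE]
    simp

/-! ### Growth of symbols that define Roumieu distributions -/

/-- A nonzero function, translated and scaled to be 1 at the origin, is raised to a high power. This
multiplies its decay rate and keeps Gevrey bounds with some parameter. -/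
theorem exists_window {s σ : ℝ} (hs : 0 < s) (hσ : 0 < σ) (hne : SSpace d s σ σ s ≠ ⊥) (R : ℝ) :
    ∃ (φ : Phase d → ℂ) (h C : ℝ), ContDiff ℝ (⊤ : ℕ∞) φ ∧ φ 0 = 1 ∧ 0 < h ∧ 0 ≤ C ∧
      Gam s σ h C (fun X => Real.exp (-R * gauge s σ X)) φ := by
  obtain ⟨φ₀, hφ₀, hφ0⟩ := (Submodule.ne_bot_iff _).1 hne
  obtain ⟨X₀, hX₀⟩ := Function.ne_iff.1 hφ0
  set φ₁ : Phase d → ℂ := (φ₀ X₀)⁻¹ • fun X => φ₀ (X + X₀) with hφ₁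
  have hmem : φ₁ ∈ SSpace d s σ σ s := Submodule.smul_mem _ _ (SSpace_translate hs hσ hφ₀ X₀)
  have h1 : φ₁ 0 = 1 := by
    simp only [hφ₁, Pi.smul_apply, zero_add, smul_eq_mul]
    exact inv_mul_cancel₀ hX₀
  obtain ⟨hsm, h, r, hh, hr, C, hC, H⟩ := (mem_SSpace_iff_Gam hs hσ).1 hmem
  have key : ∀ n : ℕ, ∃ h C : ℝ, ContDiff ℝ (⊤ : ℕ∞) (φ₁ ^ (n + 1)) ∧ 0 < h ∧ 0 ≤ C ∧
      Gam s σ h C (fun X => Real.exp (-((n + 1 : ℕ) * r) * gauge s σ X)) (φ₁ ^ (n + 1)) := by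
    intro n
    induction n with
    | zero => exact ⟨h, C, by simpa using hsm, hh, hC, by simpa using H⟩
    | succ n ih =>
      obtain ⟨h', C', hsm', hh', hC', H'⟩ := ih
      have hm : 0 < max h h' := lt_max_of_lt_left hh
      have h2 := Gam.mul hs.le hσ.le hm.le hsm' hsm (fun X => by positivity)
        (fun X => by positivity)
        (H'.mono hh'.le (le_max_right h h') (fun X => by positivity) fun X => le_rfl)
        (H.mono hh.le (le_max_left h h') (fun X => by positivity) fun X => le_rfl)
      rw [← pow_succ] at h2
      refine ⟨_, _, ?_, by positivity, mul_nonneg hC' hC, h2.mono (by positivity) le_rfl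
        (fun X => by positivity) fun X => ?_⟩
      · rw [pow_succ]; exact hsm'.mul hsm
      · rw [← Real.exp_add]
        gcongr
        push_cast
        linarith
  obtain ⟨n, hn⟩ := exists_nat_ge (R / r)
  obtain ⟨h', C', hsm', hh', hC', H'⟩ := key n
  refine ⟨φ₁ ^ (n + 1), h', C', hsm', by simp [h1], hh', hC', H'.mono hh'.le le_rfl
    (fun X => by positivity) fun X => ?_⟩
  rw [div_le_iff₀ hr] at hn
  have := gauge_nonneg s σ X
  gcongr
  push_cast
  nlinarith

/-- Integration by parts along the monomial in the frequency from `exp_gauge_le`. The rate depends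
only on the Gevrey parameter, so it is uniform over localized symbols. -/
theorem exists_fourier_decay (d : ℕ) {s σ h : ℝ} (hs : 0 < s) (hσ : 0 < σ) (hh : 0 < h) :
    ∃ ρ K : ℝ, 0 < ρ ∧ 0 ≤ K ∧ ∀ {v : Phase d → ℂ} {C : ℝ}, ContDiff ℝ (⊤ : ℕ∞) v → 0 ≤ C →
      Gam s σ h C (fun X => Real.exp (-1 * gauge s σ X)) v →
      ∀ Z, ‖∫ X, ch Z X * v X‖ ≤ K * C * Real.exp (-ρ * gauge σ s Z) := by
  obtain ⟨ρ, hρ, hle⟩ := exists_lam_le d hσ hs (h := 1 / h) (by positivity)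
  set J := ∫ X : Phase d, Real.exp (-1 * gauge s σ X) with hJ
  have hJ0 : 0 ≤ J := integral_nonneg fun X => by positivity
  refine ⟨ρ, 2 ^ (σ + s) * J, hρ, by positivity, fun {v C} hv hC H Z => ?_⟩
  obtain ⟨m, hm⟩ := exp_gauge_le hσ hs hρ Z
  set I := ‖∫ X, ch Z X * v X‖ with hI
  have hI0 : 0 ≤ I := norm_nonneg _
  have hint : ∀ l l', Integrable fun X => dl l (ch Z) X * dl l' v X := fun l l' => by
    refine integrable_mul_of_le (ε := 0) hs hσ one_pos (contDiff_dl (contDiff_ch Z) l).continuous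
      (contDiff_dl hv l').continuous (C := |xl l Z|) (fun X => le_of_eq ?_) fun X => H l' X
    rw [dl_ch, Pi.smul_apply, norm_smul, norm_ch, norm_mul, norm_pow, Complex.norm_I, one_pow,
      one_mul, mul_one, Complex.norm_real, Real.norm_eq_abs]
    simp
  have h1 : |xl m Z| * I = ‖∫ X, ch Z X * dl m v X‖ := by
    have h2 := integral_dl_mul (contDiff_ch Z) hv hint m
    have h3 : ∀ X, dl m (ch Z) X * v X = (Complex.I ^ m.length * xl m Z) * (ch Z X * v X) :=
      fun X => by rw [dl_ch, Pi.smul_apply, smul_eq_mul, mul_assoc]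
    simp only [h3] at h2
    rw [integral_const_mul] at h2
    have h4 := congrArg norm h2
    rw [norm_mul, norm_mul, norm_mul, norm_pow, norm_pow, Complex.norm_I, norm_neg, norm_one,
      one_pow, one_mul, one_mul, Complex.norm_real, Real.norm_eq_abs] at h4
    exact h4
  have f1 := fr_pos σ (cnt true m)
  have f2 := fr_pos s (cnt false m)
  have h2 : |xl m Z| * I ≤ C * (h ^ m.length * (fr σ (cnt true m) * fr s (cnt false m))) * J := by
    rw [h1, hJ, ← integral_const_mul]
    refine norm_integral_le_of_norm_le ((integrable_exp_gauge hs hσ one_pos).const_mul _)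
      (Filter.Eventually.of_forall fun X => ?_)
    rw [norm_mul, norm_ch, one_mul]
    exact H m X
  have hl := lam_pos d hσ hs hρ
  rw [le_div_iff₀ hh] at hle
  have h3 : Real.exp (ρ * gauge σ s Z) * I ≤ 2 ^ (σ + s) * J * C := by
    calc _ ≤ (2 ^ (σ + s) * (lam d σ s ρ ^ m.length * |xl m Z| /
          (fr σ (cnt true m) * fr s (cnt false m)))) * I := by gcongr
      _ = 2 ^ (σ + s) * (lam d σ s ρ ^ m.length * (|xl m Z| * I) /
          (fr σ (cnt true m) * fr s (cnt false m))) := by ring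
      _ ≤ 2 ^ (σ + s) * (lam d σ s ρ ^ m.length *
          (C * (h ^ m.length * (fr σ (cnt true m) * fr s (cnt false m))) * J) /
          (fr σ (cnt true m) * fr s (cnt false m))) := by gcongr
      _ = 2 ^ (σ + s) * ((lam d σ s ρ * h) ^ m.length * (J * C)) := by
          rw [mul_pow]; field_simp
      _ ≤ 2 ^ (σ + s) * (1 * (J * C)) := by
          gcongr
          exact pow_le_one₀ (by positivity) hle
      _ = _ := by ring
  have e : Real.exp (ρ * gauge σ s Z) * Real.exp (-ρ * gauge σ s Z) = 1 := by
    rw [← Real.exp_add]; simp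
  calc I = Real.exp (ρ * gauge σ s Z) * I * Real.exp (-ρ * gauge σ s Z) := by
        linear_combination (-I) * e
    _ ≤ _ := by gcongr

/-- Weighted geometric mean of two bounds: a small `h` in one compensates a large `B` in the other,
and the exponents interpolate. -/
theorem le_of_le_of_le_rpow {x K K' h B W p q θ : ℝ} {n : ℕ} (hx : 0 ≤ x) (hK : 0 ≤ K)
    (hK' : 0 ≤ K') (hh : 0 ≤ h) (hB : 0 ≤ B) (hW : 0 ≤ W) (hθ : 0 < θ) (hθ' : θ < 1)
    (h1 : x ≤ K * (h ^ n * W) * Real.exp p) (h2 : x ≤ K' * (B ^ n * W) * Real.exp q) :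
    x ≤ K ^ θ * K' ^ (1 - θ) * ((h ^ θ * B ^ (1 - θ)) ^ n * W) *
      Real.exp (θ * p + (1 - θ) * q) := by
  have hθ1 : 0 < 1 - θ := by linarith
  have split : ∀ y : ℝ, 0 ≤ y → y ^ θ * y ^ (1 - θ) = y := fun y hy => by
    rw [← Real.rpow_add' hy (by linarith), add_sub_cancel, Real.rpow_one]
  have hpw : ∀ (y τ : ℝ), 0 ≤ y → (y ^ n) ^ τ = (y ^ τ) ^ n := fun y τ hy => by
    rw [← Real.rpow_natCast, ← Real.rpow_mul hy, mul_comm, Real.rpow_mul hy, Real.rpow_natCast]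
  calc x = x ^ θ * x ^ (1 - θ) := (split x hx).symm
    _ ≤ (K * (h ^ n * W) * Real.exp p) ^ θ * (K' * (B ^ n * W) * Real.exp q) ^ (1 - θ) := by
        gcongr
    _ = K ^ θ * K' ^ (1 - θ) * ((h ^ θ * B ^ (1 - θ)) ^ n * (W ^ θ * W ^ (1 - θ))) *
        (Real.exp p ^ θ * Real.exp q ^ (1 - θ)) := by
        rw [Real.mul_rpow (by positivity) (by positivity),
          Real.mul_rpow hK (by positivity), Real.mul_rpow (by positivity) hW,
          Real.mul_rpow (by positivity) (by positivity),
          Real.mul_rpow hK' (by positivity), Real.mul_rpow (by positivity) hW,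
          hpw h θ hh, hpw B _ hB, mul_pow]
        ring
    _ = _ := by
        rw [split W hW, ← Real.exp_mul, ← Real.exp_mul, ← Real.exp_add]
        ring_nf

section Growth

variable {s σ : ℝ} {w : Phase d → ℝ} {f φ : Phase d → ℂ}

/-- Two parameters are kept apart: further derivatives of the localized function cost the fixed
parameter `2 * h₁` of the window, whereas the derivatives `l` of the symbol cost an arbitrarily
small `h`. -/
theorem localized_bound (hs : 0 < s) (hσ : 0 < σ) (hw : IsModerate s σ w) {r₀ C₀ : ℝ}
    (hC₀ : 0 ≤ C₀) (h0 : ∀ X Y, w Y ≤ C₀ * w X * Real.exp (r₀ * gauge s σ (X - Y)))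
    (hfs : ContDiff ℝ (⊤ : ℕ∞) f) (hfG : ∀ h, 0 < h → ∃ C, 0 ≤ C ∧ Gam s σ h C w f)
    (hφs : ContDiff ℝ (⊤ : ℕ∞) φ) {h₁ C₁ : ℝ} (hh₁ : 0 < h₁) (hC₁ : 0 ≤ C₁)
    (hφ : Gam s σ h₁ C₁ (fun X => Real.exp (-(r₀ + 1) * gauge s σ X)) φ) {h : ℝ} (hh : 0 < h) :
    ∃ K, 0 ≤ K ∧ ∀ l Y, Gam s σ (2 * h₁)
      (K * (h ^ l.length * (fr σ (cnt true l) * fr s (cnt false l))) * w Y)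
      (fun X => Real.exp (-1 * gauge s σ X)) ((fun X => dl l f (X + Y)) * φ) := by
  have h2 : (0 : ℝ) < 2 ^ (s + σ) := by positivity
  -- One parameter for the symbol serves both kinds of derivatives; the division by 2^{s+σ} offsets
  -- the loss in `Gam.dl`.
  set k := min h h₁ with hk
  have hk0 : 0 < k := lt_min hh hh₁
  obtain ⟨C, hC, H⟩ := hfG (k / 2 ^ (s + σ)) (by positivity)
  refine ⟨C * C₀ * C₁, by positivity, fun l Y => ?_⟩
  have f1 := fr_nonneg σ (cnt true l)
  have f2 := fr_nonneg s (cnt false l)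
  have hwp := hw.pos
  have hwY := hw.pos Y
  have hl := H.dl hs.le hσ.le (by positivity) (fun X => mul_nonneg hC (hwp X).le) l
  rw [mul_div_cancel₀ _ h2.ne'] at hl
  have ht : Gam s σ h₁
      (C * C₀ * (h ^ l.length * (fr σ (cnt true l) * fr s (cnt false l))) * w Y)
      (fun X => Real.exp (r₀ * gauge s σ X)) (fun X => dl l f (X + Y)) := by
    refine (hl.translate Y).mono hk0.le (min_le_right _ _) (fun X => (hwp _).le) fun X => ?_
    have h3 := h0 Y (X + Y)
    rw [show Y - (X + Y) = -X by abel, gauge_neg] at h3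
    calc _ ≤ C * (k ^ l.length * (fr σ (cnt true l) * fr s (cnt false l))) *
          (C₀ * w Y * Real.exp (r₀ * gauge s σ X)) := by gcongr
      _ ≤ C * (h ^ l.length * (fr σ (cnt true l) * fr s (cnt false l))) *
          (C₀ * w Y * Real.exp (r₀ * gauge s σ X)) := by gcongr; exact min_le_left _ _
      _ = _ := by ring
  have hm := Gam.mul hs.le hσ.le hh₁.le (contDiff_translate (contDiff_dl hfs l) Y) hφs
    (fun X => by positivity) (fun X => by positivity) ht hφ
  refine hm.mono (by positivity) le_rfl (fun X => by positivity) fun X => ?_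
  rw [← Real.exp_add, show r₀ * gauge s σ X + -(r₀ + 1) * gauge s σ X = -1 * gauge s σ X by ring]
  exact le_of_eq (by ring)

theorem integrable_dl_mul_translate (hs : 0 < s) (hσ : 0 < σ) {r₀ C₀ : ℝ}
    (h0 : ∀ X Y, w Y ≤ C₀ * w X * Real.exp (r₀ * gauge s σ (X - Y)))
    (hfs : ContDiff ℝ (⊤ : ℕ∞) f) (hfG : ∀ h, 0 < h → ∃ C, 0 ≤ C ∧ Gam s σ h C w f)
    (hφs : ContDiff ℝ (⊤ : ℕ∞) φ) {h₁ C₁ : ℝ} (hh₁ : 0 < h₁) (hC₁ : 0 ≤ C₁)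
    (hφ : Gam s σ h₁ C₁ (fun X => Real.exp (-(r₀ + 1) * gauge s σ X)) φ)
    (l₁ l₂ : List (Fin d ⊕ Fin d)) (Y Z : Phase d) :
    Integrable fun X => dl l₁ f X * dl l₂ (fun X => (ch Z * φ) (X + -Y)) X := by
  obtain ⟨C, hC, H⟩ := hfG 1 one_pos
  have hsm : ContDiff ℝ (⊤ : ℕ∞) (ch Z * φ) := (contDiff_ch Z).mul hφs
  have hM := monoFac_pos hσ hs one_pos
  set k := max h₁ (monoFac σ s 1) with hk
  have hk0 : 0 < k := lt_max_of_lt_left hh₁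
  have g1 := Gam.mul hs.le hσ.le hk0.le (contDiff_ch Z) hφs (fun X => by positivity)
    (fun X => by positivity)
    ((Gam_ch hs hσ one_pos Z).mono hM.le (le_max_right h₁ _) (fun X => zero_le_one) fun X => le_rfl)
    (hφ.mono hh₁.le (le_max_left _ (monoFac σ s 1)) (fun X => by positivity) (C' := C₁)
      (w' := fun X => Real.exp (-(r₀ + 1) * gauge s σ X)) fun X => le_rfl)
  have h1 : Integrable fun X => dl l₁ f (X + Y) * dl l₂ (ch Z * φ) X := by
    refine integrable_mul_of_le (ε := r₀) (r := r₀ + 1)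
      (C := C * (1 ^ l₁.length * (fr σ (cnt true l₁) * fr s (cnt false l₁))) * (C₀ * w Y))
      (C' := Real.exp (1 * gauge σ s Z) * C₁ *
        ((2 * k) ^ l₂.length * (fr σ (cnt true l₂) * fr s (cnt false l₂))))
      hs hσ (lt_add_one r₀) ((contDiff_dl hfs l₁).continuous.comp (continuous_add_const Y))
      (contDiff_dl hsm l₂).continuous (fun X => ?_) fun X => ?_
    · have h3 := h0 Y (X + Y)
      rw [show Y - (X + Y) = -X by abel, gauge_neg] at h3
      have f1 := fr_nonneg σ (cnt true l₁)
      have f2 := fr_nonneg s (cnt false l₁)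
      refine (H l₁ (X + Y)).trans ?_
      rw [mul_assoc _ (C₀ * w Y)]
      gcongr
    · refine (g1 l₂ X).trans (le_of_eq ?_)
      simp only [one_mul]
  have h2 := h1.comp_add_right (-Y)
  refine h2.congr (Filter.Eventually.of_forall fun X => ?_)
  simp only [neg_add_cancel_right, dl_translate]

/-- Translations and modulations of the window cost exponentials of arbitrarily small rate if the
norm parameter is taken large, and a Roumieu functional is bounded for every parameter. The price is
an uncontrolled base `B` for the derivatives. -/
theorem localized_bound_dual (hs : 0 < s) (hσ : 0 < σ) {a : SSpace d s σ σ s →ₗ[ℂ] ℂ}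
    (ha : ∀ h : ℝ, 0 < h → ∃ C : ℝ≥0, ∀ φ : SSpace d s σ σ s,
      gsNorm s σ σ s h (φ : Phase d → ℂ) < ∞ →
      ‖a φ‖ₑ ≤ C * gsNorm s σ σ s h (φ : Phase d → ℂ))
    (hφs : ContDiff ℝ (⊤ : ℕ∞) φ) {h₁ C₁ R : ℝ} (hh₁ : 0 < h₁) (hC₁ : 0 ≤ C₁)
    (hφ : Gam s σ h₁ C₁ (fun X => Real.exp (-R * gauge s σ X)) φ) {ε : ℝ} (hε : 0 < ε)
    (hεR : ε ≤ R) :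
    ∃ B K, 0 < B ∧ 0 ≤ K ∧ ∀ (l : List (Fin d ⊕ Fin d)) (Y Z : Phase d),
      ∃ θ : SSpace d s σ σ s,
        (θ : Phase d → ℂ) = dl l (fun X => (ch Z * φ) (X + -Y)) ∧
        ‖a θ‖ ≤ K * (B ^ l.length * (fr σ (cnt true l) * fr s (cnt false l))) *
          Real.exp (ε * gauge s σ Y + ε * gauge σ s Z) := by
  have hq := quasi_pos s σ
  have hM := monoFac_pos hσ hs hε
  set k := max h₁ (monoFac σ s ε) with hk
  have hk0 : 0 < k := lt_max_of_lt_left hh₁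
  set H := max (2 * k) (monoFac s σ (ε / quasi s σ)) with hH
  have hH0 : 0 < H := lt_max_of_lt_left (by positivity)
  obtain ⟨Ca, hCa⟩ := ha ((2 * (d + 1)) ^ (s + σ) * (2 ^ (s + σ) * H)) (by positivity)
  refine ⟨2 ^ (s + σ) * H, Ca * C₁, by positivity, by positivity, fun l Y Z => ?_⟩
  have f1 := fr_nonneg σ (cnt true l)
  have f2 := fr_nonneg s (cnt false l)
  have g1 : Gam s σ (2 * k) (Real.exp (ε * gauge σ s Z) * C₁)
      (fun X => Real.exp (-ε * gauge s σ X)) (ch Z * φ) := by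
    have := Gam.mul hs.le hσ.le hk0.le (contDiff_ch Z) hφs (fun X => by positivity)
      (fun X => by positivity)
      ((Gam_ch hs hσ hε Z).mono hM.le (le_max_right h₁ _) (fun X => zero_le_one) fun X => le_rfl)
      (hφ.mono hh₁.le (le_max_left _ (monoFac σ s ε)) (fun X => by positivity) (C' := C₁)
        (w' := fun X => Real.exp (-ε * gauge s σ X)) fun X => by
          have := gauge_nonneg s σ X
          gcongr)
    refine this.mono (by positivity) le_rfl (fun X => by positivity) fun X => ?_
    rw [one_mul]
  have hsm : ContDiff ℝ (⊤ : ℕ∞) (ch Z * φ) := (contDiff_ch Z).mul hφs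
  have hsm' := contDiff_translate hsm (-Y)
  have g2 := (g1.translate_exp hs hσ (by positivity) (by positivity) hε.le (-Y)).gs hs hσ
    (by positivity) (by positivity) (by positivity)
  rw [gauge_neg, ← hH] at g2
  have g3 := g2.dl hs.le hσ.le hH0.le (by positivity) l
  have g4 := gsNorm_le_of_GS hs.le hσ.le (by positivity) (by positivity) g3
  have hmem : dl l (fun X => (ch Z * φ) (X + -Y)) ∈ SSpace d s σ σ s :=
    ⟨contDiff_dl hsm' l, _, by positivity, g4.trans_lt ENNReal.ofReal_lt_top⟩
  refine ⟨⟨_, hmem⟩, rfl, ?_⟩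
  have g5 := (hCa ⟨_, hmem⟩ (g4.trans_lt ENNReal.ofReal_lt_top)).trans (mul_le_mul_right g4 _)
  have e : (Ca : ℝ≥0∞) = ENNReal.ofReal Ca := by simp
  rw [e, ← ENNReal.ofReal_mul (by positivity), ← ofReal_norm,
    ENNReal.ofReal_le_ofReal_iff (by positivity)] at g5
  refine g5.trans (le_of_eq ?_)
  rw [Real.exp_add]
  ring

theorem norm_le_of_fourier_le {v : 𝓢(Phase d, ℂ)} {c C : ℝ} (hs : 0 < s) (hσ : 0 < σ) (hc : 0 < c)
    (H : ∀ Z, ‖∫ X, ch Z X * v X‖ ≤ C * Real.exp (-c * gauge σ s Z)) :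
    ‖v 0‖ ≤ C * ∫ Ξ : Phase d, Real.exp (-c * gauge σ s (-(2 * Real.pi) • Ξ)) := by
  have h1 : v 0 = ∫ Ξ, 𝓕 v Ξ := by
    have : v 0 = 𝓕⁻ (𝓕 v) (0 : Phase d) := by
      rw [FourierTransform.fourierInv_fourier_eq (F := 𝓢(Phase d, ℂ)) v]
    rw [this, SchwartzMap.fourierInv_coe, Real.fourierInv_eq']
    simp
  have hi : Integrable fun Ξ : Phase d => Real.exp (-c * gauge σ s (-(2 * Real.pi) • Ξ)) :=
    (integrable_exp_gauge hσ hs hc).comp_smul (by simp)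
  rw [h1, ← integral_const_mul]
  refine norm_integral_le_of_norm_le (hi.const_mul _) (Filter.Eventually.of_forall fun Ξ => ?_)
  rw [SchwartzMap.fourier_coe, fourier_eq_integral_ch]
  exact H _

/-- The Fourier transform of the localized derivative of f has two bounds. The symbol estimates give
decay in frequency and small `h`, but growth at the rate of the weight. Continuity of the functional
gives small growth, but a large base. Their geometric mean with small exponent θ has small growth,
some decay in frequency and, after a suitable choice of `h`, the base δ. Fourier inversion at the
origin recovers the derivative. -/
theorem gam_exp_of_dual (hs : 0 < s) (hσ : 0 < σ) {a : SSpace d s σ σ s →ₗ[ℂ] ℂ}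
    (ha : ∀ h : ℝ, 0 < h → ∃ C : ℝ≥0, ∀ φ : SSpace d s σ σ s,
      gsNorm s σ σ s h (φ : Phase d → ℂ) < ∞ →
      ‖a φ‖ₑ ≤ C * gsNorm s σ σ s h (φ : Phase d → ℂ))
    (hw : IsModerate s σ w) (hf : IsGammaZero s σ w f)
    (haf : ∀ φ : SSpace d s σ σ s, a φ = ∫ X, f X * (φ : Phase d → ℂ) X)
    (hne : SSpace d s σ σ s ≠ ⊥) {δ η : ℝ} (hδ : 0 < δ) (hη : 0 < η) :
    ∃ C, 0 ≤ C ∧ Gam s σ δ C (fun X => Real.exp (η * gauge s σ X)) f := by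
  obtain ⟨hfs, hfG⟩ := (isGammaZero_iff hs.le hσ.le hw.pos).1 hf
  obtain ⟨r₀, C₀, hr₀, hC₀, h0⟩ := hw.le
  obtain ⟨r₁, C₁, hr₁, hC₁, h1⟩ := hw.exists_le_exp
  obtain ⟨φ, h₂, C₂, hφs, hφ0, hh₂, hC₂, hφ⟩ := exists_window hs hσ hne (r₀ + 1)
  obtain ⟨ρ, K₃, hρ, hK₃, h3⟩ := exists_fourier_decay d hs hσ (h := 2 * h₂) (by positivity)
  -- The growth of the weight contributes at most η/2 after interpolation.
  set θ := min (1 / 2) (η / (2 * r₁)) with hθ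
  have hθ0 : 0 < θ := by positivity
  have hθ1 : θ < 1 := (min_le_left _ _).trans_lt (by norm_num)
  have hθη : θ * r₁ ≤ η / 2 := by
    have := min_le_right (1 / 2) (η / (2 * r₁))
    rw [← hθ, le_div_iff₀ (by positivity)] at this
    linarith
  -- The entries give the other half of the growth η, preserve half of the frequency decay θρ, and
  -- keep ε below the decay rate of the window.
  set ε := min (min (η / 2) (θ * ρ / 2)) (r₀ + 1) with hε
  have hε0 : 0 < ε := by positivity
  have hε1 : ε ≤ η / 2 := (min_le_left _ _).trans (min_le_left _ _)
  have hε2 : ε ≤ θ * ρ / 2 := (min_le_left _ _).trans (min_le_right _ _)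
  obtain ⟨B, K₄, hB, hK₄, h4⟩ := localized_bound_dual hs hσ ha hφs hh₂ hC₂ hφ hε0
    (min_le_right _ _)
  -- Solves h^θ B^{1-θ} = δ. The base `B` is fixed before `h`, and the symbol class admits every
  -- `h`.
  set h := (δ / B ^ (1 - θ)) ^ (1 / θ) with hh
  have hh0 : 0 < h := by positivity
  have hhδ : h ^ θ * B ^ (1 - θ) = δ := by
    rw [hh, ← Real.rpow_mul (by positivity), one_div_mul_cancel hθ0.ne', Real.rpow_one]
    field_simp
  obtain ⟨K₅, hK₅, h5⟩ := localized_bound hs hσ hw hC₀ h0 hfs hfG hφs hh₂ hC₂ hφ hh0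
  have hc : 0 < θ * ρ / 2 := by positivity
  set J := ∫ Ξ : Phase d, Real.exp (-(θ * ρ / 2) * gauge σ s (-(2 * Real.pi) • Ξ)) with hJ
  have hJ0 : 0 ≤ J := integral_nonneg fun X => by positivity
  refine ⟨(K₃ * K₅ * C₁) ^ θ * K₄ ^ (1 - θ) * J, by positivity, fun l Y => ?_⟩
  set W := fr σ (cnt true l) * fr s (cnt false l) with hW
  have hW0 : 0 ≤ W := mul_nonneg (fr_nonneg _ _) (fr_nonneg _ _)
  have hwY := hw.pos Y
  have g1 := h5 l Y
  have hvs : ContDiff ℝ (⊤ : ℕ∞) ((fun X => dl l f (X + Y)) * φ) :=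
    (contDiff_translate (contDiff_dl hfs l) Y).mul hφs
  obtain ⟨v, hv⟩ := (g1.gs hs hσ (by positivity) (by positivity) one_pos).exists_schwartz hvs
  have hv0 : v 0 = dl l f Y := by rw [hv]; simp [hφ0]
  have key : ∀ Z, ‖∫ X, ch Z X * v X‖ ≤
      ((K₃ * K₅ * C₁) ^ θ * K₄ ^ (1 - θ) * (δ ^ l.length * W) * Real.exp (η * gauge s σ Y)) *
        Real.exp (-(θ * ρ / 2) * gauge σ s Z) := by
    intro Z
    have y0 := gauge_nonneg s σ Y
    have z0 := gauge_nonneg σ s Z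
    have b1 : ‖∫ X, ch Z X * v X‖ ≤ (K₃ * K₅ * C₁) * (h ^ l.length * W) *
        Real.exp (r₁ * gauge s σ Y + -ρ * gauge σ s Z) := by
      rw [hv]
      refine (h3 hvs (by positivity) g1 Z).trans ?_
      calc _ ≤ K₃ * (K₅ * (h ^ l.length * W) * (C₁ * Real.exp (r₁ * gauge s σ Y))) *
            Real.exp (-ρ * gauge σ s Z) := by gcongr; exact h1 Y
        _ = _ := by rw [Real.exp_add]; ring
    obtain ⟨τ, hτ, b2⟩ := h4 l Y Z
    -- Integration by parts and translation identify the Fourier integral, up to sign, with the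
    -- functional on the differentiated, modulated and translated window.
    have b3 : ‖∫ X, ch Z X * v X‖ = ‖a τ‖ := by
      have hsm : ContDiff ℝ (⊤ : ℕ∞) (fun X => (ch Z * φ) (X + -Y)) :=
        contDiff_translate ((contDiff_ch Z).mul hφs) (-Y)
      have hint : ∀ l₁ l₂, Integrable fun X =>
          dl l₁ f X * dl l₂ (fun X => (ch Z * φ) (X + -Y)) X := by
        exact fun l₁ l₂ => integrable_dl_mul_translate hs hσ h0 hfs hfG hφs hh₂ hC₂ hφ l₁ l₂ Y Z
      have i1 := integral_dl_mul hfs hsm hint l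
      rw [haf, hτ]
      have i2 := congrArg norm i1
      rw [norm_mul, norm_pow, norm_neg, norm_one, one_pow, one_mul] at i2
      rw [← i2, ← integral_add_right_eq_self (fun X => dl l f X * (ch Z * φ) (X + -Y)) Y, hv]
      congr 2
      funext X
      simp only [Pi.mul_apply, add_neg_cancel_right]
      ring
    rw [← b3] at b2
    refine (le_of_le_of_le_rpow (norm_nonneg _) (by positivity) hK₄ hh0.le hB.le hW0 hθ0 hθ1 b1
      b2).trans ?_
    rw [hhδ, mul_assoc _ (Real.exp _) (Real.exp _), ← Real.exp_add]
    have k1 : θ * r₁ * gauge s σ Y ≤ η / 2 * gauge s σ Y := by gcongr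
    have k2 : ε * gauge s σ Y ≤ η / 2 * gauge s σ Y := by gcongr
    have k3 : ε * gauge σ s Z ≤ θ * ρ / 2 * gauge σ s Z := by gcongr
    have k4 : 0 ≤ θ * (ε * gauge s σ Y) := by positivity
    have k5 : 0 ≤ θ * (ε * gauge σ s Z) := by positivity
    have k6 := Real.exp_le_exp.2 (show θ * (r₁ * gauge s σ Y + -ρ * gauge σ s Z) +
      (1 - θ) * (ε * gauge s σ Y + ε * gauge σ s Z) ≤
        η * gauge s σ Y + -(θ * ρ / 2) * gauge σ s Z by linarith)
    exact mul_le_mul_of_nonneg_left k6 (by positivity)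
  have := norm_le_of_fourier_le hs hσ hc key
  rw [hv0] at this
  refine this.trans (le_of_eq ?_)
  rw [← hJ]
  ring

theorem MemGammaZero.s_op (hs : 0 < s) (hσ : 0 < σ) (hsσ : s + σ = 1) (hw : IsModerate s σ w)
    (hV : IsInvariant (SSpace d s σ σ s)) (A : Matrix (Fin d) (Fin d) ℝ)
    {a : SSpace d s σ σ s →ₗ[ℂ] ℂ}
    (ha : ∀ h : ℝ, 0 < h → ∃ C : ℝ≥0, ∀ φ : SSpace d s σ σ s,
      gsNorm s σ σ s h (φ : Phase d → ℂ) < ∞ →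
      ‖a φ‖ₑ ≤ C * gsNorm s σ σ s h (φ : Phase d → ℂ))
    (hM : MemGammaZero s σ w a) : MemGammaZero s σ w (a ∘ₗ hV.op A) := by
  obtain ⟨f, hf, haf⟩ := hM
  by_cases hbot : SSpace d s σ σ s = ⊥
  · have h0 : ∀ φ : SSpace d s σ σ s, φ = 0 := fun φ =>
      Subtype.ext ((Submodule.eq_bot_iff _).1 hbot φ φ.2)
    refine ⟨f, hf, fun φ => ⟨(haf φ).1, ?_⟩⟩
    rw [h0 φ]
    simp
  have hg := hf.expGen hs hσ hsσ hw A
  refine ⟨_, hg, fun φ => ?_⟩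
  have h1 := integral_expGen_mul hs hσ hsσ A hf.1 (fun h ε hh hε =>
    gam_exp_of_dual hs hσ ha hw hf (fun φ => (haf φ).2) hbot hh hε) hg.1.continuous
    (u := hV.toS φ) (by rw [hV.coe_toS]; exact φ.2)
  rw [hV.coe_toS] at h1
  refine ⟨h1.1, ?_⟩
  rw [h1.2, LinearMap.comp_apply, (haf _).2, hV.coe_op]

end Growth

/-! ### The borderline case of the Beurling space -/

/-- For d = 0 the only matrix is 0; for d ≥ 1 the only element of the space is 0. -/
theorem TS_eq_self_of_mem_SigmaSpace {s σ : ℝ} (hs : 0 < s) (hσ : 0 < σ) (hsσ : s + σ = 1)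
    (A : Matrix (Fin d) (Fin d) ℝ) {u : 𝓢(Phase d, ℂ)} (hu : ⇑u ∈ SigmaSpace d s σ σ s) :
    TS A u = u := by
  rcases isEmpty_or_nonempty (Fin d) with hd | ⟨⟨j⟩⟩
  · rw [Subsingleton.elim A 0, TS_zero]
  · rw [SigmaSpace_eq_bot hs hσ hsσ j, Submodule.mem_bot] at hu
    have : u = 0 := DFunLike.coe_injective hu
    rw [this, map_zero]

theorem isInvariant_SigmaSpace_of_add_eq_one {s σ : ℝ} (hs : 0 < s) (hσ : 0 < σ)
    (hsσ : s + σ = 1) : IsInvariant (SigmaSpace d s σ σ s) where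
  exists_schwartz f hf := by
    obtain ⟨h1, H⟩ := (mem_SigmaSpace_iff hs hσ).1 hf
    obtain ⟨C, hC, H⟩ := H 1 one_pos
    exact H.exists_schwartz h1
  mem A u hu := by rwa [TS_eq_self_of_mem_SigmaSpace hs hσ hsσ A hu]

theorem comp_op_of_add_eq_one {s σ : ℝ} (hs : 0 < s) (hσ : 0 < σ) (hsσ : s + σ = 1)
    (hV : IsInvariant (SigmaSpace d s σ σ s)) (A : Matrix (Fin d) (Fin d) ℝ)
    (a : SigmaSpace d s σ σ s →ₗ[ℂ] ℂ) : a ∘ₗ hV.op A = a := by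
  ext φ
  rw [LinearMap.comp_apply]
  congr 1
  ext X
  rw [hV.coe_op, TS_eq_self_of_mem_SigmaSpace hs hσ hsσ A (by rw [hV.coe_toS]; exact φ.2),
    hV.coe_toS]

end

end GelfandShilov

theorem mainTheorem7 (d : ℕ) (s σ : ℝ) (hs : 0 < s) (hσ : 0 < σ) (hsσ : 1 ≤ s + σ)
    (A : Matrix (Fin d) (Fin d) ℝ) (ω : GelfandShilov.Phase d → ℝ)
    (hω : GelfandShilov.IsWeightP s σ ω) :
    (∀ a : GelfandShilov.SigmaDual d s σ σ s,
      (∃! b : GelfandShilov.SigmaDual d s σ σ s, GelfandShilov.IsExpADD A a.1 b.1) ∧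
      ∀ b : GelfandShilov.SigmaDual d s σ σ s, GelfandShilov.IsExpADD A a.1 b.1 →
        (GelfandShilov.MemGammaZero s σ ω a.1 ↔ GelfandShilov.MemGammaZero s σ ω b.1)) ∧
    (s + σ = 1 → ∀ a : GelfandShilov.SDual d s σ σ s,
      (∃! b : GelfandShilov.SDual d s σ σ s, GelfandShilov.IsExpADD A a.1 b.1) ∧
      ∀ b : GelfandShilov.SDual d s σ σ s, GelfandShilov.IsExpADD A a.1 b.1 →
        (GelfandShilov.MemGammaZero s σ ω a.1 ↔ GelfandShilov.MemGammaZero s σ ω b.1)) := by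
  have hw := hω.isModerate
  refine ⟨fun a => ?_, fun h1 a => ?_⟩
  · rcases hsσ.lt_or_eq with h1 | h1
    · have hV := GelfandShilov.isInvariant_SigmaSpace (d := d) hs hσ h1
      exact hV.exists_unique_and_iff (fun A a ha => GelfandShilov.SigmaDual_op hs hσ h1 hV A a ha)
        (fun A a _ ha => ha.sigma_op hs hσ h1 hw hV A) A a
    · have hV := GelfandShilov.isInvariant_SigmaSpace_of_add_eq_one (d := d) hs hσ h1.symm
      have e := GelfandShilov.comp_op_of_add_eq_one hs hσ h1.symm hV
      exact hV.exists_unique_and_iff (fun A a ha => by rwa [e]) (fun A a _ ha => by rwa [e]) A a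
  · have hV := GelfandShilov.isInvariant_SSpace (d := d) hs hσ hsσ
    exact hV.exists_unique_and_iff (fun A a ha => GelfandShilov.SDual_op hs hσ hsσ hV A a ha)
      (fun A a ha hM => hM.s_op hs hσ h1 hw hV A ha) A a
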